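/- Let $\mathcal F$ be a germ of (possibly singular) holomorphic foliation of codimension one on $(\mathbb C^n,0)$, defined by $\omega=0$, where $\omega$ is a germ of integrable holomorphic $1$-form whose coefficients have no common factor. Suppose that there are an open neighbourhood $U$ of $0$ in $\mathbb C^n$ and a composition $\pi : M\to U$ of finitely many blow-ups with nonsingular centers (closed complex submanifolds, of codimension at least one, of the successively obtained manifolds) such that every point $p\in\pi^{-1}(0)$ is a simple CH-point for the transformed foliation $\pi^*\mathcal F$; that is, there are an integer $\tau\geq 1$ and local holomorphic coordinates $x_1,\dots,x_n$ of $M$ centered at $p$ in which $\pi^*\mathcal F$ is given by $$\sum_{i=1}^{\tau}\bigl(\lambda_i+b_i(x_1,\dots,x_\tau)\bigr)\frac{dx_i}{x_i}=0,\qquad b_i\in\mathbb C\{x_1,\dots,x_\tau\},\quad b_i(0)=0,$$ where $\sum_{i=1}^\tau m_i\lambda_i\neq 0$ for every $(m_1,\dots,m_\tau)\in\mathbb Z_{\geq 0}^\tau\setminus\{0\}$. Then $\mathcal F$ is a CH-foliation: for every germ of holomorphic map $\phi:(\mathbb C^2,0)\to(\mathbb C^n,0)$ generically transversal to $\mathcal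 F$ (that is, $\phi^*\omega\not\equiv 0$), the foliation $\mathcal G=\phi^*\mathcal F$ on $(\mathbb C^2,0)$ has no saddle-nodes in its reduction of singularities. In other words: for every composition $\sigma:\Delta\to V$ of finitely many blow-ups of points over a neighbourhood $V$ of $0\in\mathbb C^2$ such that every point of $\sigma^{-1}(0)$ is for $\sigma^*\mathcal G$ either a regular point or a simple singularity (generated by a vector field whose linear part has eigenvalues $\alpha,\beta$ with $\beta\neq 0$ and $\alpha/\beta\notin\mathbb Q_{>0}$), no point of $\sigma^{-1}(0)$ is a saddle-node (a singularity with exactly one non-zero eigenvalue). -/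

import Mathlib

open Filter Topology
open scoped ContDiff Manifold

/-! ### Germs of holomorphic 1-forms at the origin of `ℂⁿ` -/

/-- Coordinate space `ℂⁿ`. -/
abbrev CSpace (n : ℕ) : Type := Fin n → ℂ

/-- Differential 1-forms `θ = ∑ θ_i(x) dx_i` of type `(1,0)` on `ℂⁿ`, given by the coefficients
`θ x i = θ_i(x)`. Only the germ at the origin of such a function is ever used. -/
abbrev OneForm (n : ℕ) : Type := CSpace n → CSpace n

/-- The partial derivative `∂f_i/∂x_j` at `x`. -/
noncomputable def partialD {m n : ℕ} (f : CSpace m → CSpace n) (x : CSpace m) (i : Fin n)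
    (j : Fin m) : ℂ :=
  fderiv ℂ f x (Pi.single j 1) i

/-- The pull-back `φ^* θ = ∑ θ_i(φ(x)) dφ_i` of a 1-form by a map `φ`. -/
noncomputable def OneForm.pullback {m n : ℕ} (φ : CSpace m → CSpace n) (θ : OneForm n) :
    OneForm m :=
  fun x j => ∑ i, θ (φ x) i * partialD φ x i j

/-- The germ at `0` of `θ` is the zero form. -/
def OneForm.IsZeroGerm {n : ℕ} (θ : OneForm n) : Prop :=
  ∀ᶠ x in 𝓝 (0 : CSpace n), θ x = 0

/-- The coefficient `∂θ_j/∂x_i - ∂θ_i/∂x_j` of `dx_i ∧ dx_j` in the exterior derivative `dθ`. -/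
noncomputable def OneForm.extD {n : ℕ} (θ : OneForm n) (x : CSpace n) (i j : Fin n) : ℂ :=
  partialD θ x j i - partialD θ x i j

/-- Frobenius integrability `θ ∧ dθ = 0` in a neighbourhood of the origin. -/
def OneForm.IsIntegrable {n : ℕ} (θ : OneForm n) : Prop :=
  ∀ᶠ x in 𝓝 (0 : CSpace n), ∀ i j k : Fin n,
    θ x i * θ.extD x j k + θ x j * θ.extD x k i + θ x k * θ.extD x i j = 0

/-- The coefficients of `θ` have no common factor in the ring of germs of holomorphic functions:
whenever `θ = g η` with `g`, `η` holomorphic, `g` is a unit. Equivalently, `θ` is not zero and its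
zero locus has codimension at least two. -/
def OneForm.IsSaturated {n : ℕ} (θ : OneForm n) : Prop :=
  ∀ (g : CSpace n → ℂ) (η : OneForm n), AnalyticAt ℂ g 0 → AnalyticAt ℂ η 0 →
    (∀ᶠ x in 𝓝 (0 : CSpace n), θ x = g x • η x) → g 0 ≠ 0

/-- The equations `θ = 0` and `η = 0` define the same codimension one foliation at the origin:
both germs are non-zero and `θ ∧ η = 0`, that is, they are proportional over the field of germs
of meromorphic functions. -/
def OneForm.SameFoliation {n : ℕ} (θ η : OneForm n) : Prop :=
  ¬ θ.IsZeroGerm ∧ ¬ η.IsZeroGerm ∧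
    ∀ᶠ x in 𝓝 (0 : CSpace n), ∀ i j : Fin n, θ x i * η x j = θ x j * η x i

/-! ### Germs of foliations -/

/-- A germ of (possibly singular) holomorphic foliation of codimension one on `(ℂⁿ, 0)`, given by
`form = 0`, where `form` is a germ of integrable holomorphic 1-form whose coefficients have no
common factor. -/
structure FoliationGerm (n : ℕ) where
  form : OneForm n
  analyticAt : AnalyticAt ℂ form 0
  integrable : form.IsIntegrable
  saturated : form.IsSaturated

/-! ### Simple complex hyperbolic points -/

/-- The holomorphic 1-form
`(x₁ ⋯ x_τ) ∑_{i ≤ τ} (λᵢ + bᵢ (x₁, …, x_τ)) d xᵢ / xᵢ` on `ℂⁿ`, where `τ ≤ n`. -/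
noncomputable def logForm {n τ : ℕ} (h : τ ≤ n) (lam : Fin τ → ℂ)
    (b : Fin τ → CSpace τ → ℂ) : OneForm n :=
  fun x k =>
    if hk : (k : ℕ) < τ then
      (lam ⟨k, hk⟩ + b ⟨k, hk⟩ (fun j => x (Fin.castLE h j))) *
        ∏ j ∈ Finset.univ.erase ⟨k, hk⟩, x (Fin.castLE h j)
    else 0

/-- `lam` is non-resonant: `∑ mᵢ λᵢ ≠ 0` for all `m ∈ ℕ^τ` other than `0`. -/
def IsNonResonant {τ : ℕ} (lam : Fin τ → ℂ) : Prop :=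
  ∀ m : Fin τ → ℕ, m ≠ 0 → ∑ i, (m i : ℂ) * lam i ≠ 0

/-- The foliation `θ = 0` is given, in the standard coordinates of `ℂⁿ`, by a 1-form
`∑_{i ≤ τ} (λᵢ + bᵢ (x₁, …, x_τ)) d xᵢ / xᵢ` with `bᵢ` holomorphic, `bᵢ 0 = 0` and non-resonant
`(λᵢ)`. The number `τ` is then the dimensional type of the foliation: a vector field tangent to it
has its `i`-th component divisible by `xᵢ` for every `i ≤ τ`. -/
def OneForm.IsSimpleCHInCoordinates {n : ℕ} (θ : OneForm n) : Prop :=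
  ∃ (τ : ℕ) (h : τ ≤ n) (lam : Fin τ → ℂ) (b : Fin τ → CSpace τ → ℂ),
    1 ≤ τ ∧ (∀ i, AnalyticAt ℂ (b i) 0) ∧ (∀ i, b i 0 = 0) ∧ IsNonResonant lam ∧
      θ.SameFoliation (logForm h lam b)

/-! ### Complex manifolds and blow-ups -/

/-- A Hausdorff complex manifold of dimension `n`. -/
structure CMfd (n : ℕ) where
  carrier : Type
  [top : TopologicalSpace carrier]
  [t2 : T2Space carrier]
  [charted : ChartedSpace (CSpace n) carrier]
  [manifold : IsManifold 𝓘(ℂ, CSpace n) ω carrier]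

instance (n : ℕ) : CoeSort (CMfd n) Type := ⟨CMfd.carrier⟩

attribute [instance] CMfd.top CMfd.t2 CMfd.charted CMfd.manifold

/-- An open subset of `ℂⁿ` as a complex manifold. -/
noncomputable def CMfd.ofOpens {n : ℕ} (U : TopologicalSpace.Opens (CSpace n)) : CMfd n where
  carrier := U

/-- The charts (holomorphic local coordinate systems) of a complex manifold. -/
noncomputable def CMfd.charts {n : ℕ} (M : CMfd n) : Set (OpenPartialHomeomorph M (CSpace n)) :=
  IsManifold.maximalAtlas 𝓘(ℂ, CSpace n) ω M

/-- The `i`-th affine chart of the blow-up of `ℂⁿ` along the linear subspace `x_j = 0`, `j ∈ S`: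
`x_i = u_i`, `x_j = u_i u_j` for the other `j ∈ S`, and `x_j = u_j` for `j ∉ S`. -/
def blowUpChart {n : ℕ} (S : Finset (Fin n)) (i : Fin n) (u : CSpace n) : CSpace n :=
  fun j => if j ∈ S ∧ j ≠ i then u i * u j else u j

/-- `g : M' → M` is the blow-up of the complex manifold `M` with nonsingular center `Y`.

Every point of `M` has a coordinate neighbourhood `e` in which `Y` is the locus of zeros of the
coordinates with index in a non-empty set `S` (so `Y` is a closed submanifold, of codimension at
least one, possibly empty), and over which `g` is the standard blow-up of the open set `e.target`
of `ℂⁿ` along this linear subspace: the inverse image of the coordinate neighbourhood is covered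
by charts `c i`, `i ∈ S`, in which `g` is `blowUpChart S i`, and the `j`-th chart meets the `i`-th
one precisely in the part where the `j`-th coordinate of the `i`-th chart does not vanish. (The
transition maps between the charts `c i` are then determined by `g`.) Outside `Y` one may take a
coordinate without zeros and `S` with one element: there `g` is locally a biholomorphism. -/
def IsBlowUp {n : ℕ} {M' M : CMfd n} (g : M' → M) (Y : Set M) : Prop :=
  ∀ y : M, ∃ e ∈ M.charts, y ∈ e.source ∧
    ∃ S : Finset (Fin n), S.Nonempty ∧
      (∀ p ∈ e.source, p ∈ Y ↔ ∀ i ∈ S, e p i = 0) ∧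
      ∃ c : Fin n → OpenPartialHomeomorph M' (CSpace n),
        (∀ i ∈ S, c i ∈ M'.charts ∧ (c i).target = blowUpChart S i ⁻¹' e.target ∧
          ∀ p ∈ (c i).source, g p ∈ e.source ∧ e (g p) = blowUpChart S i (c i p)) ∧
        (∀ p : M', g p ∈ e.source → ∃ i ∈ S, p ∈ (c i).source) ∧
        (∀ i ∈ S, ∀ j ∈ S, i ≠ j → ∀ p ∈ (c i).source, p ∈ (c j).source ↔ c i p j ≠ 0)

/-- `π : M → U ⊆ ℂⁿ` is a composition of finitely many blow-ups with nonsingular centers,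
starting from the open set `U`. Each center is a closed submanifold of the manifold obtained so
far, and it has to satisfy `IsCenter`. The map `π` is regarded as a map to `ℂⁿ`. -/
inductive IsBlowUpComposition {n : ℕ} (IsCenter : ∀ M : CMfd n, Set M → Prop)
    (U : TopologicalSpace.Opens (CSpace n)) : ∀ M : CMfd n, (M → CSpace n) → Prop
  | base : IsBlowUpComposition IsCenter U (CMfd.ofOpens U) (fun x : U => (x : CSpace n))
  | step {M M' : CMfd n} {π : M → CSpace n} {g : M' → M} {Y : Set M} :
      IsBlowUpComposition IsCenter U M π → IsCenter M Y → IsBlowUp g Y →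
        IsBlowUpComposition IsCenter U M' (π ∘ g)

/-- Compositions of blow-ups with arbitrary nonsingular centers. -/
def IsNonsingularBlowUpComposition {n : ℕ} (U : TopologicalSpace.Opens (CSpace n)) (M : CMfd n)
    (π : M → CSpace n) : Prop :=
  IsBlowUpComposition (fun _ _ => True) U M π

/-- Compositions of blow-ups of points. -/
def IsPointBlowUpComposition {n : ℕ} (U : TopologicalSpace.Opens (CSpace n)) (M : CMfd n)
    (π : M → CSpace n) : Prop :=
  IsBlowUpComposition (fun _ Y => ∃ p, Y = {p}) U M π

/-- In suitable holomorphic coordinates of `M` centered at the point `p`, the transform by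
`π : M → ℂⁿ` of the 1-form `θ` has the property `P`. -/
def TransformHas {n : ℕ} (P : OneForm n → Prop) {M : CMfd n} (π : M → CSpace n)
    (θ : OneForm n) (p : M) : Prop :=
  ∃ e ∈ M.charts, p ∈ e.source ∧ e p = 0 ∧ P (θ.pullback (π ∘ e.symm))

/-- The point `p ∈ M`, with `π p = 0`, is a simple complex hyperbolic point for the transform
`π^* F` of the foliation `F`. -/
def FoliationGerm.IsSimpleCHPoint {n : ℕ} (F : FoliationGerm n) {M : CMfd n} (π : M → CSpace n)
    (p : M) : Prop :=
  TransformHas OneForm.IsSimpleCHInCoordinates π F.form p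

/-! ### Foliations in dimension two and their reduction of singularities -/

/-- `η` is a saturated holomorphic generator of the foliation given by the 1-form `θ`. -/
def OneForm.IsGenerator {n : ℕ} (η θ : OneForm n) : Prop :=
  AnalyticAt ℂ η 0 ∧ η.IsSaturated ∧ θ.SameFoliation η

/-- The vector field `η₂ ∂/∂x₁ - η₁ ∂/∂x₂` tangent to `η₁ dx₁ + η₂ dx₂ = 0`. -/
def OneForm.dualField (η : OneForm 2) : CSpace 2 → CSpace 2 :=
  fun x => ![η x 1, -(η x 0)]

/-- The foliation `θ = 0` on `(ℂ², 0)` is non-singular at the origin. -/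
def OneForm.IsRegular (θ : OneForm 2) : Prop :=
  ∃ η : OneForm 2, η.IsGenerator θ ∧ η 0 ≠ 0

/-- The foliation `θ = 0` on `(ℂ², 0)` is singular at the origin and it is generated by a vector
field whose linear part has the eigenvalues `α`, `β`, with multiplicity (and with isolated
singularity, as the generator `η` is saturated). -/
def OneForm.HasEigenvalues (θ : OneForm 2) (α β : ℂ) : Prop :=
  ∃ η : OneForm 2, η.IsGenerator θ ∧ η 0 = 0 ∧
    (fderiv ℂ η.dualField 0).toLinearMap.charpoly =
      (Polynomial.X - Polynomial.C α) * (Polynomial.X - Polynomial.C β)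

/-- Simple singularity in the sense of Seidenberg: `β ≠ 0` and `α / β` is not a positive rational
number. -/
def OneForm.IsSimpleSingularity (θ : OneForm 2) : Prop :=
  ∃ α β : ℂ, θ.HasEigenvalues α β ∧ β ≠ 0 ∧ ∀ r : ℚ, 0 < r → α / β ≠ (r : ℂ)

/-- Saddle-node: a singularity with exactly one non-zero eigenvalue. -/
def OneForm.IsSaddleNode (θ : OneForm 2) : Prop :=
  ∃ β : ℂ, θ.HasEigenvalues 0 β ∧ β ≠ 0

/-- `σ : Δ → V` is a reduction of singularities of the foliation `θ = 0` on `(ℂ², 0)`: a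
composition of blow-ups of points over a neighbourhood `V` of the origin, such that every point
over the origin is a regular point or a simple singularity of the transformed foliation. -/
def IsReductionOfSingularities (θ : OneForm 2) (V : TopologicalSpace.Opens (CSpace 2))
    (Δ : CMfd 2) (σ : Δ → CSpace 2) : Prop :=
  (0 : CSpace 2) ∈ V ∧ IsPointBlowUpComposition V Δ σ ∧
    ∀ q : Δ, σ q = 0 →
      TransformHas OneForm.IsRegular σ θ q ∨ TransformHas OneForm.IsSimpleSingularity σ θ q

/-- The foliation `θ = 0` on `(ℂ², 0)` is a generalized curve: no saddle-node appears in its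
reduction of singularities (whichever reduction is taken: saddle-nodes survive further blow-ups
and do not come from points that are already regular or simple with non-zero eigenvalues). -/
def OneForm.IsGeneralizedCurve (θ : OneForm 2) : Prop :=
  ∀ (V : TopologicalSpace.Opens (CSpace 2)) (Δ : CMfd 2) (σ : Δ → CSpace 2),
    IsReductionOfSingularities θ V Δ σ →
      ∀ q : Δ, σ q = 0 → ¬ TransformHas OneForm.IsSaddleNode σ θ q

/-! ### Complex hyperbolic foliations -/

/-- `φ` is generically transversal to `F`: the pull-back of the saturated 1-form defining `F` is
not identically zero. -/
def FoliationGerm.IsGenericallyTransversal {n : ℕ} (F : FoliationGerm n)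
    (φ : CSpace 2 → CSpace n) : Prop :=
  ¬ (F.form.pullback φ).IsZeroGerm

/-- `F` is a complex hyperbolic foliation: the pull-back of `F` by every germ of holomorphic map
`φ : (ℂ², 0) → (ℂⁿ, 0)` generically transversal to `F` is a generalized curve. -/
def FoliationGerm.IsCHFoliation {n : ℕ} (F : FoliationGerm n) : Prop :=
  ∀ φ : CSpace 2 → CSpace n, AnalyticAt ℂ φ 0 → φ 0 = 0 → F.IsGenericallyTransversal φ →
    (F.form.pullback φ).IsGeneralizedCurve

/-! Suppose that a saddle-node occurs over the origin, and let `A dx + B dy` generate it. Linear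
coordinates adapted to the eigenvectors bring its linear part to `a y dx` with `a ≠ 0`, so that the
x-axis is the weak direction. Blowing up in that direction, in the chart `(x, x (y + c x))` with a
suitable `c`, and dividing by `x` gives a form of the same kind. Saddle-nodes therefore generate
infinite towers of blow-ups that follow the weak separatrix.

Such a tower resolves every non-zero germ into a monomial times a unit
(`OneForm.IsNormalized.exists_resolving_tower`). If the weak separatrix converges, it is
straightened to `y = 0`, all `c` are `0`, and the blow-ups compose to `(x, x^N y)`. If no invariant
graph exists, every germ even becomes a power of `x` times a unit: a smooth curve passing through
all the infinitely near points would be invariant (`IsTower.becomesPower_of_pd_ne_zero`), and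
general germs reduce to this case by differentiating in `y` (`IsTower.becomesPower_of_pd`).

Divisibility is consequently a total preorder on germs up to further blow-ups, so the ideals of the
centers become principal and the map to `ℂⁿ` lifts through `π` (`IsBlowUpComposition.exists_lift`).
The lift ends at a simple CH-point. Its components along the divisor do not vanish identically,
because the divisor is invariant, and further up the tower they become `x^(aᵢ) y^(mᵢ)` times units
with `aᵢ ≥ 1`. The logarithmic form then pulls back to `U dx/x + V dy/y`, with `U 0 = ∑ aᵢ λᵢ ≠ 0`
and `V 0 = ∑ mᵢ λᵢ`. Proportionality to the saddle-node reads `x A V = y B U`.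

If some `mᵢ` is non-zero, then `V` is a unit by non-resonance, and the linear part `a y dx` excludes
the relation (`OneForm.IsNormalized.not_saddle`). If all `mᵢ` vanish, then `y` divides `V` and `B =
x E A`. The power of `x` in this relation grows at each blow-up, whereas `B` is merely composed with
the blow-ups and ends as a fixed power of `x` times a unit (`IsTower.not_eq_mul`). -/

/-! ### Division of analytic germs by a linear form -/

section Division

variable {E F : Type*} [NormedAddCommGroup E] [NormedSpace ℂ E] [NormedAddCommGroup F]
  [NormedSpace ℂ F]

/-- The projection onto the kernel of `ℓ` along `e`, where `ℓ e = 1`. -/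
noncomputable def kerProj (ℓ : E →L[ℂ] ℂ) (e : E) : E →L[ℂ] E :=
  ContinuousLinearMap.id ℂ E - ℓ.smulRight e

theorem kerProj_apply (ℓ : E →L[ℂ] ℂ) (e z : E) : kerProj ℓ e z = z - ℓ z • e := rfl

/-- The series of the quotient of a power series by the linear form `ℓ`. -/
noncomputable def FormalMultilinearSeries.divLinear (p : FormalMultilinearSeries ℂ E F)
    (ℓ : E →L[ℂ] ℂ) (e : E) : FormalMultilinearSeries ℂ E F := fun n =>
  ∑ k : Fin (n + 1), ((p (n + 1)).compContinuousLinearMap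
    (fun j => if j < k then kerProj ℓ e else ContinuousLinearMap.id ℂ E)).curryMid k e

theorem FormalMultilinearSeries.norm_divLinear_le (p : FormalMultilinearSeries ℂ E F)
    (ℓ : E →L[ℂ] ℂ) (e : E) (n : ℕ) :
    ‖p.divLinear ℓ e n‖ ≤ (n + 1) * (‖p (n + 1)‖ * (1 + ‖kerProj ℓ e‖) ^ (n + 1) * ‖e‖) := by
  unfold FormalMultilinearSeries.divLinear
  refine (norm_sum_le _ _).trans ?_
  have : ∀ k ∈ (Finset.univ : Finset (Fin (n + 1))),
      ‖((p (n + 1)).compContinuousLinearMap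
    (fun j => if j < k then kerProj ℓ e else ContinuousLinearMap.id ℂ E)).curryMid k e‖ ≤
      ‖p (n + 1)‖ * (1 + ‖kerProj ℓ e‖) ^ (n + 1) * ‖e‖ := by
    intro k _
    refine (ContinuousLinearMap.le_opNorm _ _).trans ?_
    gcongr
    rw [ContinuousMultilinearMap.norm_curryMid]
    refine (ContinuousMultilinearMap.norm_compContinuousLinearMap_le _ _).trans ?_
    gcongr
    calc _ ≤ ∏ j : Fin (n + 1), (1 + ‖kerProj ℓ e‖) := by
          refine Finset.prod_le_prod (fun _ _ => norm_nonneg _) fun j _ => ?_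
          have h1 : ‖ContinuousLinearMap.id ℂ E‖ ≤ 1 := ContinuousLinearMap.norm_id_le
          have h2 := norm_nonneg (kerProj ℓ e)
          split_ifs <;> linarith
      _ = _ := by simp
  refine (Finset.sum_le_card_nsmul _ _ _ this).trans ?_
  simp

/-- The right-hand side telescopes when the arguments `z` are replaced by `kerProj ℓ e z` one slot
at a time. Each replacement changes slot `k` by `z - kerProj ℓ e z = ℓ z • e`, which is the `k`-th
summand of the quotient series. -/
theorem FormalMultilinearSeries.smul_divLinear (p : FormalMultilinearSeries ℂ E F)
    (ℓ : E →L[ℂ] ℂ) (e : E) (n : ℕ) (z : E) :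
    ℓ z • p.divLinear ℓ e n (fun _ => z) =
      p (n + 1) (fun _ => z) - p (n + 1) (fun _ => kerProj ℓ e z) := by
  have key : ∀ k : Fin (n + 1), ℓ z • (((p (n + 1)).compContinuousLinearMap
    (fun j => if j < k then kerProj ℓ e else ContinuousLinearMap.id ℂ E)).curryMid k e) (fun _ => z) =
      p (n + 1) (fun j => if (j : ℕ) < k then kerProj ℓ e z else z) -
      p (n + 1) (fun j => if (j : ℕ) < k + 1 then kerProj ℓ e z else z) := by
    intro k
    obtain ⟨v, hv⟩ : ∃ v : Fin (n + 1) → E,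
        v = fun j : Fin (n + 1) => if (j : ℕ) < k then kerProj ℓ e z else z := ⟨_, rfl⟩
    have h1 : (fun j : Fin (n + 1) => if (j : ℕ) < k then kerProj ℓ e z else z) =
        Function.update v k z := by
      funext j
      by_cases h : j = k
      · subst h; simp
      · simp [h, hv]
    have h2 : (fun j : Fin (n + 1) => if (j : ℕ) < k + 1 then kerProj ℓ e z else z) =
        Function.update v k (kerProj ℓ e z) := by
      funext j
      by_cases h : j = k
      · subst h; simp
      · have : (j : ℕ) ≠ k := fun h' => h (Fin.ext h')
        simp only [Function.update_of_ne h, hv]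
        congr 1
        simp only [eq_iff_iff]; omega
    have h3 : (((p (n + 1)).compContinuousLinearMap
        (fun j => if j < k then kerProj ℓ e else ContinuousLinearMap.id ℂ E)).curryMid k e) (fun _ => z) =
        p (n + 1) (Function.update v k e) := by
      rw [ContinuousMultilinearMap.curryMid_apply,
        ContinuousMultilinearMap.compContinuousLinearMap_apply]
      congr 1
      funext j
      refine Fin.succAboveCases k ?_ (fun i => ?_) j
      · simp
      · rw [Fin.insertNth_apply_succAbove, Function.update_of_ne (Fin.succAbove_ne k i), hv]
        by_cases hlt : k.succAbove i < k
        · simp [hlt, Fin.lt_def.1 hlt]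
        · have : ¬ ((k.succAbove i : Fin (n + 1)) : ℕ) < k := fun h => hlt (Fin.lt_def.2 h)
          simp [hlt, this]
    rw [h1, h2, h3, ← ContinuousMultilinearMap.map_update_sub, kerProj_apply, sub_sub_cancel,
      ContinuousMultilinearMap.map_update_smul]
  unfold FormalMultilinearSeries.divLinear
  rw [sum_apply, Finset.smul_sum, Finset.sum_congr rfl fun k _ => key k]
  rw [Fin.sum_univ_eq_sum_range (fun k => p (n + 1) (fun j => if (j : ℕ) < k then kerProj ℓ e z else z)
    - p (n + 1) (fun j => if (j : ℕ) < k + 1 then kerProj ℓ e z else z)),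
    Finset.sum_range_sub' (fun k => p (n + 1) (fun j => if (j : ℕ) < k then kerProj ℓ e z else z))]
  congr 2
  funext j
  simp [Nat.lt_succ_iff.1 j.2]

theorem FormalMultilinearSeries.divLinear_radius_pos (p : FormalMultilinearSeries ℂ E F)
    (ℓ : E →L[ℂ] ℂ) (e : E) (hp : 0 < p.radius) : 0 < (p.divLinear ℓ e).radius := by
  obtain ⟨ρ, hρ0, hρ⟩ := ENNReal.lt_iff_exists_nnreal_btwn.1 hp
  have hρ0' : (0 : ℝ) < ρ := by exact_mod_cast hρ0
  obtain ⟨C, hC, hp⟩ := p.norm_mul_pow_le_of_lt_radius hρ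
  set M : ℝ := 1 + ‖kerProj ℓ e‖ with hM
  have hM0 : 0 < M := by positivity
  -- The factor `M` absorbs the geometric growth `M ^ (n + 1)` of the coefficients, and `2` absorbs
  -- the number `n + 1 ≤ 2 ^ n` of summands.
  set r : NNReal := ρ / (2 * M.toNNReal) with hr
  have hr' : (r : ℝ) = ρ / (2 * M) := by simp [hr, hM0.le]
  have hr0 : 0 < r := by
    have : (0 : ℝ) < r := by rw [hr']; positivity
    exact_mod_cast this
  refine lt_of_lt_of_le (by exact_mod_cast hr0)
    (FormalMultilinearSeries.le_radius_of_bound _ (C * M * ‖e‖ / ρ) (r := r) fun n => ?_)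
  have h1 := p.norm_divLinear_le ℓ e n
  have h2 := hp (n + 1)
  have h3 : ((n : ℝ) + 1) ≤ 2 ^ n := by exact_mod_cast Nat.lt_two_pow_self (n := n)
  calc _ ≤ (n + 1) * (‖p (n + 1)‖ * M ^ (n + 1) * ‖e‖) * (r : ℝ) ^ n := by gcongr
    _ = ((n + 1) / 2 ^ n) * ((‖p (n + 1)‖ * ρ ^ (n + 1)) * M * ‖e‖ / ρ) := by
      rw [hr', div_pow, mul_pow, pow_succ M, pow_succ (ρ : ℝ)]; field_simp
    _ ≤ 1 * (C * M * ‖e‖ / ρ) := by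
      gcongr
      rw [div_le_one (by positivity)]; exact h3
    _ = _ := one_mul _

/-- Vanishing on the kernel of `ℓ` makes the composite of `f` with the projection a zero germ, so
every homogeneous term of its series vanishes. The telescoping identity then exhibits each term of
`f` as `ℓ` times a term of the quotient series. -/
theorem AnalyticAt.exists_eq_smul_of_eq_zero [CompleteSpace F] {f : E → F}
    (hf : AnalyticAt ℂ f 0) (ℓ : E →L[ℂ] ℂ) (e : E) (he : ℓ e = 1)
    (h : ∀ᶠ z in 𝓝 (0 : E), ℓ z = 0 → f z = 0) :
    ∃ g : E → F, AnalyticAt ℂ g 0 ∧ ∀ᶠ z in 𝓝 (0 : E), f z = ℓ z • g z := by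
  obtain ⟨p, hp⟩ := hf
  have hP0 : kerProj ℓ e 0 = 0 := map_zero _
  have hℓP : ∀ z, ℓ (kerProj ℓ e z) = 0 := fun z => by simp [kerProj_apply, he]
  have hPc : Tendsto (kerProj ℓ e) (𝓝 0) (𝓝 0) := by
    simpa [hP0] using (kerProj ℓ e).continuous.tendsto 0
  have hcomp : HasFPowerSeriesAt (0 : E → F) (p.compContinuousLinearMap (kerProj ℓ e)) 0 := by
    have := HasFPowerSeriesAt.compContinuousLinearMap (u := kerProj ℓ e) (x := 0) (by rwa [hP0])
    refine this.congr ?_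
    filter_upwards [hPc.eventually h] with z hz
    simpa using hz (hℓP z)
  have hzero : ∀ n z, p n (fun _ => kerProj ℓ e z) = 0 := by
    intro n z
    simpa [FormalMultilinearSeries.compContinuousLinearMap, Function.comp_def] using
      hcomp.apply_eq_zero n z
  have hq := (p.divLinear ℓ e).hasFPowerSeriesOnBall
    (p.divLinear_radius_pos ℓ e hp.radius_pos)
  refine ⟨(p.divLinear ℓ e).sum, hq.analyticAt, ?_⟩
  filter_upwards [hp.eventually_hasSum, hq.hasFPowerSeriesAt.eventually_hasSum] with z h1 h2
  rw [zero_add] at h1 h2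
  have h3 := h2.const_smul (ℓ z)
  simp only [FormalMultilinearSeries.smul_divLinear, hzero, sub_zero] at h3
  have h4 := (hasSum_nat_add_iff' (f := fun n => p n (fun _ => z)) 1).2 h1
  have h5 : p 0 (fun _ => z) = 0 := by
    rw [← hzero 0 z]; congr 1; exact Subsingleton.elim _ _
  simp only [Finset.range_one, Finset.sum_singleton, h5, sub_zero] at h4
  exact h4.unique h3

end Division

/-! ### Germs of analytic functions -/

/-- Near a point `b` of a small ball where `f b ≠ 0`, the factor `g` vanishes identically; the
identity theorem spreads this over the ball. -/
theorem AnalyticAt.eventually_eq_zero_or_of_mul {E : Type*} [NormedAddCommGroup E]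
    [NormedSpace ℂ E] {f g : E → ℂ} {a : E} (hf : AnalyticAt ℂ f a) (hg : AnalyticAt ℂ g a)
    (h : ∀ᶠ z in 𝓝 a, f z * g z = 0) :
    (∀ᶠ z in 𝓝 a, f z = 0) ∨ (∀ᶠ z in 𝓝 a, g z = 0) := by
  by_contra hcon
  obtain ⟨hf0, hg0⟩ := not_or.1 hcon
  obtain ⟨r, hr, hball⟩ := Metric.eventually_nhds_iff_ball.1
    (hf.eventually_analyticAt.and (hg.eventually_analyticAt.and h))
  obtain ⟨b, hb, hfb⟩ : ∃ b ∈ Metric.ball a r, f b ≠ 0 := by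
    by_contra! hall
    exact hf0 (Metric.eventually_nhds_iff_ball.2 ⟨r, hr, hall⟩)
  apply hg0
  have hgb : g =ᶠ[𝓝 b] 0 := by
    filter_upwards [(hball b hb).1.continuousAt.eventually_ne hfb,
      Metric.isOpen_ball.mem_nhds hb] with z hz hzb
    exact (mul_eq_zero.1 (hball z hzb).2.2).resolve_left hz
  have := AnalyticOnNhd.eqOn_zero_of_preconnected_of_eventuallyEq_zero
    (f := g) (U := Metric.ball a r) (fun z hz => (hball z hz).2.1)
    (convex_ball a r).isPreconnected hb hgb
  exact Metric.eventually_nhds_iff_ball.2 ⟨r, hr, this⟩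

/-- Germs form a domain. This is the cancellation by which identities are divided by powers of a
coordinate throughout. -/
theorem AnalyticAt.eventually_eq_of_mul_eq {E : Type*} [NormedAddCommGroup E]
    [NormedSpace ℂ E] {u f g : E → ℂ} {a : E} (hu : AnalyticAt ℂ u a) (hf : AnalyticAt ℂ f a)
    (hg : AnalyticAt ℂ g a) (hu0 : ¬ ∀ᶠ z in 𝓝 a, u z = 0)
    (h : ∀ᶠ z in 𝓝 a, u z * f z = u z * g z) : f =ᶠ[𝓝 a] g := by
  have := (hu.eventually_eq_zero_or_of_mul (hf.sub hg) (by
    filter_upwards [h] with z hz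
    simp [mul_sub, hz])).resolve_left hu0
  filter_upwards [this] with z hz
  exact sub_eq_zero.1 hz

theorem analyticAt_coord {n : ℕ} (i : Fin n) (a : CSpace n) :
    AnalyticAt ℂ (fun z : CSpace n => z i) a :=
  (ContinuousLinearMap.proj (R := ℂ) (φ := fun _ : Fin n => ℂ) i).analyticAt a

theorem not_eventually_coord_eq_zero {n : ℕ} (i : Fin n) :
    ¬ ∀ᶠ z in 𝓝 (0 : CSpace n), z i = 0 := by
  intro h
  have h1 : Tendsto (fun t : ℂ => (Pi.single i t : CSpace n)) (𝓝 0) (𝓝 0) := by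
    have : Continuous (fun t : ℂ => (Pi.single i t : CSpace n)) := continuous_pi fun j => by
      by_cases hj : j = i
      · subst hj; simpa using continuous_id'
      · simpa [Pi.single_apply, hj] using continuous_const
    simpa using this.tendsto 0
  have h2 := h1.eventually h
  simp only [Pi.single_eq_same] at h2
  have h3 : ∀ᶠ t : ℂ in 𝓝[≠] 0, t = 0 := h2.filter_mono nhdsWithin_le_nhds
  have h4 : ∀ᶠ t : ℂ in 𝓝[≠] 0, t ≠ 0 := eventually_mem_nhdsWithin
  obtain ⟨t, ht⟩ := (h3.and h4).exists
  exact ht.2 ht.1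

theorem not_eventually_pow_eq_zero {n : ℕ} (i : Fin n) (k : ℕ) :
    ¬ ∀ᶠ z in 𝓝 (0 : CSpace n), z i ^ k = 0 := fun h =>
  not_eventually_coord_eq_zero i (h.mono fun _ hz => eq_zero_of_pow_eq_zero hz)

theorem AnalyticAt.exists_eq_coord_mul {n : ℕ} {f : CSpace n → ℂ} (hf : AnalyticAt ℂ f 0)
    (i : Fin n) (h : ∀ᶠ z in 𝓝 (0 : CSpace n), z i = 0 → f z = 0) :
    ∃ g : CSpace n → ℂ, AnalyticAt ℂ g 0 ∧ ∀ᶠ z in 𝓝 (0 : CSpace n), f z = z i * g z :=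
  hf.exists_eq_smul_of_eq_zero (ContinuousLinearMap.proj (R := ℂ) (φ := fun _ : Fin n => ℂ) i)
    (Pi.single i 1) (by simp) (by simpa using h)

/-! ### Partial derivatives -/

/-- The partial derivative `∂f/∂x_j`. -/
noncomputable def pd {n : ℕ} (j : Fin n) (f : CSpace n → ℂ) (x : CSpace n) : ℂ :=
  fderiv ℂ f x (Pi.single j 1)

theorem AnalyticAt.pd {n : ℕ} {f : CSpace n → ℂ} {a : CSpace n} (hf : AnalyticAt ℂ f a)
    (j : Fin n) : AnalyticAt ℂ (pd j f) a :=
  AnalyticAt.comp (g := fun L : CSpace n →L[ℂ] ℂ => L (Pi.single j 1))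
    ((ContinuousLinearMap.apply ℂ ℂ (Pi.single j 1 : CSpace n)).analyticAt _) hf.fderiv

theorem Filter.EventuallyEq.pd {n : ℕ} {f g : CSpace n → ℂ} {a : CSpace n} (h : f =ᶠ[𝓝 a] g)
    (j : Fin n) : pd j f =ᶠ[𝓝 a] pd j g := by
  filter_upwards [h.fderiv (𝕜 := ℂ)] with z hz
  simp [_root_.pd, hz]

theorem pd_add {n : ℕ} (j : Fin n) {f g : CSpace n → ℂ} {x : CSpace n}
    (hf : DifferentiableAt ℂ f x) (hg : DifferentiableAt ℂ g x) :
    pd j (fun z => f z + g z) x = pd j f x + pd j g x := by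
  simp [pd, fderiv_fun_add hf hg]

theorem pd_mul {n : ℕ} (j : Fin n) {f g : CSpace n → ℂ} {x : CSpace n}
    (hf : DifferentiableAt ℂ f x) (hg : DifferentiableAt ℂ g x) :
    pd j (fun z => f z * g z) x = pd j f x * g x + f x * pd j g x := by
  simp [pd, fderiv_fun_mul hf hg]; ring

theorem pd_const {n : ℕ} (j : Fin n) (c : ℂ) (x : CSpace n) : pd j (fun _ => c) x = 0 := by
  simp [pd]

theorem pd_coord {n : ℕ} (j i : Fin n) (x : CSpace n) :
    pd j (fun z => z i) x = if i = j then 1 else 0 := by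
  have : (fun z : CSpace n => z i) =
    ContinuousLinearMap.proj (R := ℂ) (φ := fun _ : Fin n => ℂ) i := rfl
  rw [pd, this, ContinuousLinearMap.fderiv]
  simp [Pi.single_apply]

theorem pd_coord_pow {n : ℕ} (j i : Fin n) (k : ℕ) (x : CSpace n) :
    pd j (fun z => z i ^ k) x = if i = j then k * x i ^ (k - 1) else 0 := by
  have hd : HasFDerivAt (fun z : CSpace n => z i)
    (ContinuousLinearMap.proj (R := ℂ) (φ := fun _ : Fin n => ℂ) i) x :=
    (ContinuousLinearMap.proj (R := ℂ) (φ := fun _ : Fin n => ℂ) i).hasFDerivAt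
  have hp : HasFDerivAt (fun z : CSpace n => z i ^ k) _ x :=
    (hasDerivAt_pow k (x i)).comp_hasFDerivAt x hd
  rw [pd, hp.fderiv]
  simp [Pi.single_apply]

theorem pd_eq_partialD {m n : ℕ} {f : CSpace m → CSpace n} {x : CSpace m}
    (hf : DifferentiableAt ℂ f x) (i : Fin n) (j : Fin m) :
    partialD f x i j = pd j (fun z => f z i) x := by
  rw [partialD, pd, fderiv_apply hf]
  rfl

theorem fderiv_eq_sum_pd {n : ℕ} (f : CSpace n → ℂ) (x v : CSpace n) :
    fderiv ℂ f x v = ∑ i, v i * pd i f x := by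
  conv_lhs => rw [pi_eq_sum_univ' v]
  rw [map_sum]
  refine Finset.sum_congr rfl fun i _ => ?_
  rw [map_smul, smul_eq_mul, pd]

theorem pd_comp {m n : ℕ} (j : Fin m) {f : CSpace n → ℂ} {G : CSpace m → CSpace n} {x : CSpace m}
    (hf : DifferentiableAt ℂ f (G x)) (hG : DifferentiableAt ℂ G x) :
    pd j (fun z => f (G z)) x = ∑ i, pd j (fun z => G z i) x * pd i f (G x) := by
  have : (fun z => f (G z)) = f ∘ G := rfl
  rw [pd, this, fderiv_comp x hf hG, ContinuousLinearMap.comp_apply, fderiv_eq_sum_pd]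
  refine Finset.sum_congr rfl fun i _ => ?_
  rw [← pd_eq_partialD hG]
  rfl

theorem hasDerivAt_comp_curve {n : ℕ} {f : CSpace n → ℂ} {γ : ℂ → CSpace n} {t : ℂ}
    {γ' : CSpace n} (hf : DifferentiableAt ℂ f (γ t)) (hγ : HasDerivAt γ γ' t) :
    HasDerivAt (fun s => f (γ s)) (∑ i, γ' i * pd i f (γ t)) t := by
  rw [← fderiv_eq_sum_pd]
  exact hf.hasFDerivAt.comp_hasDerivAt t hγ

/-! ### Pull-backs of 1-forms -/

theorem OneForm.pullback_pullback_apply {l m n : ℕ} (θ : OneForm n) {φ : CSpace m → CSpace n}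
    {χ : CSpace l → CSpace m} {z : CSpace l} (hφ : DifferentiableAt ℂ φ (χ z))
    (hχ : DifferentiableAt ℂ χ z) :
    (θ.pullback φ).pullback χ z = θ.pullback (φ ∘ χ) z := by
  funext j
  simp only [OneForm.pullback, Function.comp_apply, Finset.sum_mul]
  rw [Finset.sum_comm]
  refine Finset.sum_congr rfl fun k _ => ?_
  have h1 : partialD (φ ∘ χ) z k j = ∑ i, partialD χ z i j * partialD φ (χ z) k i := by
    have hc : DifferentiableAt ℂ (φ ∘ χ) z := hφ.comp z hχ
    rw [pd_eq_partialD hc]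
    have := pd_comp j (f := fun y => φ y k) (G := χ) (x := z)
      (differentiableAt_pi.1 hφ k) hχ
    refine this.trans ?_
    refine Finset.sum_congr rfl fun i _ => ?_
    rw [pd_eq_partialD hχ, pd_eq_partialD hφ]
  rw [h1, Finset.mul_sum]
  refine Finset.sum_congr rfl fun i _ => ?_
  ring

theorem OneForm.pullback_pullback {l m n : ℕ} (θ : OneForm n) {φ : CSpace m → CSpace n}
    {χ : CSpace l → CSpace m} {a : CSpace l} (hφ : AnalyticAt ℂ φ (χ a)) (hχ : AnalyticAt ℂ χ a) :
    (θ.pullback φ).pullback χ =ᶠ[𝓝 a] θ.pullback (φ ∘ χ) := by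
  filter_upwards [hχ.eventually_analyticAt,
    hχ.continuousAt.eventually hφ.eventually_analyticAt] with z h1 h2
  exact θ.pullback_pullback_apply h2.differentiableAt h1.differentiableAt

theorem OneForm.pullback_congr {m n : ℕ} (θ : OneForm n) {φ φ' : CSpace m → CSpace n}
    {a : CSpace m} (h : φ =ᶠ[𝓝 a] φ') : θ.pullback φ =ᶠ[𝓝 a] θ.pullback φ' := by
  filter_upwards [h, h.fderiv (𝕜 := ℂ)] with z h1 h2
  funext j
  simp [OneForm.pullback, partialD, h1, h2]

theorem OneForm.pullback_congr_left {m n : ℕ} {θ θ' : OneForm n} {φ : CSpace m → CSpace n}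
    {a : CSpace m} (hφ : ContinuousAt φ a) (h : θ =ᶠ[𝓝 (φ a)] θ') :
    θ.pullback φ =ᶠ[𝓝 a] θ'.pullback φ := by
  filter_upwards [hφ.eventually h] with z h1
  funext j
  simp [OneForm.pullback, h1]

theorem AnalyticAt.partialD {m n : ℕ} {f : CSpace m → CSpace n} {a : CSpace m}
    (hf : AnalyticAt ℂ f a) (i : Fin n) (j : Fin m) :
    AnalyticAt ℂ (fun x => partialD f x i j) a := by
  have h1 : AnalyticAt ℂ (fun x => fderiv ℂ f x (Pi.single j 1)) a :=
    AnalyticAt.comp (g := fun L : CSpace m →L[ℂ] CSpace n => L (Pi.single j 1))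
      ((ContinuousLinearMap.apply ℂ (CSpace n) (Pi.single j 1 : CSpace m)).analyticAt _) hf.fderiv
  exact analyticAt_pi_iff.1 h1 i

theorem AnalyticAt.coord {E : Type*} [NormedAddCommGroup E] [NormedSpace ℂ E] {n : ℕ}
    {f : E → CSpace n} {a : E} (hf : AnalyticAt ℂ f a) (i : Fin n) :
    AnalyticAt ℂ (fun x => f x i) a := analyticAt_pi_iff.1 hf i

theorem OneForm.analyticAt_pullback {m n : ℕ} {θ : OneForm n} {φ : CSpace m → CSpace n}
    {a : CSpace m} (hθ : AnalyticAt ℂ θ (φ a)) (hφ : AnalyticAt ℂ φ a) :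
    AnalyticAt ℂ (θ.pullback φ) a := by
  refine analyticAt_pi_iff.2 fun j => ?_
  refine Finset.analyticAt_fun_sum _ fun i _ => ?_
  exact ((hθ.comp hφ).coord i).mul (hφ.partialD i j)

theorem OneForm.pullback_smul {m n : ℕ} (g : CSpace n → ℂ) (θ : OneForm n)
    (φ : CSpace m → CSpace n) :
    OneForm.pullback φ (fun x => g x • θ x) = fun z => g (φ z) • θ.pullback φ z := by
  funext z j
  simp [OneForm.pullback, Finset.mul_sum, mul_assoc]

/-- Pull-backs preserve proportionality. -/
theorem OneForm.pullback_wedge {m n : ℕ} {θ η : OneForm n} {φ : CSpace m → CSpace n} {z : CSpace m}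
    (h : ∀ i j, θ (φ z) i * η (φ z) j = θ (φ z) j * η (φ z) i) (i j : Fin m) :
    θ.pullback φ z i * η.pullback φ z j = θ.pullback φ z j * η.pullback φ z i := by
  simp only [OneForm.pullback, Finset.sum_mul_sum]
  rw [Finset.sum_comm]
  refine Finset.sum_congr rfl fun k _ => Finset.sum_congr rfl fun l _ => ?_
  linear_combination (partialD φ z l i * partialD φ z k j) * h l k

/-- Proportionality is transitive through a non-zero germ. -/
theorem OneForm.wedge_trans {n : ℕ} {ρ θ η : OneForm n} (hρ : AnalyticAt ℂ ρ 0)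
    (hθ : AnalyticAt ℂ θ 0) (hη : AnalyticAt ℂ η 0) (h0 : ¬ ρ.IsZeroGerm)
    (h1 : ∀ᶠ x in 𝓝 (0 : CSpace n), ∀ i j : Fin n, ρ x i * θ x j = ρ x j * θ x i)
    (h2 : ∀ᶠ x in 𝓝 (0 : CSpace n), ∀ i j : Fin n, ρ x i * η x j = ρ x j * η x i) :
    ∀ᶠ x in 𝓝 (0 : CSpace n), ∀ i j : Fin n, θ x i * η x j = θ x j * η x i := by
  obtain ⟨k, hk⟩ : ∃ k, ¬ ∀ᶠ x in 𝓝 (0 : CSpace n), ρ x k = 0 := by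
    by_contra! hall
    exact h0 ((eventually_all.2 hall).mono fun x hx => funext hx)
  rw [eventually_all]; intro i
  rw [eventually_all]; intro j
  refine AnalyticAt.eventually_eq_of_mul_eq ((hρ.coord k).mul (hρ.coord k))
    ((hθ.coord i).mul (hη.coord j)) ((hθ.coord j).mul (hη.coord i)) (fun h => hk ?_) ?_
  · exact h.mono fun x hx => by simpa using hx
  · filter_upwards [h1, h2] with x h1 h2
    have e1 := h1 k i
    have e2 := h1 k j
    have e3 := h2 k i
    have e4 := h2 k j
    simp only [Pi.mul_apply]
    linear_combination (ρ x k * η x j) * e1 + ρ x i * θ x k * e4 - ρ x k * η x i * e2 - ρ x j * θ x k * e3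

/-! ### Directional blow-ups of the plane -/

theorem analyticAt_vec2 {E : Type*} [NormedAddCommGroup E] [NormedSpace ℂ E] {f g : E → ℂ} {a : E}
    (hf : AnalyticAt ℂ f a) (hg : AnalyticAt ℂ g a) :
    AnalyticAt ℂ (fun z => (![f z, g z] : CSpace 2)) a :=
  analyticAt_pi_iff.2 (Fin.forall_fin_two.2 ⟨by simpa using hf, by simpa using hg⟩)

theorem hasDerivAt_vec2 {f g : ℂ → ℂ} {f' g' t : ℂ} (hf : HasDerivAt f f' t)
    (hg : HasDerivAt g g' t) :
    HasDerivAt (fun z => (![f z, g z] : CSpace 2)) ![f', g'] t :=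
  hasDerivAt_pi.2 (Fin.forall_fin_two.2 ⟨by simpa using hf, by simpa using hg⟩)

/-- The chart `(x, y) ↦ (x, x (y + c x))` of the blow-up of the origin of `ℂ²`. -/
noncomputable def dirBlowUp (c : ℂ) (z : CSpace 2) : CSpace 2 := ![z 0, z 0 * (z 1 + c * z 0)]

@[simp] theorem dirBlowUp_apply_zero (c : ℂ) (z : CSpace 2) : dirBlowUp c z 0 = z 0 := rfl

@[simp] theorem dirBlowUp_apply_one (c : ℂ) (z : CSpace 2) :
    dirBlowUp c z 1 = z 0 * (z 1 + c * z 0) := rfl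

theorem dirBlowUp_eq_zero (c : ℂ) {z : CSpace 2} (h : z 0 = 0) : dirBlowUp c z = 0 := by
  funext i; fin_cases i <;> simp [h]

@[simp] theorem dirBlowUp_zero (c : ℂ) : dirBlowUp c 0 = 0 := dirBlowUp_eq_zero c rfl

theorem analyticAt_dirBlowUp (c : ℂ) (a : CSpace 2) : AnalyticAt ℂ (dirBlowUp c) a := by
  have h0 := analyticAt_coord (n := 2) 0 a
  have h1 := analyticAt_coord (n := 2) 1 a
  exact analyticAt_vec2 h0 (h0.mul (h1.add (analyticAt_const.mul h0)))

theorem tendsto_dirBlowUp (c : ℂ) : Tendsto (dirBlowUp c) (𝓝 0) (𝓝 0) := by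
  simpa using (analyticAt_dirBlowUp c 0).continuousAt.tendsto

theorem AnalyticAt.comp_dirBlowUp {f : CSpace 2 → ℂ} (hf : AnalyticAt ℂ f 0) (c : ℂ) :
    AnalyticAt ℂ (fun z => f (dirBlowUp c z)) 0 :=
  AnalyticAt.comp (g := f) (by simpa using hf) (analyticAt_dirBlowUp c 0)

theorem pd_zero_dirBlowUp_one (c : ℂ) (z : CSpace 2) :
    pd 0 (fun z => dirBlowUp c z 1) z = z 1 + 2 * c * z 0 := by
  have h0 := (analyticAt_coord (n := 2) 0 z).differentiableAt
  have h1 := (analyticAt_coord (n := 2) 1 z).differentiableAt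
  have hc : DifferentiableAt ℂ (fun _ : CSpace 2 => c) z := differentiableAt_const c
  simp only [dirBlowUp_apply_one]
  rw [pd_mul 0 h0 (h1.fun_add (hc.fun_mul h0)), pd_add 0 h1 (hc.fun_mul h0), pd_mul 0 hc h0, pd_const,
    pd_coord, pd_coord]
  simp; ring

theorem pd_one_dirBlowUp_one (c : ℂ) (z : CSpace 2) :
    pd 1 (fun z => dirBlowUp c z 1) z = z 0 := by
  have h0 := (analyticAt_coord (n := 2) 0 z).differentiableAt
  have h1 := (analyticAt_coord (n := 2) 1 z).differentiableAt
  have hc : DifferentiableAt ℂ (fun _ : CSpace 2 => c) z := differentiableAt_const c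
  simp only [dirBlowUp_apply_one]
  rw [pd_mul 1 h0 (h1.fun_add (hc.fun_mul h0)), pd_add 1 h1 (hc.fun_mul h0), pd_mul 1 hc h0, pd_const,
    pd_coord, pd_coord]
  simp

theorem pullback_dirBlowUp_zero (c : ℂ) (η : OneForm 2) (z : CSpace 2) :
    η.pullback (dirBlowUp c) z 0 =
      η (dirBlowUp c z) 0 + η (dirBlowUp c z) 1 * (z 1 + 2 * c * z 0) := by
  have hd := (analyticAt_dirBlowUp c z).differentiableAt
  rw [OneForm.pullback, Fin.sum_univ_two, pd_eq_partialD hd, pd_eq_partialD hd,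
    pd_zero_dirBlowUp_one]
  simp [pd_coord]

theorem pullback_dirBlowUp_one (c : ℂ) (η : OneForm 2) (z : CSpace 2) :
    η.pullback (dirBlowUp c) z 1 = η (dirBlowUp c z) 1 * z 0 := by
  have hd := (analyticAt_dirBlowUp c z).differentiableAt
  rw [OneForm.pullback, Fin.sum_univ_two, pd_eq_partialD hd, pd_eq_partialD hd,
    pd_one_dirBlowUp_one]
  simp [pd_coord]

theorem pd_zero_comp_dirBlowUp (c : ℂ) {f : CSpace 2 → ℂ} {z : CSpace 2}
    (hf : DifferentiableAt ℂ f (dirBlowUp c z)) :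
    pd 0 (fun z => f (dirBlowUp c z)) z =
      pd 0 f (dirBlowUp c z) + (z 1 + 2 * c * z 0) * pd 1 f (dirBlowUp c z) := by
  rw [pd_comp 0 hf (analyticAt_dirBlowUp c z).differentiableAt, Fin.sum_univ_two,
    pd_zero_dirBlowUp_one]
  simp [pd_coord]

theorem pd_one_comp_dirBlowUp (c : ℂ) {f : CSpace 2 → ℂ} {z : CSpace 2}
    (hf : DifferentiableAt ℂ f (dirBlowUp c z)) :
    pd 1 (fun z => f (dirBlowUp c z)) z = z 0 * pd 1 f (dirBlowUp c z) := by
  rw [pd_comp 1 hf (analyticAt_dirBlowUp c z).differentiableAt, Fin.sum_univ_two,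
    pd_one_dirBlowUp_one]
  simp [pd_coord]

theorem pd_coord_mul_zero {n : ℕ} (i j : Fin n) {g : CSpace n → ℂ} (hg : AnalyticAt ℂ g 0) :
    pd j (fun z => z i * g z) 0 = if i = j then g 0 else 0 := by
  rw [pd_mul j (analyticAt_coord i 0).differentiableAt hg.differentiableAt, pd_coord]
  simp

/-- A germ vanishing at the origin becomes divisible by `x` after a blow-up. -/
theorem AnalyticAt.exists_strictTransform {f : CSpace 2 → ℂ} (hf : AnalyticAt ℂ f 0)
    (h0 : f 0 = 0) (c : ℂ) :
    ∃ g : CSpace 2 → ℂ, AnalyticAt ℂ g 0 ∧ (∀ᶠ z in 𝓝 0, f (dirBlowUp c z) = z 0 * g z) ∧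
      g 0 = _root_.pd 0 f 0 ∧ _root_.pd 1 g =ᶠ[𝓝 0] fun z => _root_.pd 1 f (dirBlowUp c z) := by
  obtain ⟨g, hg, hfg⟩ := (hf.comp_dirBlowUp c).exists_eq_coord_mul 0
    (Eventually.of_forall fun z hz => by rw [dirBlowUp_eq_zero c hz, h0])
  refine ⟨g, hg, hfg, ?_, ?_⟩
  · have h1 := (EventuallyEq.pd hfg 0).self_of_nhds
    rw [pd_zero_comp_dirBlowUp c (by simpa using hf.differentiableAt),
      pd_coord_mul_zero 0 0 hg] at h1
    simpa using h1.symm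
  · refine AnalyticAt.eventually_eq_of_mul_eq (analyticAt_coord 0 0) (hg.pd 1)
      ((hf.pd 1).comp_dirBlowUp c) (not_eventually_coord_eq_zero 0) ?_
    filter_upwards [EventuallyEq.pd hfg 1, (tendsto_dirBlowUp c).eventually
      hf.eventually_analyticAt, hg.eventually_analyticAt] with z h1 h2 h3
    rw [pd_one_comp_dirBlowUp c h2.differentiableAt, pd_mul 1
      (analyticAt_coord 0 z).differentiableAt h3.differentiableAt, pd_coord] at h1
    simpa using h1.symm

/-! ### Normalized saddle-nodes and their transforms -/

/-- The linear part of `η = A dx + B dy` at the origin is `a y dx` with `a ≠ 0`. -/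
structure OneForm.IsNormalized (η : OneForm 2) : Prop where
  analyticAt : AnalyticAt ℂ η 0
  zero : η 0 = 0
  pd_zero_zero : pd 0 (fun z => η z 0) 0 = 0
  pd_one_zero : pd 1 (fun z => η z 0) 0 ≠ 0
  pd_zero_one : pd 0 (fun z => η z 1) 0 = 0
  pd_one_one : pd 1 (fun z => η z 1) 0 = 0

/-- `η'` is the transform of `η` by a directional blow-up. -/
def OneForm.IsTransform (c : ℂ) (η η' : OneForm 2) : Prop :=
  η.pullback (dirBlowUp c) =ᶠ[𝓝 0] fun z => z 0 • η' z

/-- The blown-up coordinate contributes `x dy`, and this `x` is exactly the factor divided out. The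
`dy` coefficient is thus only composed with the blow-up, a rigidity on which the final contradiction
rests. -/
theorem OneForm.IsTransform.coord_one {c : ℂ} {η η' : OneForm 2} (h : η.IsTransform c η')
    (hη : AnalyticAt ℂ η 0) (hη' : AnalyticAt ℂ η' 0) :
    ∀ᶠ z in 𝓝 0, η' z 1 = η (dirBlowUp c z) 1 := by
  refine AnalyticAt.eventually_eq_of_mul_eq (analyticAt_coord 0 0) (hη'.coord 1)
      ((hη.coord 1).comp_dirBlowUp c) (not_eventually_coord_eq_zero 0) ?_
  filter_upwards [h] with z hz
  have := congrFun hz 1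
  rw [pullback_dirBlowUp_one] at this
  simp only [Pi.smul_apply, smul_eq_mul] at this
  rw [← this, mul_comm]

theorem OneForm.IsTransform.coord_zero {c : ℂ} {η η' : OneForm 2} (h : η.IsTransform c η') :
    ∀ᶠ z in 𝓝 0, z 0 * η' z 0 =
      η (dirBlowUp c z) 0 + η (dirBlowUp c z) 1 * (z 1 + 2 * c * z 0) := by
  filter_upwards [h] with z hz
  have := congrFun hz 0
  rw [pullback_dirBlowUp_zero] at this
  simpa using this.symm

/-- The shear `(x, y) ↦ (x, y + c x)`. -/
noncomputable def linearShear (c : ℂ) (z : CSpace 2) : CSpace 2 := ![z 0, z 1 + c * z 0]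

theorem analyticAt_linearShear (c : ℂ) (a : CSpace 2) : AnalyticAt ℂ (linearShear c) a := by
  have h0 := analyticAt_coord (n := 2) 0 a
  have h1 := analyticAt_coord (n := 2) 1 a
  exact analyticAt_vec2 h0 (h1.add (analyticAt_const.mul h0))

@[simp] theorem linearShear_zero (c : ℂ) : linearShear c 0 = 0 := by
  funext i; fin_cases i <;> simp [linearShear]

theorem tendsto_linearShear (c : ℂ) : Tendsto (linearShear c) (𝓝 0) (𝓝 0) := by
  simpa using (analyticAt_linearShear c 0).continuousAt.tendsto

theorem AnalyticAt.comp_linearShear {f : CSpace 2 → ℂ} (hf : AnalyticAt ℂ f 0) (c : ℂ) :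
    AnalyticAt ℂ (fun z => f (linearShear c z)) 0 :=
  AnalyticAt.comp (g := f) (by simpa using hf) (analyticAt_linearShear c 0)

/-- The parameter `c` amounts to a shear in the chart of the standard blow-up, so it can be chosen
after the division by `x` has been carried out with `c = 0`. -/
theorem dirBlowUp_zero_linearShear (c : ℂ) (z : CSpace 2) :
    dirBlowUp 0 (linearShear c z) = dirBlowUp c z := by
  funext i; fin_cases i <;> simp [linearShear]

theorem pd_comp_linearShear (c : ℂ) {f : CSpace 2 → ℂ} (hf : AnalyticAt ℂ f 0) :
    pd 0 (fun z => f (linearShear c z)) 0 = pd 0 f 0 + c * pd 1 f 0 ∧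
      pd 1 (fun z => f (linearShear c z)) 0 = pd 1 f 0 := by
  have h0 := (analyticAt_coord (n := 2) 0 0).differentiableAt
  have h1 := (analyticAt_coord (n := 2) 1 0).differentiableAt
  have hc : DifferentiableAt ℂ (fun _ : CSpace 2 => c) 0 := differentiableAt_const c
  have hd := (analyticAt_linearShear c 0).differentiableAt
  have hf' : DifferentiableAt ℂ f (linearShear c 0) := by simpa using hf.differentiableAt
  have key : ∀ j : Fin 2, pd j (fun z => linearShear c z 1) 0 =
      (if (1 : Fin 2) = j then 1 else 0) + c * (if (0 : Fin 2) = j then 1 else 0) := by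
    intro j
    have : (fun z : CSpace 2 => linearShear c z 1) = fun z => z 1 + c * z 0 := rfl
    rw [this, pd_add j h1 (hc.fun_mul h0), pd_mul j hc h0, pd_const, pd_coord, pd_coord]
    ring
  have key0 : ∀ j : Fin 2, pd j (fun z => linearShear c z 0) 0 =
      (if (0 : Fin 2) = j then 1 else 0) := fun j => pd_coord j 0 0
  constructor
  · rw [pd_comp 0 hf' hd, Fin.sum_univ_two, key, key0]; simp
  · rw [pd_comp 1 hf' hd, Fin.sum_univ_two, key, key0]; simp

/-- Since `A` has order one and `B` order at least two, `A` becomes `x A₁` and `B` becomes `x² B₂`.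
Dividing by `x` leaves `A₁ + x B₂ (y + 2 c x)` and `x² B₂`, with `A₁` and `B₂` read after the shear;
only `A₁` contributes to the linear part. -/
theorem OneForm.IsNormalized.exists_transform_aux {η : OneForm 2} (hη : η.IsNormalized) :
    ∃ e : ℂ, ∀ c : ℂ, ∃ η' : OneForm 2, AnalyticAt ℂ η' 0 ∧ η' 0 = 0 ∧
      pd 0 (fun z => η' z 0) 0 = e + c * pd 1 (fun z => η z 0) 0 ∧
      pd 1 (fun z => η' z 0) 0 = pd 1 (fun z => η z 0) 0 ∧
      pd 0 (fun z => η' z 1) 0 = 0 ∧ pd 1 (fun z => η' z 1) 0 = 0 ∧ η.IsTransform c η' := by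
  have hA := hη.analyticAt.coord 0
  have hB := hη.analyticAt.coord 1
  obtain ⟨A₁, hA₁, hAA, hA₁0, hA₁1⟩ := hA.exists_strictTransform (by simp [hη.zero]) 0
  obtain ⟨B₁, hB₁, hBB, -, -⟩ := hB.exists_strictTransform (by simp [hη.zero]) 0
  -- Differentiating `B ∘ dirBlowUp 0 = x B₁` in `x` on the line `x = 0` expresses `B₁` there
  -- through the first derivatives of `B` at the origin, which vanish.
  obtain ⟨B₂, hB₂, hBB₂⟩ := hB₁.exists_eq_coord_mul 0 (by
    filter_upwards [EventuallyEq.pd hBB 0, (tendsto_dirBlowUp 0).eventually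
      hB.eventually_analyticAt, hB₁.eventually_analyticAt] with z h1 h2 h3 hz
    rw [pd_zero_comp_dirBlowUp 0 h2.differentiableAt, pd_mul 0
      (analyticAt_coord 0 z).differentiableAt h3.differentiableAt, pd_coord,
      dirBlowUp_eq_zero 0 hz, hη.pd_zero_one, hη.pd_one_one, hz] at h1
    simpa using h1.symm)
  have hA₁1' := hA₁1.self_of_nhds
  simp only [dirBlowUp_zero] at hA₁1'
  rw [hη.pd_zero_zero] at hA₁0
  -- The unwanted coefficient of `x dx` is that of the standard transform; the shear then adds `c`
  -- times the coefficient of `y dx`.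
  refine ⟨pd 0 A₁ 0, fun c => ?_⟩
  have hA₁c := hA₁.comp_linearShear c
  have hB₂c := hB₂.comp_linearShear c
  have h0 := analyticAt_coord (n := 2) 0 0
  have h1 := analyticAt_coord (n := 2) 1 0
  have hC : AnalyticAt ℂ (fun z : CSpace 2 => B₂ (linearShear c z) * (z 1 + 2 * c * z 0)) 0 :=
    hB₂c.mul (h1.add (analyticAt_const.mul h0))
  have hD : AnalyticAt ℂ (fun z : CSpace 2 => z 0 * B₂ (linearShear c z)) 0 := h0.mul hB₂c
  refine ⟨fun z => ![A₁ (linearShear c z) + z 0 * (B₂ (linearShear c z) * (z 1 + 2 * c * z 0)),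
    z 0 * (z 0 * B₂ (linearShear c z))], analyticAt_vec2 (hA₁c.add (h0.mul hC)) (h0.mul hD),
    ?_, ?_, ?_, ?_, ?_, ?_⟩
  · funext i; fin_cases i <;> simp [hA₁0]
  · simp only [Matrix.cons_val_zero]
    rw [pd_add 0 hA₁c.differentiableAt (h0.fun_mul hC).differentiableAt, pd_coord_mul_zero 0 0 hC,
      (pd_comp_linearShear c hA₁).1, hA₁1']
    simp
  · simp only [Matrix.cons_val_zero]
    rw [pd_add 1 hA₁c.differentiableAt (h0.fun_mul hC).differentiableAt, pd_coord_mul_zero 0 1 hC,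
      (pd_comp_linearShear c hA₁).2, hA₁1']
    simp
  · simp only [Matrix.cons_val_one, Matrix.cons_val_fin_one]
    rw [pd_coord_mul_zero 0 0 hD]
    simp
  · simp only [Matrix.cons_val_one, Matrix.cons_val_fin_one]
    rw [pd_coord_mul_zero 0 1 hD]
    simp
  · have hAA' := (tendsto_linearShear c).eventually hAA
    have hBB' := (tendsto_linearShear c).eventually hBB
    have hBB₂' := (tendsto_linearShear c).eventually hBB₂
    filter_upwards [hAA', hBB', hBB₂'] with z e1 e2 e3
    rw [dirBlowUp_zero_linearShear] at e1 e2
    have e0 : linearShear c z 0 = z 0 := rfl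
    rw [e0] at e1 e2 e3
    rw [e3] at e2
    funext i
    fin_cases i
    · simp only [Fin.zero_eta, pullback_dirBlowUp_zero, e1, e2, Pi.smul_apply, smul_eq_mul,
        Matrix.cons_val_zero]
      ring
    · simp only [Fin.mk_one, pullback_dirBlowUp_one, e2, Pi.smul_apply, smul_eq_mul,
        Matrix.cons_val_one, Matrix.cons_val_fin_one]
      ring

theorem OneForm.IsNormalized.exists_transform {η : OneForm 2} (hη : η.IsNormalized) :
    ∃ (c : ℂ) (η' : OneForm 2), η'.IsNormalized ∧ η.IsTransform c η' := by
  obtain ⟨e, he⟩ := hη.exists_transform_aux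
  -- This `c` solves `e + c a = 0`, where `a` is the coefficient of `y dx`, and so turns the x-axis
  -- back into the weak direction.
  obtain ⟨η', h1, h2, h3, h4, h5, h6, h7⟩ := he (-e / pd 1 (fun z => η z 0) 0)
  refine ⟨_, η', ⟨h1, h2, ?_, ?_, h5, h6⟩, h7⟩
  · rw [h3]; field_simp [hη.pd_one_zero]; ring
  · rw [h4]; exact hη.pd_one_zero

/-- The derivative of a germ along a coordinate axis on which it vanishes. -/
theorem pd_eq_zero_of_axis {f : CSpace 2 → ℂ} (hf : AnalyticAt ℂ f 0)
    (h : ∀ᶠ z in 𝓝 (0 : CSpace 2), z 1 = 0 → f z = 0) : pd 0 f 0 = 0 := by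
  have hγ : HasDerivAt (fun t : ℂ => (![t, 0] : CSpace 2)) ![1, 0] 0 :=
    hasDerivAt_vec2 (hasDerivAt_id _) (hasDerivAt_const _ _)
  have hγ0 : (![0, 0] : CSpace 2) = 0 := by funext i; fin_cases i <;> rfl
  have h1 := hasDerivAt_comp_curve (f := f) (γ := fun t : ℂ => (![t, 0] : CSpace 2))
    (by simpa [hγ0] using hf.differentiableAt) hγ
  have h2 : (fun t : ℂ => f ![t, 0]) =ᶠ[𝓝 0] fun _ => 0 := by
    have ht : Tendsto (fun t : ℂ => (![t, 0] : CSpace 2)) (𝓝 0) (𝓝 0) := by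
      simpa [hγ0] using hγ.continuousAt.tendsto
    filter_upwards [ht.eventually h] with t ht
    exact ht (by simp)
  have h3 := h1.congr_of_eventuallyEq h2.symm
  have h4 := h3.unique (hasDerivAt_const (0 : ℂ) (0 : ℂ))
  simpa [hγ0] using h4

/-- If the axis `y = 0` is invariant, so is its strict transform. The term in `x dx` is then
automatically zero and no shear is needed. -/
theorem OneForm.IsNormalized.exists_transform_of_axis {η : OneForm 2} (hη : η.IsNormalized)
    (h : ∀ᶠ z in 𝓝 (0 : CSpace 2), z 1 = 0 → η z 0 = 0) :
    ∃ η' : OneForm 2, η'.IsNormalized ∧ η.IsTransform 0 η' ∧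
      ∀ᶠ z in 𝓝 (0 : CSpace 2), z 1 = 0 → η' z 0 = 0 := by
  obtain ⟨e, he⟩ := hη.exists_transform_aux
  obtain ⟨η', h1, h2, h3, h4, h5, h6, h7⟩ := he 0
  have hax : ∀ᶠ z in 𝓝 (0 : CSpace 2), z 1 = 0 → η' z 0 = 0 := by
    filter_upwards [h7.coord_zero, (tendsto_dirBlowUp 0).eventually h] with z e1 e2 hz
    rw [e2 (by simp [hz]), hz] at e1
    by_cases hz0 : z 0 = 0
    · have : z = 0 := by funext i; fin_cases i <;> simp [hz, hz0]
      rw [this, h2]; rfl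
    · simpa [hz0] using e1
  refine ⟨η', ⟨h1, h2, pd_eq_zero_of_axis (h1.coord 0) hax, ?_, h5, h6⟩, h7, hax⟩
  rw [h4]; exact hη.pd_one_zero

/-! ### Towers of blow-ups following a saddle-node -/

/-- The composition of the directional blow-ups between the levels `s` and `s + N`. -/
noncomputable def iterBlowUp (c : ℕ → ℂ) : ℕ → ℕ → CSpace 2 → CSpace 2
  | _, 0 => id
  | s, N + 1 => dirBlowUp (c s) ∘ iterBlowUp c (s + 1) N

theorem iterBlowUp_add (c : ℕ → ℂ) (s N K : ℕ) :
    iterBlowUp c s (N + K) = iterBlowUp c s N ∘ iterBlowUp c (s + N) K := by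
  induction N generalizing s with
  | zero => simp [iterBlowUp]
  | succ N ih =>
    rw [show N + 1 + K = (N + K) + 1 by ring, iterBlowUp, ih, iterBlowUp,
      show s + 1 + N = s + (N + 1) by ring]
    rfl

theorem iterBlowUp_succ (c : ℕ → ℂ) (s N : ℕ) :
    iterBlowUp c s (N + 1) = iterBlowUp c s N ∘ dirBlowUp (c (s + N)) := by
  rw [iterBlowUp_add]; rfl

@[simp] theorem iterBlowUp_apply_zero (c : ℕ → ℂ) (s N : ℕ) (z : CSpace 2) :
    iterBlowUp c s N z 0 = z 0 := by
  induction N generalizing s with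
  | zero => rfl
  | succ N ih => rw [iterBlowUp, Function.comp_apply, dirBlowUp_apply_zero, ih]

theorem iterBlowUp_apply_one {c : ℕ → ℂ} (hc : ∀ j, c j = 0) (s N : ℕ) (z : CSpace 2) :
    iterBlowUp c s N z 1 = z 0 ^ N * z 1 := by
  induction N generalizing s with
  | zero => simp [iterBlowUp]
  | succ N ih =>
    rw [iterBlowUp, Function.comp_apply, dirBlowUp_apply_one, ih, hc, iterBlowUp_apply_zero]
    ring

@[simp] theorem iterBlowUp_zero (c : ℕ → ℂ) (s N : ℕ) : iterBlowUp c s N 0 = 0 := by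
  induction N generalizing s with
  | zero => rfl
  | succ N ih => rw [iterBlowUp, Function.comp_apply, ih, dirBlowUp_zero]

theorem analyticAt_iterBlowUp (c : ℕ → ℂ) (s N : ℕ) (a : CSpace 2) :
    AnalyticAt ℂ (iterBlowUp c s N) a := by
  induction N generalizing s with
  | zero => exact analyticAt_id
  | succ N ih => exact (analyticAt_dirBlowUp _ _).comp (ih _)

theorem tendsto_iterBlowUp (c : ℕ → ℂ) (s N : ℕ) :
    Tendsto (iterBlowUp c s N) (𝓝 0) (𝓝 0) := by
  simpa using (analyticAt_iterBlowUp c s N 0).continuousAt.tendsto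

theorem AnalyticAt.comp_iterBlowUp {E : Type*} [NormedAddCommGroup E] [NormedSpace ℂ E]
    {f : CSpace 2 → E} (hf : AnalyticAt ℂ f 0) (c : ℕ → ℂ) (s N : ℕ) :
    AnalyticAt ℂ (fun z => f (iterBlowUp c s N z)) 0 :=
  AnalyticAt.comp (g := f) (by simpa using hf) (analyticAt_iterBlowUp c s N 0)

/-- An infinite sequence of transforms of normalized forms. -/
structure IsTower (c : ℕ → ℂ) (η : ℕ → OneForm 2) : Prop where
  isNormalized : ∀ s, (η s).IsNormalized
  isTransform : ∀ s, (η s).IsTransform (c s) (η (s + 1))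

theorem OneForm.IsNormalized.exists_tower {η : OneForm 2} (hη : η.IsNormalized) :
    ∃ (c : ℕ → ℂ) (η' : ℕ → OneForm 2), IsTower c η' ∧ η' 0 = η := by
  choose c f hf ht using fun θ : {θ : OneForm 2 // θ.IsNormalized} => θ.2.exists_transform
  let seq : ℕ → {θ : OneForm 2 // θ.IsNormalized} :=
    fun n => Nat.rec ⟨η, hη⟩ (fun _ θ => ⟨f θ, hf θ⟩) n
  exact ⟨fun s => c (seq s), fun s => (seq s).1, ⟨fun s => (seq s).2, fun s => ht (seq s)⟩, rfl⟩

theorem OneForm.IsNormalized.exists_tower_of_axis {η : OneForm 2} (hη : η.IsNormalized)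
    (h : ∀ᶠ z in 𝓝 (0 : CSpace 2), z 1 = 0 → η z 0 = 0) :
    ∃ η' : ℕ → OneForm 2, IsTower (fun _ => 0) η' ∧ η' 0 = η := by
  choose f hf ht ha using fun θ : {θ : OneForm 2 // θ.IsNormalized ∧
    ∀ᶠ z in 𝓝 (0 : CSpace 2), z 1 = 0 → θ z 0 = 0} => θ.2.1.exists_transform_of_axis θ.2.2
  let seq : ℕ → {θ : OneForm 2 // θ.IsNormalized ∧
      ∀ᶠ z in 𝓝 (0 : CSpace 2), z 1 = 0 → θ z 0 = 0} :=
    fun n => Nat.rec ⟨η, hη, h⟩ (fun _ θ => ⟨f θ, hf θ, ha θ⟩) n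
  exact ⟨fun s => (seq s).1, ⟨fun s => (seq s).2.1, fun s => ht (seq s)⟩, rfl⟩

theorem IsTower.coord_one {c : ℕ → ℂ} {η : ℕ → OneForm 2} (h : IsTower c η) (s N : ℕ) :
    ∀ᶠ z in 𝓝 0, η (s + N) z 1 = η s (iterBlowUp c s N z) 1 := by
  induction N with
  | zero => exact Eventually.of_forall fun z => rfl
  | succ N ih =>
    filter_upwards [(h.isTransform (s + N)).coord_one (h.isNormalized _).analyticAt
      (h.isNormalized _).analyticAt, (tendsto_dirBlowUp (c (s + N))).eventually ih] with z h1 h2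
    rw [iterBlowUp_succ, Function.comp_apply, ← h2, ← h1]
    rfl

/-- The pull-back of the form at level `s` is a multiple of the form at level `s + N`. -/
theorem IsTower.pullback {c : ℕ → ℂ} {η : ℕ → OneForm 2} (h : IsTower c η) (s N : ℕ) :
    (η s).pullback (iterBlowUp c s N) =ᶠ[𝓝 0] fun z => z 0 ^ N • η (s + N) z := by
  induction N with
  | zero =>
    refine Eventually.of_forall fun z => ?_
    funext j
    have hd : DifferentiableAt ℂ (iterBlowUp c s 0) z :=
      (analyticAt_iterBlowUp c s 0 z).differentiableAt
    simp only [OneForm.pullback, pd_eq_partialD hd]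
    simp [iterBlowUp, pd_coord]
  | succ N ih =>
    have h1 := OneForm.pullback_pullback (η s) (a := 0) (analyticAt_iterBlowUp c s N _)
      (analyticAt_dirBlowUp (c (s + N)) 0)
    have h2 := OneForm.pullback_congr_left (a := 0)
      (analyticAt_dirBlowUp (c (s + N)) 0).continuousAt
      (by simpa using ih)
    filter_upwards [h1, h2, h.isTransform (s + N)] with z h1 h2 h3
    rw [iterBlowUp_succ, ← h1, h2, OneForm.pullback_smul]
    simp only [h3, smul_smul, dirBlowUp_apply_zero, ← pow_succ]
    rfl

/-! ### Extracting powers of a coordinate -/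

/-- Were the extraction never to stop, all powers of the coordinate would divide `f`. On every line
through the origin `f` would vanish to infinite order, hence identically on the part of the line
inside a ball of analyticity. -/
theorem AnalyticAt.exists_eq_coord_pow_mul {n : ℕ} {f : CSpace n → ℂ} (hf : AnalyticAt ℂ f 0)
    (h0 : ¬ ∀ᶠ z in 𝓝 (0 : CSpace n), f z = 0) (i : Fin n) :
    ∃ (k : ℕ) (g : CSpace n → ℂ), AnalyticAt ℂ g 0 ∧ (∀ᶠ z in 𝓝 0, f z = z i ^ k * g z) ∧
      ¬ ∀ᶠ z in 𝓝 (0 : CSpace n), z i = 0 → g z = 0 := by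
  by_contra hcon
  push Not at hcon
  have hall : ∀ k : ℕ, ∃ g : CSpace n → ℂ, AnalyticAt ℂ g 0 ∧
      ∀ᶠ z in 𝓝 0, f z = z i ^ k * g z := by
    intro k
    induction k with
    | zero => exact ⟨f, hf, Eventually.of_forall fun z => by simp⟩
    | succ k ih =>
      obtain ⟨g, hg, hfg⟩ := ih
      obtain ⟨g', hg', hgg⟩ := hg.exists_eq_coord_mul i (hcon k g hg hfg)
      refine ⟨g', hg', ?_⟩
      filter_upwards [hfg, hgg] with z h1 h2
      rw [h1, h2]; ring
  obtain ⟨r, hr, hball⟩ := Metric.eventually_nhds_iff_ball.1 hf.eventually_analyticAt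
  obtain ⟨v, hv, hfv⟩ : ∃ v ∈ Metric.ball (0 : CSpace n) r, f v ≠ 0 := by
    by_contra! hall
    exact h0 (Metric.eventually_nhds_iff_ball.2 ⟨r, hr, hall⟩)
  set F : ℂ → ℂ := fun t => f (t • v) with hF
  have hlin : ∀ t : ℂ, AnalyticAt ℂ (fun t : ℂ => t • v) t := fun t =>
    analyticAt_id.smul analyticAt_const
  have hlin0 : Tendsto (fun t : ℂ => t • v) (𝓝 0) (𝓝 0) := by
    simpa using (hlin 0).continuousAt.tendsto
  have hF0 : AnalyticAt ℂ F 0 := AnalyticAt.comp (g := f) (by simpa using hf) (hlin 0)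
  have htop : analyticOrderAt F 0 = ⊤ := by
    rw [ENat.eq_top_iff_forall_ge]
    intro k
    rw [natCast_le_analyticOrderAt hF0]
    obtain ⟨g, hg, hfg⟩ := hall k
    refine ⟨fun t => v i ^ k * g (t • v), analyticAt_const.mul
      (AnalyticAt.comp (g := g) (by simpa using hg) (hlin 0)), ?_⟩
    filter_upwards [hlin0.eventually hfg] with t ht
    simp only [hF, ht, Pi.smul_apply, smul_eq_mul, sub_zero]
    ring
  have hz : F =ᶠ[𝓝 0] 0 := analyticOrderAt_eq_top.1 htop
  set S : Set ℂ := (fun t : ℂ => t • v) ⁻¹' Metric.ball 0 r with hS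
  have hconv : Convex ℝ S := by
    have : S = (((LinearMap.toSpanSingleton ℂ (CSpace n) v).restrictScalars ℝ) : ℂ →ₗ[ℝ] CSpace n) ⁻¹'
      Metric.ball 0 r := by ext t; simp [hS]
    rw [this]
    exact (convex_ball _ _).linear_preimage _
  have := AnalyticOnNhd.eqOn_zero_of_preconnected_of_eventuallyEq_zero (f := F) (U := S)
    (fun t ht => AnalyticAt.comp (g := f) (hball _ ht) (hlin t)) hconv.isPreconnected
    (by simpa [hS] using hr) hz
  exact hfv (by simpa [hF] using this (show (1 : ℂ) ∈ S by simpa [hS] using hv))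

/-! ### Invariant curves -/

/-- The pull-back of `η` by the parametrization `t ↦ (t, h t)` of a graph. -/
noncomputable def OneForm.restrict (η : OneForm 2) (h : ℂ → ℂ) (t : ℂ) : ℂ :=
  η ![t, h t] 0 + deriv h t * η ![t, h t] 1

theorem vec2_zero : (![0, 0] : CSpace 2) = 0 := by funext i; fin_cases i <;> rfl

theorem vec2_eta (z : CSpace 2) : ![z 0, z 1] = z := by funext i; fin_cases i <;> rfl

theorem analyticAt_graph {h : ℂ → ℂ} (hh : AnalyticAt ℂ h 0) :
    AnalyticAt ℂ (fun t => (![t, h t] : CSpace 2)) 0 := analyticAt_vec2 analyticAt_id hh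

theorem tendsto_graph {h : ℂ → ℂ} (hh : AnalyticAt ℂ h 0) (h0 : h 0 = 0) :
    Tendsto (fun t => (![t, h t] : CSpace 2)) (𝓝 0) (𝓝 0) := by
  simpa [h0, vec2_zero] using (analyticAt_graph hh).continuousAt.tendsto

theorem AnalyticAt.comp_graph {f : CSpace 2 → ℂ} (hf : AnalyticAt ℂ f 0) {h : ℂ → ℂ}
    (hh : AnalyticAt ℂ h 0) (h0 : h 0 = 0) : AnalyticAt ℂ (fun t => f ![t, h t]) 0 :=
  AnalyticAt.comp (g := f) (by simpa [h0, vec2_zero] using hf) (analyticAt_graph hh)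

theorem OneForm.analyticAt_restrict {η : OneForm 2} (hη : AnalyticAt ℂ η 0) {h : ℂ → ℂ}
    (hh : AnalyticAt ℂ h 0) (h0 : h 0 = 0) : AnalyticAt ℂ (η.restrict h) 0 :=
  ((hη.coord 0).comp_graph hh h0).add (hh.deriv.mul ((hη.coord 1).comp_graph hh h0))

/-- The graph of `h` is invariant by the foliation `η = 0`. -/
def OneForm.HasInvariantGraph (η : OneForm 2) (h : ℂ → ℂ) : Prop :=
  AnalyticAt ℂ h 0 ∧ h 0 = 0 ∧ ∀ᶠ t in 𝓝 0, η.restrict h t = 0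

/-- The blow-up carries the graph of `h'` to the graph of `h`, so both sides are pull-backs along
the same curve; the factor `x` removed from the transform is `t` on it. -/
theorem OneForm.IsTransform.restrict_eq {c : ℂ} {η η' : OneForm 2} (ht : η.IsTransform c η')
    (hη : AnalyticAt ℂ η 0) (hη' : AnalyticAt ℂ η' 0) {h h' : ℂ → ℂ} (hh' : AnalyticAt ℂ h' 0)
    (h0 : h' 0 = 0) (heq : h =ᶠ[𝓝 0] fun t => t * (h' t + c * t)) :
    ∀ᶠ t in 𝓝 0, η.restrict h t = t * η'.restrict h' t := by
  have htend := tendsto_graph hh' h0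
  filter_upwards [htend.eventually ht.coord_zero, htend.eventually (ht.coord_one hη hη'), heq,
    heq.deriv, hh'.eventually_analyticAt] with t e1 e2 e3 e4 e5
  have e6 : dirBlowUp c ![t, h' t] = ![t, h t] := by
    funext i; fin_cases i <;> simp [e3]
  rw [e6] at e1 e2
  simp only [Matrix.cons_val_zero, Matrix.cons_val_one, Matrix.cons_val_fin_one] at e1
  have e7 : deriv h t = (h' t + c * t) + t * (deriv h' t + c) := by
    rw [e4]
    have hd : HasDerivAt (fun t => t * (h' t + c * t))
        (1 * (h' t + c * t) + t * (deriv h' t + c * 1)) t :=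
      (hasDerivAt_id t).mul (e5.differentiableAt.hasDerivAt.add ((hasDerivAt_id t).const_mul c))
    rw [hd.deriv]; ring
  simp only [OneForm.restrict, e2, e7]
  linear_combination -e1

theorem OneForm.IsTransform.hasInvariantGraph {c : ℂ} {η η' : OneForm 2}
    (ht : η.IsTransform c η') (hη : AnalyticAt ℂ η 0) (hη' : AnalyticAt ℂ η' 0) {h' : ℂ → ℂ}
    (hh : η'.HasInvariantGraph h') : ∃ h, η.HasInvariantGraph h := by
  obtain ⟨h1, h2, h3⟩ := hh
  refine ⟨fun t => t * (h' t + c * t),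
    analyticAt_id.mul (h1.add (analyticAt_const.mul analyticAt_id)), by simp, ?_⟩
  filter_upwards [ht.restrict_eq hη hη' h1 h2 (EventuallyEq.refl _ _), h3] with t e1 e2
  rw [e1, e2, mul_zero]

/-- Used in the contrapositive: if the bottom of the tower has no invariant graph, neither has any
other level. -/
theorem IsTower.hasInvariantGraph {c : ℕ → ℂ} {η : ℕ → OneForm 2} (ht : IsTower c η) {s : ℕ}
    (h : ∃ h, (η s).HasInvariantGraph h) : ∃ h, (η 0).HasInvariantGraph h := by
  induction s with
  | zero => exact h
  | succ s ih =>
    obtain ⟨h', hh'⟩ := h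
    exact ih ((ht.isTransform s).hasInvariantGraph (ht.isNormalized _).analyticAt
      (ht.isNormalized _).analyticAt hh')

/-- The implicit function theorem for a plane curve. -/
theorem AnalyticAt.exists_graph {D : CSpace 2 → ℂ} (hD : AnalyticAt ℂ D 0) (h0 : D 0 = 0)
    (h1 : _root_.pd 1 D 0 ≠ 0) :
    ∃ h : ℂ → ℂ, AnalyticAt ℂ h 0 ∧ h 0 = 0 ∧ ∀ᶠ t in 𝓝 0, D ![t, h t] = 0 := by
  set f : ℂ × ℂ → ℂ := fun p => D ![p.1, p.2] with hf
  have hv : AnalyticAt ℂ (fun p : ℂ × ℂ => (![p.1, p.2] : CSpace 2)) (0, 0) :=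
    analyticAt_vec2 analyticAt_fst analyticAt_snd
  have hfa : AnalyticAt ℂ f (0, 0) :=
    AnalyticAt.comp (g := D) (by simpa [vec2_zero] using hD) hv
  have hcd : ContDiffAt ℂ ω f (0, 0) := hfa.contDiffAt
  have hval : (fderiv ℂ f (0, 0) ∘L .inr ℂ ℂ ℂ) 1 = _root_.pd 1 D 0 := by
    have hγ : HasDerivAt (fun t : ℂ => ((0, t) : ℂ × ℂ)) (0, 1) 0 :=
      (hasDerivAt_const (0 : ℂ) (0 : ℂ)).prodMk (hasDerivAt_id _)
    have e1 := hfa.differentiableAt.hasFDerivAt.comp_hasDerivAt (0 : ℂ) hγ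
    have hγ2 : HasDerivAt (fun t : ℂ => (![0, t] : CSpace 2)) ![0, 1] 0 :=
      hasDerivAt_vec2 (hasDerivAt_const _ _) (hasDerivAt_id _)
    have e2 := hasDerivAt_comp_curve (f := D) (γ := fun t : ℂ => (![0, t] : CSpace 2))
      (by simpa [vec2_zero] using hD.differentiableAt) hγ2
    have e3 := e1.unique e2
    simpa [vec2_zero] using e3
  have hinv : (fderiv ℂ f (0, 0) ∘L .inr ℂ ℂ ℂ).IsInvertible := by
    refine ⟨ContinuousLinearEquiv.unitsEquivAut ℂ (Units.mk0 _ h1), ?_⟩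
    ext
    rw [hval]
    simp
  refine ⟨hcd.implicitFunction (by simp) hinv,
    (hcd.contDiffAt_implicitFunction (by simp) hinv).analyticAt,
    hcd.implicitFunction_apply_self (by simp) hinv, ?_⟩
  filter_upwards [hcd.eventually_apply_implicitFunction (by simp) hinv] with t ht
  have : f (0, 0) = 0 := by simp [hf, vec2_zero, h0]
  rw [this] at ht
  exact ht

/-! ### Germs that become monomial along a tower -/

/-- Some transform of the germ `f` at level `s` is a power of `x` times a unit. -/
def BecomesPower (c : ℕ → ℂ) (s : ℕ) (f : CSpace 2 → ℂ) : Prop :=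
  ∃ (N k : ℕ) (u : CSpace 2 → ℂ), AnalyticAt ℂ u 0 ∧ u 0 ≠ 0 ∧
    ∀ᶠ z in 𝓝 0, f (iterBlowUp c s N z) = z 0 ^ k * u z

theorem BecomesPower.of_comp {c : ℕ → ℂ} {s : ℕ} {f : CSpace 2 → ℂ}
    (h : BecomesPower c (s + 1) fun z => f (dirBlowUp (c s) z)) : BecomesPower c s f := by
  obtain ⟨N, k, u, h1, h2, h3⟩ := h
  exact ⟨N + 1, k, u, h1, h2, h3⟩

theorem BecomesPower.of_eq_pow_mul {c : ℕ → ℂ} {s : ℕ} {f g : CSpace 2 → ℂ}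
    (h : BecomesPower c s g) (m : ℕ) (hfg : ∀ᶠ z in 𝓝 0, f z = z 0 ^ m * g z) :
    BecomesPower c s f := by
  obtain ⟨N, k, u, h1, h2, h3⟩ := h
  refine ⟨N, m + k, u, h1, h2, ?_⟩
  filter_upwards [h3, (tendsto_iterBlowUp c s N).eventually hfg] with z e1 e2
  rw [e2, e1, iterBlowUp_apply_zero]; ring

theorem BecomesPower.of_ne_zero {c : ℕ → ℂ} {s : ℕ} {f : CSpace 2 → ℂ} (hf : AnalyticAt ℂ f 0)
    (h : f 0 ≠ 0) : BecomesPower c s f :=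
  ⟨0, 0, f, hf, h, Eventually.of_forall fun z => by simp [iterBlowUp]⟩

/-- `D = 0` is a smooth curve, the graph of `h`, none of whose transforms along the tower becomes
a power of `x`. -/
structure IsInfinitelyNear (c : ℕ → ℂ) (s : ℕ) (D : CSpace 2 → ℂ) (h : ℂ → ℂ) : Prop where
  analyticAt : AnalyticAt ℂ D 0
  zero : D 0 = 0
  pd_ne : pd 1 D 0 ≠ 0
  not_becomesPower : ¬ BecomesPower c s D
  analyticAt_graph : AnalyticAt ℂ h 0
  graph_zero : h 0 = 0
  apply_graph : ∀ᶠ t in 𝓝 0, D ![t, h t] = 0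

/-- A strict transform missing the origin would be a unit, making `D` a power of `x` times a unit
one level up. It therefore passes through the origin, and solving `h = t (h' + c t)` gives its
graph. -/
theorem IsInfinitelyNear.exists_next {c : ℕ → ℂ} {s : ℕ} {D : CSpace 2 → ℂ} {h : ℂ → ℂ}
    (hD : IsInfinitelyNear c s D h) :
    ∃ (D' : CSpace 2 → ℂ) (h' : ℂ → ℂ), IsInfinitelyNear c (s + 1) D' h' ∧
      h =ᶠ[𝓝 0] fun t => t * (h' t + c s * t) := by
  obtain ⟨D', hD', hDD, hD0, hD1⟩ := hD.analyticAt.exists_strictTransform hD.zero (c s)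
  have hbad : ¬ BecomesPower c (s + 1) D' := fun hg => hD.not_becomesPower
    (BecomesPower.of_comp (hg.of_eq_pow_mul 1 (by simpa using hDD)))
  have hD'0 : D' 0 = 0 := by
    by_contra hne
    exact hbad (BecomesPower.of_ne_zero hD' hne)
  have hD'1 : pd 1 D' 0 = pd 1 D 0 := by simpa using hD1.self_of_nhds
  -- The value at the origin of the strict transform is `∂D/∂x`; its vanishing makes the curve
  -- tangent to the x-axis.
  have hderiv : deriv h 0 = 0 := by
    have e1 := hasDerivAt_comp_curve (f := D) (γ := fun t : ℂ => (![t, h t] : CSpace 2)) (t := 0)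
      (by simpa [vec2_zero, hD.graph_zero] using hD.analyticAt.differentiableAt)
      (hasDerivAt_vec2 (hasDerivAt_id _) hD.analyticAt_graph.differentiableAt.hasDerivAt)
    have e2 : HasDerivAt (fun t => D ![t, h t]) 0 0 :=
      (hasDerivAt_const (0 : ℂ) (0 : ℂ)).congr_of_eventuallyEq hD.apply_graph
    have e3 := e1.unique e2
    simp only [Fin.sum_univ_two, hD.graph_zero, vec2_zero, ← hD0, hD'0, Matrix.cons_val_zero,
      Matrix.cons_val_one, Matrix.cons_val_fin_one, mul_zero, zero_add, mul_eq_zero] at e3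
    exact e3.resolve_right hD.pd_ne
  have h1 : (1 : ℕ) ≤ analyticOrderAt h 0 := by
    have := hD.analyticAt_graph.analyticOrderAt_ne_zero.2 hD.graph_zero
    simpa [Order.one_le_iff_ne_zero] using this
  obtain ⟨k, hk, hhk⟩ := (natCast_le_analyticOrderAt hD.analyticAt_graph).1 h1
  have hhk' : h =ᶠ[𝓝 0] fun t => t * k t := by
    filter_upwards [hhk] with t ht
    simpa using ht
  have hk0 : k 0 = 0 := by
    have e1 := hhk'.deriv_eq
    have e2 : HasDerivAt (fun t => t * k t) (1 * k 0 + 0 * deriv k 0) 0 :=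
      (hasDerivAt_id (0 : ℂ)).mul hk.differentiableAt.hasDerivAt
    rw [e2.deriv, hderiv] at e1
    simpa using e1.symm
  have hh' : AnalyticAt ℂ (fun t => k t - c s * t) 0 :=
    hk.sub (analyticAt_const.mul analyticAt_id)
  have hh'0 : (fun t => k t - c s * t) 0 = 0 := by simp [hk0]
  refine ⟨D', fun t => k t - c s * t, ⟨hD', hD'0, by rw [hD'1]; exact hD.pd_ne, hbad, hh', hh'0,
    ?_⟩, ?_⟩
  · filter_upwards [(tendsto_graph hh' hh'0).eventually hDD, hhk', hD.apply_graph] with t e1 e2 e3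
    by_cases ht : t = 0
    · subst ht; simpa [hk0, vec2_zero] using hD'0
    · have e4 : dirBlowUp (c s) ![t, k t - c s * t] = ![t, h t] := by
        funext i; fin_cases i <;> simp [e2]
      rw [e4, e3] at e1
      simpa [ht] using e1
  · filter_upwards [hhk'] with t ht
    rw [ht]; ring

/-- Each level through which the curve passes contributes one factor `t`, and an infinitely near
curve passes through all of them. -/
theorem IsTower.exists_restrict_eq_pow_mul {c : ℕ → ℂ} {η : ℕ → OneForm 2} (ht : IsTower c η)
    (N : ℕ) {s : ℕ} {D : CSpace 2 → ℂ} {h : ℂ → ℂ} (hD : IsInfinitelyNear c s D h) :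
    ∃ g : ℂ → ℂ, AnalyticAt ℂ g 0 ∧ ∀ᶠ t in 𝓝 0, (η s).restrict h t = t ^ N * g t := by
  induction N generalizing s D h with
  | zero =>
    exact ⟨(η s).restrict h, OneForm.analyticAt_restrict (ht.isNormalized s).analyticAt
      hD.analyticAt_graph hD.graph_zero, Eventually.of_forall fun t => by simp⟩
  | succ N ih =>
    obtain ⟨D', h', hD', hh⟩ := hD.exists_next
    obtain ⟨g, hg, hgg⟩ := ih hD'
    refine ⟨g, hg, ?_⟩
    filter_upwards [hgg, (ht.isTransform s).restrict_eq (ht.isNormalized s).analyticAt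
      (ht.isNormalized _).analyticAt hD'.analyticAt_graph hD'.graph_zero hh] with t e1 e2
    rw [e2, e1]; ring

/-- Otherwise the smooth curve `D = 0` would go through all the infinitely near points. The form
restricted to it would vanish to every order, hence identically, and the curve would be an invariant
graph. -/
theorem IsTower.becomesPower_of_pd_ne_zero {c : ℕ → ℂ} {η : ℕ → OneForm 2} (ht : IsTower c η)
    (hno : ∀ s h, ¬ (η s).HasInvariantGraph h) {s : ℕ} {D : CSpace 2 → ℂ}
    (hD : AnalyticAt ℂ D 0) (h1 : pd 1 D 0 ≠ 0) : BecomesPower c s D := by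
  by_contra hbad
  have h0 : D 0 = 0 := by
    by_contra hne
    exact hbad (BecomesPower.of_ne_zero hD hne)
  obtain ⟨h, hh, hh0, hDh⟩ := hD.exists_graph h0 h1
  have hQ : IsInfinitelyNear c s D h := ⟨hD, h0, h1, hbad, hh, hh0, hDh⟩
  refine hno s h ⟨hh, hh0, ?_⟩
  have hr := OneForm.analyticAt_restrict (ht.isNormalized s).analyticAt hh hh0
  rw [← analyticOrderAt_eq_top, ENat.eq_top_iff_forall_ge]
  intro k
  rw [natCast_le_analyticOrderAt hr]
  obtain ⟨g, hg, hgg⟩ := ht.exists_restrict_eq_pow_mul k hQ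
  exact ⟨g, hg, by simpa using hgg⟩

theorem eventually_const_of_pd_one {g : CSpace 2 → ℂ} (hg : AnalyticAt ℂ g 0)
    (h : ∀ᶠ z in 𝓝 (0 : CSpace 2), z 0 = 0 → pd 1 g z = 0) :
    ∀ᶠ z in 𝓝 (0 : CSpace 2), z 0 = 0 → g z = g 0 := by
  have hv : Continuous (fun t : ℂ => (![0, t] : CSpace 2)) :=
    continuous_pi (Fin.forall_fin_two.2 ⟨by simpa using continuous_const,
      by simpa using continuous_id'⟩)
  have hv0 : Tendsto (fun t : ℂ => (![0, t] : CSpace 2)) (𝓝 0) (𝓝 0) := by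
    simpa [vec2_zero] using hv.tendsto 0
  obtain ⟨r, hr, hball⟩ := Metric.eventually_nhds_iff_ball.1
    (hv0.eventually (h.and hg.eventually_analyticAt))
  have hd : ∀ t ∈ Metric.ball (0 : ℂ) r, HasDerivAt (fun t : ℂ => g ![0, t]) 0 t := by
    intro t ht
    have e1 := hasDerivAt_comp_curve (f := g) (γ := fun t : ℂ => (![0, t] : CSpace 2)) (t := t)
      (hball t ht).2.differentiableAt (hasDerivAt_vec2 (hasDerivAt_const _ _) (hasDerivAt_id _))
    simpa [(hball t ht).1 (by simp)] using e1
  have hconst : ∀ t ∈ Metric.ball (0 : ℂ) r, g ![0, t] = g ![0, 0] := by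
    intro t ht
    refine Metric.isOpen_ball.is_const_of_deriv_eq_zero (convex_ball (0 : ℂ) r).isPreconnected
      (fun t ht => (hd t ht).differentiableAt.differentiableWithinAt)
      (fun t ht => (hd t ht).deriv) ht (Metric.mem_ball_self hr)
  have h1 : Tendsto (fun z : CSpace 2 => z 1) (𝓝 0) (𝓝 0) :=
    (analyticAt_coord (n := 2) 1 0).continuousAt.tendsto
  filter_upwards [h1.eventually (Metric.ball_mem_nhds (0 : ℂ) hr)] with z hz hz0
  have e := hconst (z 1) hz
  rw [← hz0, vec2_eta] at e
  rw [e, hz0, vec2_zero]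

theorem eventually_pd_one_pow_mul {f g : CSpace 2 → ℂ} (hg : AnalyticAt ℂ g 0) {l : ℕ}
    (h : ∀ᶠ z in 𝓝 0, f z = z 0 ^ l * g z) : ∀ᶠ z in 𝓝 0, pd 1 f z = z 0 ^ l * pd 1 g z := by
  filter_upwards [EventuallyEq.pd h 1, hg.eventually_analyticAt] with z e1 e2
  have h0 := (analyticAt_coord (n := 2) 0 z)
  rw [e1, pd_mul 1 (h0.fun_pow l).differentiableAt e2.differentiableAt]
  rw [pd_coord_pow]
  simp

/-- Where `∂f/∂y = x^k u`, write `f = x^l g` with `g` not identically zero on `x = 0`, so that `x^l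
∂g/∂y = x^k u`. If `l < k`, then `g` is constant on `x = 0`, hence a unit. If `l = k`, then `∂g/∂y`
is a unit and the smooth case applies. If `l > k`, the unit `u` would vanish at the origin. -/
theorem IsTower.becomesPower_of_pd {c : ℕ → ℂ} {η : ℕ → OneForm 2} (ht : IsTower c η)
    (hno : ∀ s h, ¬ (η s).HasInvariantGraph h) {s : ℕ} {f : CSpace 2 → ℂ}
    (hf : AnalyticAt ℂ f 0) (h : BecomesPower c s (pd 1 f)) : BecomesPower c s f := by
  obtain ⟨N, k, u, hu, hu0, hfu⟩ := h
  induction N generalizing s f k with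
  | zero =>
    have hfu' : ∀ᶠ z in 𝓝 0, pd 1 f z = z 0 ^ k * u z := hfu
    have hf0 : ¬ ∀ᶠ z in 𝓝 (0 : CSpace 2), f z = 0 := by
      intro h0
      have h1 : ∀ᶠ z in 𝓝 (0 : CSpace 2), z 0 ^ k * u z = 0 := by
        filter_upwards [hfu', EventuallyEq.pd (g := fun _ => 0) h0 1] with z e1 e2
        rw [← e1, e2, pd_const]
      rcases AnalyticAt.eventually_eq_zero_or_of_mul ((analyticAt_coord 0 0).fun_pow k) hu h1
        with h2 | h2
      · exact not_eventually_pow_eq_zero 0 k h2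
      · exact hu0 h2.self_of_nhds
    obtain ⟨l, g, hg, hfg, hg0⟩ := hf.exists_eq_coord_pow_mul hf0 0
    have hpd := eventually_pd_one_pow_mul hg hfg
    refine BecomesPower.of_eq_pow_mul ?_ l hfg
    have cancel : ∀ (m : ℕ) {a b : CSpace 2 → ℂ}, AnalyticAt ℂ a 0 → AnalyticAt ℂ b 0 →
        (∀ᶠ z in 𝓝 0, z 0 ^ m * a z = z 0 ^ m * b z) → ∀ᶠ z in 𝓝 0, a z = b z := fun m a b ha hb =>
      AnalyticAt.eventually_eq_of_mul_eq ((analyticAt_coord 0 0).fun_pow m) ha hb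
        (not_eventually_pow_eq_zero 0 m)
    rcases lt_trichotomy l k with hlk | hlk | hlk
    · obtain ⟨d, rfl⟩ := Nat.exists_eq_add_of_lt hlk
      have h1 : ∀ᶠ z in 𝓝 0, pd 1 g z = z 0 ^ (d + 1) * u z := by
        refine cancel l (hg.pd 1) (((analyticAt_coord 0 0).fun_pow _).mul hu) ?_
        filter_upwards [hfu', hpd] with z e1 e2
        rw [← e2, e1]
        ring
      have h2 := eventually_const_of_pd_one hg (by
        filter_upwards [h1] with z e1 hz
        rw [e1, hz]; simp)
      refine BecomesPower.of_ne_zero hg fun h3 => hg0 ?_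
      filter_upwards [h2] with z e1 hz
      rw [e1 hz, h3]
    · subst hlk
      have h1 : ∀ᶠ z in 𝓝 0, pd 1 g z = u z := by
        refine cancel l (hg.pd 1) hu ?_
        filter_upwards [hfu', hpd] with z e1 e2
        rw [← e2, e1]
      exact ht.becomesPower_of_pd_ne_zero hno hg (by rw [h1.self_of_nhds]; exact hu0)
    · obtain ⟨d, rfl⟩ := Nat.exists_eq_add_of_lt hlk
      have h1 : ∀ᶠ z in 𝓝 0, z 0 ^ (d + 1) * pd 1 g z = u z := by
        refine cancel k (((analyticAt_coord 0 0).fun_pow _).mul (hg.pd 1)) hu ?_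
        filter_upwards [hfu', hpd] with z e1 e2
        rw [← e1, e2]
        ring
      exact absurd h1.self_of_nhds.symm (by simpa using hu0)
  | succ N ih =>
    -- The exponent rises by one because `∂/∂y` of a germ composed with the blow-up acquires the
    -- factor `x`.
    refine BecomesPower.of_comp (ih (hf.comp_dirBlowUp (c s)) (k + 1) ?_)
    have h1 : ∀ᶠ z in 𝓝 0, pd 1 (fun z => f (dirBlowUp (c s) z)) z =
        z 0 * pd 1 f (dirBlowUp (c s) z) := by
      filter_upwards [(tendsto_dirBlowUp (c s)).eventually hf.eventually_analyticAt] with z hz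
      exact pd_one_comp_dirBlowUp (c s) hz.differentiableAt
    filter_upwards [hfu, (tendsto_iterBlowUp c (s + 1) N).eventually h1] with z e1 e2
    rw [e2, iterBlowUp_apply_zero, pow_succ']
    rw [iterBlowUp, Function.comp_apply] at e1
    rw [e1]; ring

theorem iteratedDeriv_vertical {g : CSpace 2 → ℂ} (hg : AnalyticAt ℂ g 0) (m : ℕ) :
    iteratedDeriv m (fun t : ℂ => g ![0, t]) 0 = (pd 1)^[m] g 0 := by
  induction m generalizing g with
  | zero => simp [vec2_zero]
  | succ m ih =>
    rw [iteratedDeriv_succ', Function.iterate_succ_apply, ← ih (hg.pd 1)]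
    refine Filter.EventuallyEq.iteratedDeriv_eq m ?_
    have hv : Tendsto (fun t : ℂ => (![0, t] : CSpace 2)) (𝓝 0) (𝓝 0) := by
      have := (hasDerivAt_vec2 (hasDerivAt_const (0 : ℂ) (0 : ℂ))
        (hasDerivAt_id (0 : ℂ))).continuousAt.tendsto
      simpa [vec2_zero] using this
    filter_upwards [hv.eventually hg.eventually_analyticAt] with t e1
    have e2 := hasDerivAt_comp_curve (f := g) (γ := fun t : ℂ => (![0, t] : CSpace 2)) (t := t)
      e1.differentiableAt (hasDerivAt_vec2 (hasDerivAt_const _ _) (hasDerivAt_id _))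
    rw [e2.deriv]
    simp

/-- Once the powers of `x` are removed, the germ is not zero on `x = 0`, so some iterated
`y`-derivative is non-zero at the origin, hence a unit there. The previous lemma descends from this
derivative to the germ. -/
theorem IsTower.becomesPower {c : ℕ → ℂ} {η : ℕ → OneForm 2} (ht : IsTower c η)
    (hno : ∀ s h, ¬ (η s).HasInvariantGraph h) {s : ℕ} {f : CSpace 2 → ℂ}
    (hf : AnalyticAt ℂ f 0) (h0 : ¬ ∀ᶠ z in 𝓝 (0 : CSpace 2), f z = 0) : BecomesPower c s f := by
  have key : ∀ (m : ℕ) (g : CSpace 2 → ℂ), AnalyticAt ℂ g 0 → (pd 1)^[m] g 0 ≠ 0 →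
      BecomesPower c s g := by
    intro m
    induction m with
    | zero => exact fun g hg h => BecomesPower.of_ne_zero hg h
    | succ m ih =>
      intro g hg h
      rw [Function.iterate_succ_apply] at h
      exact ht.becomesPower_of_pd hno hg (ih _ (hg.pd 1) h)
  obtain ⟨k, g, hg, hfg, hg0⟩ := hf.exists_eq_coord_pow_mul h0 0
  refine BecomesPower.of_eq_pow_mul ?_ k hfg
  by_contra hbad
  apply hg0
  have hall : ∀ m, iteratedDeriv m (fun t : ℂ => g ![0, t]) 0 = 0 := by
    intro m
    rw [iteratedDeriv_vertical hg]
    by_contra h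
    exact hbad (key m g hg h)
  have hga : AnalyticAt ℂ (fun t : ℂ => g ![0, t]) 0 :=
    AnalyticAt.comp (g := g) (by simpa [vec2_zero] using hg)
      (analyticAt_vec2 analyticAt_const analyticAt_id)
  have htop : analyticOrderAt (fun t : ℂ => g ![0, t]) 0 = ⊤ := by
    rw [ENat.eq_top_iff_forall_ge]
    intro k
    rw [natCast_le_analyticOrderAt_iff_iteratedDeriv_eq_zero hga]
    exact fun i _ => hall i
  have h1 : Tendsto (fun z : CSpace 2 => z 1) (𝓝 0) (𝓝 0) :=
    (analyticAt_coord (n := 2) 1 0).continuousAt.tendsto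
  filter_upwards [h1.eventually (analyticOrderAt_eq_top.1 htop)] with z hz hz0
  have hzv : (![0, z 1] : CSpace 2) = z := by rw [← hz0, vec2_eta]
  rwa [hzv] at hz

/-! ### Changes of coordinates -/

theorem partialD_id {n : ℕ} (x : CSpace n) (i j : Fin n) :
    partialD (id : CSpace n → CSpace n) x i j = if i = j then 1 else 0 := by
  rw [pd_eq_partialD differentiableAt_id]
  exact pd_coord j i x

theorem OneForm.pullback_id {n : ℕ} (θ : OneForm n) : θ.pullback id = θ := by
  funext x j
  simp [OneForm.pullback, partialD_id]

/-- `Φ` is a germ of biholomorphism fixing the origin, with inverse `Ξ`. -/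
structure IsCoordChange {n : ℕ} (Φ Ξ : CSpace n → CSpace n) : Prop where
  analyticAt : AnalyticAt ℂ Φ 0
  analyticAt_inv : AnalyticAt ℂ Ξ 0
  zero : Φ 0 = 0
  inv_zero : Ξ 0 = 0
  comp_inv : Φ ∘ Ξ =ᶠ[𝓝 0] id

theorem IsCoordChange.comp {n : ℕ} {Φ Ξ Φ' Ξ' : CSpace n → CSpace n} (h : IsCoordChange Φ Ξ)
    (h' : IsCoordChange Φ' Ξ') : IsCoordChange (Φ ∘ Φ') (Ξ' ∘ Ξ) where
  analyticAt := AnalyticAt.comp (by rw [h'.zero]; exact h.analyticAt) h'.analyticAt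
  analyticAt_inv := AnalyticAt.comp (by rw [h.inv_zero]; exact h'.analyticAt_inv) h.analyticAt_inv
  zero := by simp [h'.zero, h.zero]
  inv_zero := by simp [h'.inv_zero, h.inv_zero]
  comp_inv := by
    have ht : Tendsto Ξ (𝓝 0) (𝓝 0) := by
      simpa [h.inv_zero] using h.analyticAt_inv.continuousAt.tendsto
    filter_upwards [ht.eventually h'.comp_inv, h.comp_inv] with z e1 e2
    simp only [Function.comp_apply, id_eq] at e1 e2 ⊢
    rw [e1, e2]

theorem IsCoordChange.refl (n : ℕ) : IsCoordChange (id : CSpace n → CSpace n) id :=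
  ⟨analyticAt_id, analyticAt_id, rfl, rfl, EventuallyEq.refl _ _⟩

theorem IsCoordChange.pullback_pullback {n : ℕ} {Φ Ξ : CSpace n → CSpace n}
    (h : IsCoordChange Φ Ξ) (θ : OneForm n) : (θ.pullback Φ).pullback Ξ =ᶠ[𝓝 0] θ := by
  have h1 := θ.pullback_pullback (a := 0) (by rw [h.inv_zero]; exact h.analyticAt)
    h.analyticAt_inv
  have h2 := θ.pullback_congr h.comp_inv
  rw [OneForm.pullback_id] at h2
  exact h1.trans h2

theorem IsCoordChange.isSaturated {n : ℕ} {Φ Ξ : CSpace n → CSpace n}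
    (h : IsCoordChange Φ Ξ) {θ : OneForm n} (hθ : θ.IsSaturated) :
    (θ.pullback Φ).IsSaturated := by
  intro g ξ hg hξ heq
  have hg' : AnalyticAt ℂ (g ∘ Ξ) 0 :=
    AnalyticAt.comp (by rw [h.inv_zero]; exact hg) h.analyticAt_inv
  have := hθ (g ∘ Ξ) (ξ.pullback Ξ) hg'
    (OneForm.analyticAt_pullback (by rw [h.inv_zero]; exact hξ) h.analyticAt_inv) (by
      have h2 := OneForm.pullback_congr_left (a := 0) (φ := Ξ) (θ := θ.pullback Φ) (θ' := fun x => g x • ξ x)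
        h.analyticAt_inv.continuousAt (by rw [h.inv_zero]; exact heq)
      filter_upwards [h2, h.pullback_pullback θ] with z e1 e2
      rw [← e2, e1, OneForm.pullback_smul]
      rfl)
  simpa [h.inv_zero] using this

theorem IsCoordChange.isZeroGerm {n : ℕ} {Φ Ξ : CSpace n → CSpace n}
    (h : IsCoordChange Φ Ξ) {θ : OneForm n} (hθ : (θ.pullback Φ).IsZeroGerm) :
    θ.IsZeroGerm := by
  have ht : Tendsto Ξ (𝓝 0) (𝓝 0) := by
    simpa [h.inv_zero] using h.analyticAt_inv.continuousAt.tendsto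
  filter_upwards [h.pullback_pullback θ, ht.eventually hθ] with z e1 e2
  rw [← e1]
  funext j
  rw [OneForm.pullback]
  simp [e2]

/-- The shear `(x, y) ↦ (x, y + h x)`. -/
noncomputable def shear (h : ℂ → ℂ) (z : CSpace 2) : CSpace 2 := ![z 0, z 1 + h (z 0)]

theorem analyticAt_comp_coord_zero {h : ℂ → ℂ} (hh : AnalyticAt ℂ h 0) :
    AnalyticAt ℂ (fun z : CSpace 2 => h (z 0)) 0 :=
  AnalyticAt.comp (g := h) (by simpa using hh) (analyticAt_coord 0 0)

theorem analyticAt_shear {h : ℂ → ℂ} (hh : AnalyticAt ℂ h 0) : AnalyticAt ℂ (shear h) 0 :=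
  analyticAt_vec2 (analyticAt_coord 0 0)
    ((analyticAt_coord (n := 2) 1 0).add (analyticAt_comp_coord_zero hh))

theorem isCoordChange_shear {h : ℂ → ℂ} (hh : AnalyticAt ℂ h 0) (h0 : h 0 = 0) :
    IsCoordChange (shear h) (shear fun t => -h t) where
  analyticAt := analyticAt_shear hh
  analyticAt_inv := analyticAt_shear hh.neg
  zero := by funext i; fin_cases i <;> simp [shear, h0]
  inv_zero := by funext i; fin_cases i <;> simp [shear, h0]
  comp_inv := Eventually.of_forall fun z => by
    funext i; fin_cases i <;> simp [shear]

theorem pd_comp_coord_zero {h : ℂ → ℂ} {z : CSpace 2} (hh : DifferentiableAt ℂ h (z 0)) :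
    pd 0 (fun z : CSpace 2 => h (z 0)) z = deriv h (z 0) ∧
      pd 1 (fun z : CSpace 2 => h (z 0)) z = 0 := by
  have h1 : HasFDerivAt (fun z : CSpace 2 => z 0)
    (ContinuousLinearMap.proj (R := ℂ) (φ := fun _ : Fin 2 => ℂ) 0) z :=
    (ContinuousLinearMap.proj (R := ℂ) (φ := fun _ : Fin 2 => ℂ) 0).hasFDerivAt
  have h2 := (hh.hasDerivAt.comp_hasFDerivAt z h1).fderiv
  have h3 : (h ∘ fun z : CSpace 2 => z 0) = fun z : CSpace 2 => h (z 0) := rfl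
  rw [h3] at h2
  simp [pd, h2]

theorem pd_shear_one {h : ℂ → ℂ} {z : CSpace 2} (hh : DifferentiableAt ℂ h (z 0)) :
    pd 0 (fun z => shear h z 1) z = deriv h (z 0) ∧ pd 1 (fun z => shear h z 1) z = 1 := by
  have h1 := (analyticAt_coord (n := 2) 1 z).differentiableAt
  have h2 : DifferentiableAt ℂ (fun z : CSpace 2 => h (z 0)) z :=
    DifferentiableAt.comp (g := h) z hh (analyticAt_coord 0 z).differentiableAt
  have e : (fun z => shear h z 1) = fun z : CSpace 2 => z 1 + h (z 0) := rfl
  rw [e, pd_add 0 h1 h2, pd_add 1 h1 h2, (pd_comp_coord_zero hh).1, (pd_comp_coord_zero hh).2]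
  simp [pd_coord]

theorem pullback_shear {h : ℂ → ℂ} (hh : AnalyticAt ℂ h 0) (η : OneForm 2) :
    ∀ᶠ z in 𝓝 0, η.pullback (shear h) z =
      ![η (shear h z) 0 + deriv h (z 0) * η (shear h z) 1, η (shear h z) 1] := by
  have ht : Tendsto (fun z : CSpace 2 => z 0) (𝓝 0) (𝓝 0) :=
    (analyticAt_coord (n := 2) 0 0).continuousAt.tendsto
  filter_upwards [(analyticAt_shear hh).eventually_analyticAt,
    ht.eventually hh.eventually_analyticAt] with z e1 e2
  have e3 := pd_shear_one e2.differentiableAt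
  have e4 : ∀ j, pd j (fun z => shear h z 0) z = if 0 = j then 1 else 0 := fun j => pd_coord j 0 z
  funext j
  fin_cases j
  · simp only [Fin.zero_eta, OneForm.pullback, Fin.sum_univ_two, pd_eq_partialD e1.differentiableAt,
      e3.1, e4]
    simp [mul_comm]
  · simp only [Fin.mk_one, OneForm.pullback, Fin.sum_univ_two, pd_eq_partialD e1.differentiableAt,
      e3.2, e4]
    simp

theorem pd_comp_shear {h : ℂ → ℂ} (hh : AnalyticAt ℂ h 0) (h0 : h 0 = 0) (h1 : deriv h 0 = 0)
    {f : CSpace 2 → ℂ} (hf : AnalyticAt ℂ f 0) (j : Fin 2) :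
    pd j (fun z => f (shear h z)) 0 = pd j f 0 := by
  have hz := (isCoordChange_shear hh h0).zero
  have e3 := pd_shear_one (z := 0) (h := h) (by simpa using hh.differentiableAt)
  have e4 : ∀ j, pd j (fun z => shear h z 0) 0 = if 0 = j then 1 else 0 := fun j => pd_coord j 0 0
  rw [pd_comp j (by rw [hz]; exact hf.differentiableAt) (analyticAt_shear hh).differentiableAt,
    Fin.sum_univ_two, hz, e4]
  fin_cases j
  · simp only [Fin.zero_eta, e3.1]; simp [h1]
  · simp only [Fin.mk_one, e3.2]; simp

/-- The first-order term of the form restricted to the graph comes only from `a y dx` and equals `a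
h'(0)`. -/
theorem OneForm.IsNormalized.deriv_graph {η : OneForm 2} (hη : η.IsNormalized) {h : ℂ → ℂ}
    (hh : η.HasInvariantGraph h) : deriv h 0 = 0 := by
  obtain ⟨ha, h0, hr⟩ := hh
  have hc : ∀ i, HasDerivAt (fun t => η ![t, h t] i)
      (pd 0 (fun z => η z i) 0 + deriv h 0 * pd 1 (fun z => η z i) 0) 0 := by
    intro i
    have e1 := hasDerivAt_comp_curve (f := fun z => η z i)
      (γ := fun t : ℂ => (![t, h t] : CSpace 2)) (t := 0)
      (by simpa [vec2_zero, h0] using (hη.analyticAt.coord i).differentiableAt)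
      (hasDerivAt_vec2 (hasDerivAt_id _) ha.differentiableAt.hasDerivAt)
    simpa [Fin.sum_univ_two, h0, vec2_zero] using e1
  have e1 := (hc 0).add (ha.deriv.differentiableAt.hasDerivAt.mul (hc 1))
  have e2 : HasDerivAt (η.restrict h) 0 0 :=
    (hasDerivAt_const (0 : ℂ) (0 : ℂ)).congr_of_eventuallyEq hr
  have e3 := HasDerivAt.unique (f := η.restrict h) e1 e2
  simp only [hη.pd_zero_zero, hη.pd_zero_one, hη.pd_one_one, h0, vec2_zero, hη.zero] at e3
  simpa [hη.pd_one_zero] using e3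

/-- The shear straightens the invariant graph to `y = 0`; as the graph is tangent to the x-axis, the
linear part does not change. -/
theorem OneForm.IsNormalized.shear {η : OneForm 2} (hη : η.IsNormalized) {h : ℂ → ℂ}
    (hh : η.HasInvariantGraph h) : (η.pullback (shear h)).IsNormalized ∧
      ∀ᶠ z in 𝓝 (0 : CSpace 2), z 1 = 0 → η.pullback (_root_.shear h) z 0 = 0 := by
  have h1 := hη.deriv_graph hh
  obtain ⟨ha, h0, hr⟩ := hh
  have hS := isCoordChange_shear ha h0
  have hp := pullback_shear ha η
  have hcomp : ∀ i, AnalyticAt ℂ (fun z => η (_root_.shear h z) i) 0 := fun i =>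
    AnalyticAt.comp (g := fun z => η z i) (by rw [hS.zero]; exact hη.analyticAt.coord i)
      hS.analyticAt
  have hp0 : (fun z => η.pullback (_root_.shear h) z 0) =ᶠ[𝓝 0] fun z =>
      η (_root_.shear h z) 0 + deriv h (z 0) * η (_root_.shear h z) 1 :=
    hp.mono fun z hz => by simp [hz]
  have hp1 : (fun z => η.pullback (_root_.shear h) z 1) =ᶠ[𝓝 0] fun z =>
      η (_root_.shear h z) 1 := hp.mono fun z hz => by simp [hz]
  have hd : AnalyticAt ℂ (fun z : CSpace 2 => deriv h (z 0)) 0 :=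
    analyticAt_comp_coord_zero ha.deriv
  have hpd0 : ∀ j, pd j (fun z => η.pullback (_root_.shear h) z 0) 0 =
      pd j (fun z => η z 0) 0 := by
    intro j
    rw [(hp0.pd j).self_of_nhds, pd_add j (hcomp 0).differentiableAt
      (hd.fun_mul (hcomp 1)).differentiableAt, pd_mul j hd.differentiableAt
      (hcomp 1).differentiableAt, pd_comp_shear ha h0 h1 (hη.analyticAt.coord 0) j]
    simp [hS.zero, hη.zero, h1]
  have hpd1 : ∀ j, pd j (fun z => η.pullback (_root_.shear h) z 1) 0 =
      pd j (fun z => η z 1) 0 := by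
    intro j
    rw [(hp1.pd j).self_of_nhds, pd_comp_shear ha h0 h1 (hη.analyticAt.coord 1) j]
  refine ⟨⟨OneForm.analyticAt_pullback (by rw [hS.zero]; exact hη.analyticAt) hS.analyticAt, ?_,
    ?_, ?_, ?_, ?_⟩, ?_⟩
  · rw [hp.self_of_nhds, hS.zero, hη.zero]
    funext i; fin_cases i <;> simp
  · rw [hpd0]; exact hη.pd_zero_zero
  · rw [hpd0]; exact hη.pd_one_zero
  · rw [hpd1]; exact hη.pd_zero_one
  · rw [hpd1]; exact hη.pd_one_one
  · have ht : Tendsto (fun z : CSpace 2 => z 0) (𝓝 0) (𝓝 0) :=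
      (analyticAt_coord (n := 2) 0 0).continuousAt.tendsto
    filter_upwards [hp0, ht.eventually hr] with z e1 e2 hz
    have e3 : _root_.shear h z = ![z 0, h (z 0)] := by simp [_root_.shear, hz]
    rw [e1, e3]
    exact e2

/-! ### Resolving towers -/

/-- Along the sequence of blow-ups `c`, every germ becomes a monomial times a unit. -/
def IsResolving (c : ℕ → ℂ) : Prop :=
  ∀ (s : ℕ) (f : CSpace 2 → ℂ), AnalyticAt ℂ f 0 → (¬ ∀ᶠ z in 𝓝 (0 : CSpace 2), f z = 0) →
    ∃ (N k m : ℕ) (u : CSpace 2 → ℂ), AnalyticAt ℂ u 0 ∧ u 0 ≠ 0 ∧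
      (∀ᶠ z in 𝓝 0, f (iterBlowUp c s N z) = z 0 ^ k * z 1 ^ m * u z) ∧ (m = 0 ∨ ∀ j, c j = 0)

theorem becomesPower_of_not_axis {g : CSpace 2 → ℂ} (hg : AnalyticAt ℂ g 0)
    (h0 : ¬ ∀ᶠ z in 𝓝 (0 : CSpace 2), z 1 = 0 → g z = 0) (s : ℕ) :
    BecomesPower (fun _ => 0) s g := by
  have ht : Tendsto (fun z : CSpace 2 => z 0) (𝓝 0) (𝓝 0) :=
    (analyticAt_coord (n := 2) 0 0).continuousAt.tendsto
  set p : ℂ → ℂ := fun t => g ![t, 0] with hp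
  have hpa : AnalyticAt ℂ p 0 := hg.comp_graph (h := fun _ => 0) analyticAt_const rfl
  have hne : analyticOrderAt p 0 ≠ ⊤ := by
    intro htop
    apply h0
    filter_upwards [ht.eventually (analyticOrderAt_eq_top.1 htop)] with z hz hz1
    have hzv : (![z 0, 0] : CSpace 2) = z := by rw [← hz1, vec2_eta]
    simp only [hp, hzv] at hz
    exact hz
  obtain ⟨u, hu, hu0, hpu⟩ := hpa.analyticOrderAt_ne_top.1 hne
  set k := analyticOrderNatAt p 0
  obtain ⟨r, hr, hgr⟩ := (hg.sub (analyticAt_comp_coord_zero hpa)).exists_eq_coord_mul 1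
    (Eventually.of_forall fun z hz => by
      have hzv : (![z 0, 0] : CSpace 2) = z := by rw [← hz, vec2_eta]
      simp [hp, hzv])
  -- With `g(x, 0) = x^k u(x)` and `g(x, y) = g(x, 0) + y r(x, y)`, the substitution of `x^k y` for
  -- `y` makes `x^k` a common factor. Hence `k` blow-ups suffice.
  refine ⟨k, k, fun z => u (z 0) + z 1 * r (iterBlowUp (fun _ => 0) s k z),
    (analyticAt_comp_coord_zero hu).add
      ((analyticAt_coord 1 0).mul (hr.comp_iterBlowUp _ s k)), by simpa using hu0, ?_⟩
  filter_upwards [(tendsto_iterBlowUp (fun _ => 0) s k).eventually hgr, ht.eventually hpu]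
    with z e1 e2
  simp only [Pi.sub_apply, iterBlowUp_apply_zero, sub_zero, smul_eq_mul] at e1 e2
  rw [iterBlowUp_apply_one (fun _ => rfl), e2] at e1
  linear_combination e1

/-- Powers of `y` have to be split off beforehand: `y` becomes `x^N y`, which is never a power of
`x` times a unit. -/
theorem isResolving_zero : IsResolving fun _ => 0 := by
  intro s f hf h0
  obtain ⟨m, g, hg, hfg, hg0⟩ := hf.exists_eq_coord_pow_mul h0 1
  obtain ⟨N, k, u, hu, hu0, hgu⟩ := becomesPower_of_not_axis hg hg0 s
  refine ⟨N, N * m + k, m, u, hu, hu0, ?_, Or.inr fun _ => rfl⟩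
  filter_upwards [hgu, (tendsto_iterBlowUp (fun _ => 0) s N).eventually hfg] with z e1 e2
  rw [e2, e1, iterBlowUp_apply_one (fun _ => rfl)]
  ring

/-- The dichotomy is whether the weak separatrix converges. In the convergent case it is first
straightened by a shear; otherwise no change of coordinates is made. -/
theorem OneForm.IsNormalized.exists_resolving_tower {η : OneForm 2} (hη : η.IsNormalized)
    (hsat : η.IsSaturated) :
    ∃ (Φ Ξ : CSpace 2 → CSpace 2) (c : ℕ → ℂ) (η' : ℕ → OneForm 2), IsCoordChange Φ Ξ ∧
      IsTower c η' ∧ η' 0 = η.pullback Φ ∧ IsResolving c ∧ BecomesPower c 0 fun z => η' 0 z 1 := by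
  by_cases hinv : ∃ h, η.HasInvariantGraph h
  · obtain ⟨h, hh⟩ := hinv
    obtain ⟨h1, h2⟩ := hη.shear hh
    obtain ⟨η', ht, hη0⟩ := h1.exists_tower_of_axis h2
    have hS := isCoordChange_shear hh.1 hh.2.1
    refine ⟨_, _, _, η', hS, ht, hη0, isResolving_zero, ?_⟩
    rw [hη0]
    -- If `B` also vanished on the invariant axis, `y` would divide both coefficients, against
    -- saturation.
    refine becomesPower_of_not_axis (h1.analyticAt.coord 1) (fun hax => ?_) 0
    obtain ⟨a, ha, haa⟩ := (h1.analyticAt.coord 0).exists_eq_coord_mul 1 h2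
    obtain ⟨b, hb, hbb⟩ := (h1.analyticAt.coord 1).exists_eq_coord_mul 1 hax
    refine hS.isSaturated hsat (fun z => z 1) (fun z => ![a z, b z]) (analyticAt_coord 1 0)
      (analyticAt_vec2 ha hb) ?_ rfl
    filter_upwards [haa, hbb] with z e1 e2
    funext i; fin_cases i
    · simpa using e1
    · simpa using e2
  · obtain ⟨c, η', ht, hη0⟩ := hη.exists_tower
    have hno : ∀ s h, ¬ (η' s).HasInvariantGraph h := by
      intro s h hh
      have := ht.hasInvariantGraph ⟨h, hh⟩
      rw [hη0] at this
      exact hinv this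
    refine ⟨id, id, c, η', IsCoordChange.refl 2, ht, by rw [hη0, OneForm.pullback_id], ?_, ?_⟩
    · intro s f hf h0
      obtain ⟨N, k, u, hu, hu0, hfu⟩ := ht.becomesPower hno hf h0 (s := s)
      exact ⟨N, k, 0, u, hu, hu0, hfu.mono fun z hz => by simpa using hz, Or.inl rfl⟩
    -- If `B` were zero, the form would be `A dx` with `A 0 = 0`, against saturation.
    · refine ht.becomesPower hno ((ht.isNormalized 0).analyticAt.coord 1) fun hB => ?_
      rw [hη0] at hB
      refine hsat (fun z => η z 0) (fun _ => ![1, 0]) (hη.analyticAt.coord 0) analyticAt_const ?_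
        (by simp [hη.zero])
      filter_upwards [hB] with z e1
      funext i; fin_cases i
      · simp
      · simpa using e1

/-! ### Linear normalization of a saddle-node -/

/-- Eigenvectors for the distinct eigenvalues `0` and `β` are independent, which is recorded as a
non-zero determinant. -/
theorem exists_eigenvectors {T : (CSpace 2) →ₗ[ℂ] (CSpace 2)} {β : ℂ} (hβ : β ≠ 0)
    (hT : T.charpoly = (Polynomial.X - Polynomial.C 0) * (Polynomial.X - Polynomial.C β)) :
    ∃ v w : CSpace 2, T v = 0 ∧ T w = β • w ∧ v 0 * w 1 - v 1 * w 0 ≠ 0 := by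
  have h0 : Module.End.HasEigenvalue T 0 := by
    rw [Module.End.hasEigenvalue_iff_isRoot_charpoly, hT]; simp [Polynomial.IsRoot]
  have h1 : Module.End.HasEigenvalue T β := by
    rw [Module.End.hasEigenvalue_iff_isRoot_charpoly, hT]; simp [Polynomial.IsRoot]
  obtain ⟨v, hv⟩ := h0.exists_hasEigenvector
  obtain ⟨w, hw⟩ := h1.exists_hasEigenvector
  have hTv : T v = 0 := by simpa using hv.apply_eq_smul
  have hTw := hw.apply_eq_smul
  refine ⟨v, w, hTv, hTw, fun hdet => ?_⟩
  obtain ⟨i, hi⟩ : ∃ i, v i ≠ 0 := by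
    by_contra! hall
    exact hv.2 (funext hall)
  have hprop : w = (w i / v i) • v := by
    have hdet' : v 0 * w 1 = v 1 * w 0 := sub_eq_zero.1 hdet
    funext j
    simp only [Pi.smul_apply, smul_eq_mul]
    field_simp
    fin_cases i <;> fin_cases j <;> simp_all [mul_comm]
  have : T w = 0 := by rw [hprop, map_smul, hTv, smul_zero]
  rw [hTw, smul_eq_zero] at this
  exact hw.2 (this.resolve_left hβ)

/-- The linear map with matrix columns `v`, `w`. -/
noncomputable def linMap (v w : CSpace 2) (z : CSpace 2) : CSpace 2 := z 0 • v + z 1 • w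

theorem analyticAt_linMap (v w a : CSpace 2) : AnalyticAt ℂ (linMap v w) a :=
  ((analyticAt_coord 0 a).smul analyticAt_const).add ((analyticAt_coord 1 a).smul analyticAt_const)

theorem pd_linMap (v w a : CSpace 2) (i : Fin 2) :
    pd 0 (fun z => linMap v w z i) a = v i ∧ pd 1 (fun z => linMap v w z i) a = w i := by
  have h0 := (analyticAt_coord (n := 2) 0 a)
  have h1 := (analyticAt_coord (n := 2) 1 a)
  have e : (fun z => linMap v w z i) = fun z : CSpace 2 => z 0 * v i + z 1 * w i := rfl
  have hc : ∀ c : ℂ, AnalyticAt ℂ (fun _ : CSpace 2 => c) a := fun c => analyticAt_const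
  constructor
  · rw [e, pd_add _ (h0.fun_mul (hc _)).differentiableAt (h1.fun_mul (hc _)).differentiableAt,
      pd_mul _ h0.differentiableAt (hc _).differentiableAt,
      pd_mul _ h1.differentiableAt (hc _).differentiableAt]
    simp [pd_coord, pd_const]
  · rw [e, pd_add _ (h0.fun_mul (hc _)).differentiableAt (h1.fun_mul (hc _)).differentiableAt,
      pd_mul _ h0.differentiableAt (hc _).differentiableAt,
      pd_mul _ h1.differentiableAt (hc _).differentiableAt]
    simp [pd_coord, pd_const]

theorem isCoordChange_linMap {v w : CSpace 2} (h : v 0 * w 1 - v 1 * w 0 ≠ 0) :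
    IsCoordChange (linMap v w) (linMap ((v 0 * w 1 - v 1 * w 0)⁻¹ • ![w 1, -v 1])
      ((v 0 * w 1 - v 1 * w 0)⁻¹ • ![-w 0, v 0])) where
  analyticAt := analyticAt_linMap _ _ _
  analyticAt_inv := analyticAt_linMap _ _ _
  zero := by simp [linMap]
  inv_zero := by simp [linMap]
  comp_inv := Eventually.of_forall fun z => by
    funext i
    fin_cases i
    · simp [linMap]; field_simp; ring
    · simp [linMap]; field_simp; ring

/-- The new x-axis is spanned by the kernel of the linear part and the new y-axis by the
`β`-eigenvector. -/
theorem OneForm.exists_isNormalized {η : OneForm 2} (hη : AnalyticAt ℂ η 0) (h0 : η 0 = 0)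
    {β : ℂ} (hβ : β ≠ 0) (hT : (fderiv ℂ η.dualField 0).toLinearMap.charpoly =
      (Polynomial.X - Polynomial.C 0) * (Polynomial.X - Polynomial.C β)) :
    ∃ Φ Ξ : CSpace 2 → CSpace 2, IsCoordChange Φ Ξ ∧ (η.pullback Φ).IsNormalized := by
  obtain ⟨v, w, hv, hw, hdet⟩ := exists_eigenvectors hβ hT
  have hL := isCoordChange_linMap hdet
  refine ⟨_, _, hL, ?_⟩
  have hdual : AnalyticAt ℂ η.dualField 0 := analyticAt_vec2 (hη.coord 1) (hη.coord 0).neg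
  have hd : ∀ u : CSpace 2, fderiv ℂ η.dualField 0 u =
      ![∑ i, u i * pd i (fun z => η z 1) 0, -∑ i, u i * pd i (fun z => η z 0) 0] := by
    intro u
    funext i
    have e1 : fderiv ℂ η.dualField 0 u i = fderiv ℂ (fun z => η.dualField z i) 0 u := by
      rw [fderiv_apply hdual.differentiableAt]; rfl
    rw [e1]
    fin_cases i
    · have e2 : (fun z => η.dualField z 0) = fun z => η z 1 := rfl
      simp only [Fin.zero_eta, e2, fderiv_eq_sum_pd]
      rfl
    · have e2 : (fun z => η.dualField z 1) = fun z => -η z 0 := rfl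
      simp only [Fin.mk_one, e2, fderiv_fun_neg, ← fderiv_eq_sum_pd]
      rfl
  have hv' : fderiv ℂ η.dualField 0 v = 0 := hv
  have hw' : fderiv ℂ η.dualField 0 w = β • w := hw
  rw [hd] at hv' hw'
  have v0 := congrFun hv' 0
  have v1 := congrFun hv' 1
  have w0 := congrFun hw' 0
  have w1 := congrFun hw' 1
  simp only [Fin.sum_univ_two, Matrix.cons_val_zero, Matrix.cons_val_one, Matrix.cons_val_fin_one,
    Pi.smul_apply, Pi.zero_apply, smul_eq_mul] at v0 v1 w0 w1
  have hpb : ∀ z, η.pullback (linMap v w) z = ![η (linMap v w z) 0 * v 0 + η (linMap v w z) 1 * v 1,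
      η (linMap v w z) 0 * w 0 + η (linMap v w z) 1 * w 1] := by
    intro z
    have hdz := (analyticAt_linMap v w z).differentiableAt
    funext j
    fin_cases j
    · simp [OneForm.pullback, pd_eq_partialD hdz, (pd_linMap v w z _).1]
    · simp [OneForm.pullback, pd_eq_partialD hdz, (pd_linMap v w z _).2]
  have hcomp : ∀ i, AnalyticAt ℂ (fun z => η (linMap v w z) i) 0 := fun i =>
    AnalyticAt.comp (g := fun z => η z i) (by rw [hL.zero]; exact hη.coord i) hL.analyticAt
  have hpdc : ∀ i, pd 0 (fun z => η (linMap v w z) i) 0 =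
        v 0 * pd 0 (fun z => η z i) 0 + v 1 * pd 1 (fun z => η z i) 0 ∧
      pd 1 (fun z => η (linMap v w z) i) 0 =
        w 0 * pd 0 (fun z => η z i) 0 + w 1 * pd 1 (fun z => η z i) 0 := by
    intro i
    have e : DifferentiableAt ℂ (fun z => η z i) (linMap v w 0) := by
      rw [hL.zero]; exact (hη.coord i).differentiableAt
    have e' := (analyticAt_linMap v w 0).differentiableAt
    constructor
    · rw [pd_comp (f := fun z => η z i) 0 e e', Fin.sum_univ_two, (pd_linMap v w 0 _).1,
        (pd_linMap v w 0 _).1, hL.zero]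
    · rw [pd_comp (f := fun z => η z i) 1 e e', Fin.sum_univ_two, (pd_linMap v w 0 _).2,
        (pd_linMap v w 0 _).2, hL.zero]
  have hcst : ∀ c : ℂ, AnalyticAt ℂ (fun _ : CSpace 2 => c) 0 := fun c => analyticAt_const
  have hpd : ∀ (j : Fin 2) (a b : ℂ), pd j (fun z => η (linMap v w z) 0 * a +
      η (linMap v w z) 1 * b) 0 = pd j (fun z => η (linMap v w z) 0) 0 * a +
        pd j (fun z => η (linMap v w z) 1) 0 * b := by
    intro j a b
    rw [pd_add j ((hcomp 0).fun_mul (hcst a)).differentiableAt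
      ((hcomp 1).fun_mul (hcst b)).differentiableAt,
      pd_mul j (hcomp 0).differentiableAt (hcst a).differentiableAt,
      pd_mul j (hcomp 1).differentiableAt (hcst b).differentiableAt, pd_const, pd_const]
    ring
  refine ⟨OneForm.analyticAt_pullback (by rw [hL.zero]; exact hη) hL.analyticAt, ?_, ?_, ?_, ?_, ?_⟩
  · rw [hpb, hL.zero, h0]
    funext i; fin_cases i <;> simp
  · simp only [hpb, Matrix.cons_val_zero]
    rw [hpd, (hpdc 0).1, (hpdc 1).1, v0]
    linear_combination -v 0 * v1
  · simp only [hpb, Matrix.cons_val_zero]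
    rw [hpd, (hpdc 0).2, (hpdc 1).2, w0]
    intro h
    -- The coefficient of `y dx` is `-β` times the determinant of `v`, `w`.
    have : β * (v 0 * w 1 - v 1 * w 0) = 0 := by linear_combination -h - v 0 * w1
    exact (mul_ne_zero hβ hdet) this
  · simp only [hpb, Matrix.cons_val_one, Matrix.cons_val_fin_one]
    rw [hpd, (hpdc 0).1, (hpdc 1).1, v0]
    linear_combination -w 0 * v1
  · simp only [hpb, Matrix.cons_val_one, Matrix.cons_val_fin_one]
    rw [hpd, (hpdc 0).2, (hpdc 1).2, w0]
    linear_combination -w 0 * w1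

/-! ### Divisibility of germs along a resolving sequence -/

/-- Further blow-ups leave `x` unchanged. They affect a genuine power of `y` only when all `c`
vanish, and then they replace `y` by `x^K y`. -/
theorem isResolving_monomial {c : ℕ → ℂ} {s N k m : ℕ} {f u : CSpace 2 → ℂ}
    (hu : AnalyticAt ℂ u 0) (hu0 : u 0 ≠ 0)
    (hfu : ∀ᶠ z in 𝓝 0, f (iterBlowUp c s N z) = z 0 ^ k * z 1 ^ m * u z)
    (hm : m = 0 ∨ ∀ j, c j = 0) (K : ℕ) :
    ∃ u' : CSpace 2 → ℂ, AnalyticAt ℂ u' 0 ∧ u' 0 ≠ 0 ∧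
      ∀ᶠ z in 𝓝 0, f (iterBlowUp c s (N + K) z) = z 0 ^ (k + K * m) * z 1 ^ m * u' z := by
  refine ⟨fun z => u (iterBlowUp c (s + N) K z), hu.comp_iterBlowUp _ _ _, by simpa using hu0, ?_⟩
  filter_upwards [(tendsto_iterBlowUp c (s + N) K).eventually hfu] with z e1
  rw [iterBlowUp_add, Function.comp_apply, e1, iterBlowUp_apply_zero]
  rcases hm with rfl | hc
  · simp
  · rw [iterBlowUp_apply_one hc]; ring

/-- After finitely many blow-ups the germ `f` divides the germ `g`. -/
def EventuallyDvd (c : ℕ → ℂ) (s N : ℕ) (f g : CSpace 2 → ℂ) : Prop :=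
  ∃ h : CSpace 2 → ℂ, AnalyticAt ℂ h 0 ∧
    ∀ᶠ z in 𝓝 0, g (iterBlowUp c s N z) = f (iterBlowUp c s N z) * h z

theorem EventuallyDvd.mono {c : ℕ → ℂ} {s N : ℕ} {f g : CSpace 2 → ℂ}
    (h : EventuallyDvd c s N f g) (K : ℕ) : EventuallyDvd c s (N + K) f g := by
  obtain ⟨w, hw, hfg⟩ := h
  refine ⟨fun z => w (iterBlowUp c (s + N) K z), hw.comp_iterBlowUp _ _ _, ?_⟩
  filter_upwards [(tendsto_iterBlowUp c (s + N) K).eventually hfg] with z e1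
  rw [iterBlowUp_add, Function.comp_apply, e1]

theorem EventuallyDvd.trans {c : ℕ → ℂ} {s N : ℕ} {f g w : CSpace 2 → ℂ}
    (h : EventuallyDvd c s N f g) (h' : EventuallyDvd c s N g w) : EventuallyDvd c s N f w := by
  obtain ⟨a, ha, hfg⟩ := h
  obtain ⟨b, hb, hgw⟩ := h'
  refine ⟨fun z => a z * b z, ha.mul hb, ?_⟩
  filter_upwards [hfg, hgw] with z e1 e2
  rw [e2, e1]; ring

theorem EventuallyDvd.of_monomial {c : ℕ → ℂ} {s N k m k' m' : ℕ} {f g u u' : CSpace 2 → ℂ}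
    (hu : AnalyticAt ℂ u 0) (hu0 : u 0 ≠ 0) (hu' : AnalyticAt ℂ u' 0)
    (hf : ∀ᶠ z in 𝓝 0, f (iterBlowUp c s N z) = z 0 ^ k * z 1 ^ m * u z)
    (hg : ∀ᶠ z in 𝓝 0, g (iterBlowUp c s N z) = z 0 ^ k' * z 1 ^ m' * u' z)
    (hk : k ≤ k') (hm : m ≤ m') : EventuallyDvd c s N f g := by
  obtain ⟨a, rfl⟩ := Nat.exists_eq_add_of_le hk
  obtain ⟨b, rfl⟩ := Nat.exists_eq_add_of_le hm
  refine ⟨fun z => z 0 ^ a * z 1 ^ b * (u' z / u z), (((analyticAt_coord 0 0).fun_pow a).mul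
    ((analyticAt_coord 1 0).fun_pow b)).mul (hu'.div hu hu0), ?_⟩
  filter_upwards [hf, hg, hu.continuousAt.eventually_ne hu0] with z e1 e2 e3
  rw [e1, e2]
  field_simp
  ring

/-- Resolved germs are monomials up to units. If their `y`-exponents differ, each blow-up enlarges
the `x`-exponent more for the germ with the larger one, so the two exponents end up ordered alike;
if they agree, the `x`-exponents decide. -/
theorem IsResolving.eventuallyDvd_total {c : ℕ → ℂ} (hc : IsResolving c) (s : ℕ)
    {f g : CSpace 2 → ℂ} (hf : AnalyticAt ℂ f 0) (hg : AnalyticAt ℂ g 0) :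
    ∃ N, EventuallyDvd c s N f g ∨ EventuallyDvd c s N g f := by
  by_cases hf0 : ∀ᶠ z in 𝓝 (0 : CSpace 2), f z = 0
  · refine ⟨0, Or.inr ⟨fun _ => 0, analyticAt_const, ?_⟩⟩
    filter_upwards [hf0] with z e1
    simpa [iterBlowUp] using e1
  by_cases hg0 : ∀ᶠ z in 𝓝 (0 : CSpace 2), g z = 0
  · refine ⟨0, Or.inl ⟨fun _ => 0, analyticAt_const, ?_⟩⟩
    filter_upwards [hg0] with z e1
    simpa [iterBlowUp] using e1
  obtain ⟨N, k, m, u, hu, hu0, hfu, hm⟩ := hc s f hf hf0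
  obtain ⟨N', k', m', u', hu', hu0', hgu, hm'⟩ := hc s g hg hg0
  -- After `X` further blow-ups a difference of at least one in the `y`-exponents contributes at
  -- least `X` to the `x`-exponent, which outweighs all the initial terms.
  set X := k + N' * m + k' + N * m' with hX
  obtain ⟨v, hv, hv0, hfv⟩ := isResolving_monomial hu hu0 hfu hm (N' + X)
  obtain ⟨v', hv', hv0', hgv⟩ := isResolving_monomial hu' hu0' hgu hm' (N + X)
  rw [show N' + (N + X) = N + (N' + X) by ring] at hgv
  refine ⟨N + (N' + X), ?_⟩
  have key : ∀ a b : ℕ, a < b → X * a + X ≤ X * b := fun a b hab => by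
    calc X * a + X = X * (a + 1) := by ring
      _ ≤ X * b := Nat.mul_le_mul_left X hab
  rcases lt_trichotomy m m' with hlt | heq | hgt
  · refine Or.inl (EventuallyDvd.of_monomial hv hv0 hv' hfv hgv ?_ hlt.le)
    have := key m m' hlt
    nlinarith
  · subst heq
    rcases le_total (k + (N' + X) * m) (k' + (N + X) * m) with h | h
    · exact Or.inl (EventuallyDvd.of_monomial hv hv0 hv' hfv hgv h le_rfl)
    · exact Or.inr (EventuallyDvd.of_monomial hv' hv0' hv hgv hfv h le_rfl)
  · refine Or.inr (EventuallyDvd.of_monomial hv' hv0' hv hgv hfv ?_ hgt.le)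
    have := key m' m hgt
    nlinarith

/-- Finitely many germs thus generate, after blow-ups, an ideal generated by one of them. This is
what lifting through one blow-up of the target requires. -/
theorem IsResolving.exists_forall_eventuallyDvd {c : ℕ → ℂ} (hc : IsResolving c) (s : ℕ)
    {ι : Type*} {f : ι → CSpace 2 → ℂ} (hf : ∀ i, AnalyticAt ℂ (f i) 0) (S : Finset ι)
    (hS : S.Nonempty) : ∃ i ∈ S, ∃ N, ∀ j ∈ S, EventuallyDvd c s N (f i) (f j) := by
  induction hS using Finset.Nonempty.cons_induction with
  | singleton a =>
    refine ⟨a, by simp, 0, fun j hj => ?_⟩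
    rw [Finset.mem_singleton.1 hj]
    exact ⟨fun _ => 1, analyticAt_const, Eventually.of_forall fun z => by simp⟩
  | cons a S ha _ ih =>
    obtain ⟨i, hi, N, hN⟩ := ih
    obtain ⟨K, hK⟩ := hc.eventuallyDvd_total s (hf a) (hf i)
    rcases hK with hK | hK
    · refine ⟨a, by simp, K + N, fun j hj => ?_⟩
      rcases Finset.mem_cons.1 hj with rfl | hj
      · exact ⟨fun _ => 1, analyticAt_const, Eventually.of_forall fun z => by simp⟩
      · refine (hK.mono N).trans ?_
        rw [add_comm]
        exact (hN j hj).mono K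
    · refine ⟨i, by simp [hi], K + N, fun j hj => ?_⟩
      rcases Finset.mem_cons.1 hj with rfl | hj
      · exact hK.mono N
      · rw [add_comm]
        exact (hN j hj).mono K

/-! ### Compositions of blow-ups in charts, and lifting -/

theorem CMfd.analyticAt_transition {n : ℕ} {M : CMfd n}
    {e e' : OpenPartialHomeomorph M (CSpace n)} (he : e ∈ M.charts) (he' : e' ∈ M.charts) {p : M}
    (hp : p ∈ e.source) (hp' : p ∈ e'.source) : AnalyticAt ℂ (e' ∘ e.symm) (e p) := by
  have h1 : ContMDiffAt 𝓘(ℂ, CSpace n) 𝓘(ℂ, CSpace n) ω e.symm (e p) :=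
    (contMDiffOn_symm_of_mem_maximalAtlas he).contMDiffAt
      (e.open_target.mem_nhds (e.map_source hp))
  have h2 : ContMDiffAt 𝓘(ℂ, CSpace n) 𝓘(ℂ, CSpace n) ω e' (e.symm (e p)) := by
    rw [e.left_inv hp]
    exact (contMDiffOn_of_mem_maximalAtlas he').contMDiffAt (e'.open_source.mem_nhds hp')
  exact (contMDiffAt_iff_contDiffAt.1 (h2.comp _ h1)).analyticAt

theorem CMfd.ofOpens_chartAt {n : ℕ} {U : TopologicalSpace.Opens (CSpace n)}
    (p x : CMfd.ofOpens U) :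
    chartAt (CSpace n) p x = Subtype.val (p := (· ∈ U)) x := rfl

theorem CMfd.chartAt_mem_charts {n : ℕ} {M : CMfd n} (p : M) : chartAt (CSpace n) p ∈ M.charts :=
  IsManifold.chart_mem_maximalAtlas p

theorem analyticAt_blowUpChart {n : ℕ} (S : Finset (Fin n)) (i : Fin n) (a : CSpace n) :
    AnalyticAt ℂ (blowUpChart S i) a := by
  refine analyticAt_pi_iff.2 fun j => ?_
  unfold blowUpChart
  split_ifs
  · exact (analyticAt_coord i a).mul (analyticAt_coord j a)
  · exact analyticAt_coord j a

theorem OpenPartialHomeomorph.eventually_symm_mem {X Y : Type*} [TopologicalSpace X]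
    [TopologicalSpace Y] (e : OpenPartialHomeomorph X Y) {p : X} (hp : p ∈ e.source) {s : Set X}
    (hs : IsOpen s) (hps : p ∈ s) : ∀ᶠ y in 𝓝 (e p), y ∈ e.target ∧ e.symm y ∈ s := by
  refine (e.open_target.eventually_mem (e.map_source hp)).and ?_
  refine (e.continuousAt_symm (e.map_source hp)).eventually (hs.eventually_mem ?_)
  rwa [e.left_inv hp]

theorem IsBlowUpComposition.analyticAt {n : ℕ} {C : ∀ M : CMfd n, Set M → Prop}
    {U : TopologicalSpace.Opens (CSpace n)} {M : CMfd n} {π : M → CSpace n}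
    (h : IsBlowUpComposition C U M π) {e : OpenPartialHomeomorph M (CSpace n)}
    (he : e ∈ M.charts) {p : M} (hp : p ∈ e.source) : AnalyticAt ℂ (π ∘ e.symm) (e p) := by
  induction h with
  | base =>
    exact CMfd.analyticAt_transition he (CMfd.chartAt_mem_charts p) hp (mem_chart_source _ p)
  | @step M M' π g Y _ _ hg ih =>
    obtain ⟨e₁, he₁, hy, S, -, -, c, hc1, hc2, -⟩ := hg (g p)
    obtain ⟨i, hi, hpi⟩ := hc2 p hy
    obtain ⟨hci, -, hcg⟩ := hc1 i hi
    have hval : e₁ (g p) = blowUpChart S i (c i p) := (hcg p hpi).2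
    have h1 : AnalyticAt ℂ (c i ∘ e.symm) (e p) := CMfd.analyticAt_transition he hci hp hpi
    have h2 : AnalyticAt ℂ ((π ∘ e₁.symm) ∘ blowUpChart S i ∘ c i ∘ e.symm) (e p) := by
      refine AnalyticAt.comp ?_ ((analyticAt_blowUpChart S i _).comp h1)
      simp only [Function.comp_apply, e.left_inv hp, ← hval]
      exact ih he₁ hy
    refine h2.congr ?_
    filter_upwards [e.eventually_symm_mem hp (c i).open_source hpi] with y hy
    obtain ⟨h3, h4⟩ := hcg _ hy.2
    simp only [Function.comp_apply]
    rw [← h4, e₁.left_inv h3]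

/-- Lifting of a germ of holomorphic map through a composition of blow-ups, after sufficiently many
blow-ups at the source. -/
theorem IsBlowUpComposition.exists_lift {n : ℕ} {C : ∀ M : CMfd n, Set M → Prop}
    {U : TopologicalSpace.Opens (CSpace n)} (hU : (0 : CSpace n) ∈ U) {M : CMfd n}
    {π : M → CSpace n} (h : IsBlowUpComposition C U M π) {c : ℕ → ℂ} (hc : IsResolving c)
    {ψ : CSpace 2 → CSpace n} (hψ : AnalyticAt ℂ ψ 0) (hψ0 : ψ 0 = 0) :
    ∃ (N : ℕ) (p : M) (e : OpenPartialHomeomorph M (CSpace n)) (u : CSpace 2 → CSpace n),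
      e ∈ M.charts ∧ p ∈ e.source ∧ π p = 0 ∧ AnalyticAt ℂ u 0 ∧ u 0 = e p ∧
        ∀ᶠ z in 𝓝 0, π (e.symm (u z)) = ψ (iterBlowUp c 0 N z) := by
  induction h with
  | base =>
    let p : CMfd.ofOpens U := (⟨0, hU⟩ : U)
    refine ⟨0, p, chartAt (CSpace n) p, ψ, CMfd.chartAt_mem_charts p, mem_chart_source _ p, rfl, hψ,
      hψ0, ?_⟩
    have ht : ∀ᶠ z in 𝓝 0, ψ z ∈ (chartAt (CSpace n) p).target := by
      refine hψ.continuousAt.eventually ((chartAt (CSpace n) p).open_target.eventually_mem ?_)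
      rw [hψ0]
      exact (chartAt (CSpace n) p).map_source (mem_chart_source _ p)
    filter_upwards [ht] with z hz
    have := (chartAt (CSpace n) p).right_inv hz
    rwa [CMfd.ofOpens_chartAt] at this
  | @step M M' π g Y _ _ hg ih =>
    obtain ⟨N, p, e, u, he, hp, hπp, hu, hu0, hlift⟩ := ih
    obtain ⟨e', he', hp', S, hS, -, b, hb1, -, -⟩ := hg p
    have htr : AnalyticAt ℂ (e' ∘ e.symm) (u 0) := by
      rw [hu0]; exact CMfd.analyticAt_transition he he' hp hp'
    set w : CSpace 2 → CSpace n := fun z => e' (e.symm (u z)) with hw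
    have hwa : AnalyticAt ℂ w 0 := htr.comp hu
    have hw0 : w 0 = e' p := by simp only [hw, hu0, e.left_inv hp]
    -- Among the equations of the center, one pulls back to a divisor of all the others after `K`
    -- blow-ups; its index selects the chart of the blow-up that receives the lift.
    obtain ⟨i, hi, K, hK⟩ := hc.exists_forall_eventuallyDvd (0 + N)
      (f := fun j z => w z j) (fun j => hwa.coord j) S hS
    choose! q hq hqw using hK
    obtain ⟨hbi, hbt, hbg⟩ := hb1 i hi
    set ι := iterBlowUp c (0 + N) K with hι
    have hι0 : ι 0 = 0 := iterBlowUp_zero _ _ _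
    have hιt : Tendsto ι (𝓝 0) (𝓝 0) := tendsto_iterBlowUp _ _ _
    -- In the selected chart the coordinates of the lift are the quotients by the `i`-th equation,
    -- and the original coordinates elsewhere.
    set v : CSpace 2 → CSpace n := fun z j => if j ∈ S ∧ j ≠ i then q j z else w (ι z) j with hv
    have hva : AnalyticAt ℂ v 0 := by
      refine analyticAt_pi_iff.2 fun j => ?_
      by_cases hj : j ∈ S ∧ j ≠ i
      · simpa only [hv, hj, and_self, ne_eq, not_false_eq_true, if_true] using hq j hj.1
      · simp only [hj, if_false]
        exact (hwa.coord j).comp_iterBlowUp c (0 + N) K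
    have hchart : ∀ᶠ z in 𝓝 0, blowUpChart S i (v z) = w (ι z) := by
      have : ∀ᶠ z in 𝓝 0, ∀ j, j ∈ S → w (ι z) j = w (ι z) i * q j z :=
        eventually_all.2 fun j => by
          by_cases hj : j ∈ S
          · exact (hqw j hj).mono fun z hz _ => hz
          · exact Eventually.of_forall fun z hj' => absurd hj' hj
      filter_upwards [this] with z hz
      funext j
      by_cases hj : j ∈ S ∧ j ≠ i
      · simp only [blowUpChart, hv, hj, and_self, ne_eq, not_false_eq_true, if_true,
          not_true_eq_false, and_false, if_false]
        exact (hz j hj.1).symm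
      · simp only [blowUpChart, hv, hj, if_false]
    have hchart0 : blowUpChart S i (v 0) = e' p := by
      rw [hchart.self_of_nhds, hι0, hw0]
    have hvt : v 0 ∈ (b i).target := by
      rw [hbt, Set.mem_preimage, hchart0]
      exact e'.map_source hp'
    have hsrc := (b i).map_target hvt
    obtain ⟨hg1, hg2⟩ := hbg _ hsrc
    have hgp : g ((b i).symm (v 0)) = p := by
      refine e'.injOn hg1 hp' ?_
      rw [hg2, (b i).right_inv hvt, hchart0]
    refine ⟨N + K, (b i).symm (v 0), b i, v, hbi, hsrc, ?_, hva, ((b i).right_inv hvt).symm, ?_⟩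
    · simp only [Function.comp_apply, hgp, hπp]
    · have hsm : ∀ᶠ z in 𝓝 0, e.symm (u z) ∈ e'.source := by
        have h2 := e.eventually_symm_mem hp e'.open_source hp'
        rw [← hu0] at h2
        exact (hu.continuousAt.eventually h2).mono fun z hz => hz.2
      filter_upwards [hva.continuousAt.eventually ((b i).open_target.eventually_mem hvt), hchart,
        hιt.eventually hlift, hιt.eventually hsm] with z e1 e2 e3 e4
      obtain ⟨h3, h4⟩ := hbg _ ((b i).map_target e1)
      rw [(b i).right_inv e1, e2] at h4
      have h5 : g ((b i).symm (v z)) = e.symm (u (ι z)) := e'.injOn h3 e4 h4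
      rw [Function.comp_apply, h5, e3, iterBlowUp_add]
      rfl

/-! ### Pull-backs along a resolving tower -/

theorem not_eventually_monomial_eq_zero {k m : ℕ} {u : CSpace 2 → ℂ} (hu : AnalyticAt ℂ u 0)
    (hu0 : u 0 ≠ 0) : ¬ ∀ᶠ z in 𝓝 (0 : CSpace 2), z 0 ^ k * z 1 ^ m * u z = 0 := by
  intro h
  have h0 := (analyticAt_coord (n := 2) 0 0).fun_pow k
  have h1 := (analyticAt_coord (n := 2) 1 0).fun_pow m
  rcases AnalyticAt.eventually_eq_zero_or_of_mul (h0.mul h1) hu h with h2 | h2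
  · rcases AnalyticAt.eventually_eq_zero_or_of_mul h0 h1 h2 with h3 | h3
    · exact not_eventually_pow_eq_zero 0 k h3
    · exact not_eventually_pow_eq_zero 1 m h3
  · exact hu0 h2.self_of_nhds

/-- A non-zero germ cannot be killed by a blow-up, since higher in the tower it becomes a monomial
times a unit, which is not zero. -/
theorem IsResolving.eventually_eq_zero_of_comp {c : ℕ → ℂ} (hc : IsResolving c) {s : ℕ}
    {f : CSpace 2 → ℂ} (hf : AnalyticAt ℂ f 0)
    (h : ∀ᶠ z in 𝓝 (0 : CSpace 2), f (dirBlowUp (c s) z) = 0) :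
    ∀ᶠ z in 𝓝 (0 : CSpace 2), f z = 0 := by
  by_contra h0
  obtain ⟨N, k, m, u, hu, hu0, hfu, hm⟩ := hc s f hf h0
  -- The extra blow-up makes the composition have at least one factor, so that it passes through
  -- `dirBlowUp (c s)` even if `N = 0`.
  obtain ⟨v, hv, hv0, hfv⟩ := isResolving_monomial hu hu0 hfu hm 1
  refine not_eventually_monomial_eq_zero (k := k + 1 * m) (m := m) hv hv0 ?_
  filter_upwards [hfv, (tendsto_iterBlowUp c (s + 1) N).eventually h] with z e1 e2
  rw [← e1]
  exact e2

/-- This preserves generic transversality up the tower. The `dy` coefficient of the pull-back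
determines the second coefficient of the form, after which the `dx` coefficient determines the
first. -/
theorem IsResolving.isZeroGerm_of_pullback {c : ℕ → ℂ} (hc : IsResolving c) {s : ℕ} (N : ℕ)
    {α : OneForm 2} (hα : AnalyticAt ℂ α 0)
    (h : (α.pullback (iterBlowUp c s N)).IsZeroGerm) : α.IsZeroGerm := by
  induction N with
  | zero =>
    have : iterBlowUp c s 0 = id := rfl
    rwa [this, OneForm.pullback_id] at h
  | succ N ih =>
    apply ih
    set α' := α.pullback (iterBlowUp c s N) with hα'
    have hα'a : AnalyticAt ℂ α' 0 := OneForm.analyticAt_pullback (by simpa using hα)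
      (analyticAt_iterBlowUp _ _ _ _)
    have hz : ∀ᶠ z in 𝓝 0, α'.pullback (dirBlowUp (c (s + N))) z = 0 := by
      rw [iterBlowUp_succ] at h
      filter_upwards [h, OneForm.pullback_pullback α (a := 0) (analyticAt_iterBlowUp c s N _)
        (analyticAt_dirBlowUp (c (s + N)) 0)] with z e1 e2
      rw [hα', e2, e1]
    have h1 : ∀ᶠ z in 𝓝 0, α' (dirBlowUp (c (s + N)) z) 1 = 0 := by
      refine AnalyticAt.eventually_eq_of_mul_eq (analyticAt_coord 0 0)
        ((hα'a.coord 1).comp_dirBlowUp _) (g := fun _ => 0) analyticAt_const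
        (not_eventually_coord_eq_zero 0) ?_
      filter_upwards [hz] with z e1
      have := congrFun e1 1
      rw [pullback_dirBlowUp_one] at this
      rw [mul_comm, this]; simp
    have h0 : ∀ᶠ z in 𝓝 0, α' (dirBlowUp (c (s + N)) z) 0 = 0 := by
      filter_upwards [hz, h1] with z e1 e2
      have := congrFun e1 0
      rw [pullback_dirBlowUp_zero, e2] at this
      simpa using this
    filter_upwards [hc.eventually_eq_zero_of_comp (hα'a.coord 0) h0,
      hc.eventually_eq_zero_of_comp (hα'a.coord 1) h1] with z e1 e2
    funext i; fin_cases i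
    · exact e1
    · exact e2

/-- The germs of 1-forms `θ` and `η` are proportional. -/
def OneForm.IsProportional {n : ℕ} (θ η : OneForm n) : Prop :=
  ∀ᶠ x in 𝓝 (0 : CSpace n), ∀ i j : Fin n, θ x i * η x j = θ x j * η x i

theorem IsTower.isProportional_pullback {c : ℕ → ℂ} {η : ℕ → OneForm 2} (ht : IsTower c η)
    {s : ℕ} (N : ℕ) {α : OneForm 2} (hα : AnalyticAt ℂ α 0) (h : α.IsProportional (η s)) :
    (α.pullback (iterBlowUp c s N)).IsProportional (η (s + N)) := by
  have hα' : AnalyticAt ℂ (α.pullback (iterBlowUp c s N)) 0 :=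
    OneForm.analyticAt_pullback (by simpa using hα) (analyticAt_iterBlowUp _ _ _ _)
  have hη := (ht.isNormalized (s + N)).analyticAt
  unfold OneForm.IsProportional
  rw [eventually_all]; intro i
  rw [eventually_all]; intro j
  refine AnalyticAt.eventually_eq_of_mul_eq ((analyticAt_coord 0 0).fun_pow N)
    ((hα'.coord i).mul (hη.coord j)) ((hα'.coord j).mul (hη.coord i))
    (not_eventually_pow_eq_zero 0 N) ?_
  filter_upwards [(tendsto_iterBlowUp c s N).eventually h, ht.pullback s N] with z e1 e2
  have e3 := OneForm.pullback_wedge (φ := iterBlowUp c s N) e1 i j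
  simp only [e2, Pi.smul_apply, smul_eq_mul] at e3
  linear_combination e3

/-! ### Simple complex hyperbolic points -/

section LogForm

variable {n τ : ℕ} (h : τ ≤ n) {lam : Fin τ → ℂ} {b : Fin τ → CSpace τ → ℂ}

theorem logForm_castLE (x : CSpace n) (i : Fin τ) :
    logForm h lam b x (Fin.castLE h i) = (lam i + b i (fun j => x (Fin.castLE h j))) *
      ∏ j ∈ Finset.univ.erase i, x (Fin.castLE h j) := by
  simp [logForm]

theorem logForm_of_le (x : CSpace n) {k : Fin n} (hk : τ ≤ k) : logForm h lam b x k = 0 := by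
  simp [logForm, hk]

theorem logForm_eq_zero_of_coord (x : CSpace n) {i : Fin τ} (hx : x (Fin.castLE h i) = 0)
    {k : Fin n} (hk : k ≠ Fin.castLE h i) : logForm h lam b x k = 0 := by
  rcases lt_or_ge (k : ℕ) τ with hlt | hge
  · have hk' : k = Fin.castLE h ⟨k, hlt⟩ := rfl
    rw [hk', logForm_castLE, Finset.prod_eq_zero (i := i), mul_zero]
    · rw [Finset.mem_erase]
      exact ⟨fun hi => hk (hi ▸ hk'), Finset.mem_univ _⟩
    · exact hx
  · exact logForm_of_le h x hge

theorem analyticAt_comp_castLE {g : CSpace τ → ℂ} (hg : AnalyticAt ℂ g 0) :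
    AnalyticAt ℂ (fun x : CSpace n => g fun j => x (Fin.castLE h j)) 0 :=
  AnalyticAt.comp (g := g) (by exact hg) (analyticAt_pi_iff.2 fun j => analyticAt_coord _ 0)

theorem analyticAt_logForm (hb : ∀ i, AnalyticAt ℂ (b i) 0) :
    AnalyticAt ℂ (logForm h lam b) 0 := by
  refine analyticAt_pi_iff.2 fun k => ?_
  rcases lt_or_ge (k : ℕ) τ with hlt | hge
  · have hk' : k = Fin.castLE h ⟨k, hlt⟩ := rfl
    rw [hk']
    simp only [logForm_castLE]
    exact (analyticAt_const.add (analyticAt_comp_castLE h (hb _))).mul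
      (Finset.analyticAt_fun_prod _ fun j _ => analyticAt_coord _ 0)
  · simp only [logForm_of_le h _ hge]
    exact analyticAt_const

theorem IsNonResonant.ne_zero (hlam : IsNonResonant lam) (i : Fin τ) : lam i ≠ 0 := by
  have := hlam (Pi.single i 1) (by simp)
  rw [Finset.sum_eq_single i] at this
  · simpa using this
  · intro j _ hj; simp [hj]
  · simp

/-- A 1-form proportional to `logForm` is tangent to the divisor `x_i = 0`, `i ≤ τ`. -/
theorem OneForm.eq_zero_of_isProportional_logForm {θ : OneForm n} (hθ : AnalyticAt ℂ θ 0)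
    (hb : ∀ i, AnalyticAt ℂ (b i) 0) (hb0 : ∀ i, b i 0 = 0) (hlam : IsNonResonant lam)
    (hprop : θ.IsProportional (logForm h lam b)) (i : Fin τ) :
    ∀ᶠ x in 𝓝 (0 : CSpace n), x (Fin.castLE h i) = 0 → ∀ k ≠ Fin.castLE h i, θ x k = 0 := by
  have hunit : ∀ᶠ x in 𝓝 (0 : CSpace n), lam i + b i (fun j => x (Fin.castLE h j)) ≠ 0 := by
    have ha : AnalyticAt ℂ (fun x : CSpace n => lam i + b i (fun j => x (Fin.castLE h j))) 0 :=
      analyticAt_const.add (analyticAt_comp_castLE h (hb i))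
    refine ha.continuousAt.eventually_ne ?_
    have : b i (fun j => (0 : CSpace n) (Fin.castLE h j)) = 0 := hb0 i
    rw [this, add_zero]
    exact hlam.ne_zero i
  have hev := (hθ.eventually_analyticAt.and (hunit.and hprop)).eventually_nhds
  filter_upwards [hev] with x hx hxi k hk
  -- Moving from `x` in this direction stays in the divisor `x_i = 0` and makes all other
  -- coordinates non-zero for small `t ≠ 0`. There the `i`-th coefficient of the logarithmic form is
  -- non-zero, which forces `θ_k = 0`; continuity gives the value at `x` itself.
  set d : CSpace n := Function.update (fun _ => 1) (Fin.castLE h i) 0 with hd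
  have hγ : Tendsto (fun t : ℂ => x + t • d) (𝓝[≠] 0) (𝓝 x) := by
    have : Continuous (fun t : ℂ => x + t • d) := by fun_prop
    have h1 := this.tendsto 0
    simp only [zero_smul, add_zero] at h1
    exact h1.mono_left nhdsWithin_le_nhds
  have hne : ∀ᶠ t : ℂ in 𝓝[≠] 0, ∀ j, j ≠ Fin.castLE h i → (x + t • d) j ≠ 0 := by
    rw [eventually_all]; intro j
    by_cases hj : j = Fin.castLE h i
    · exact Eventually.of_forall fun t hj' => absurd hj hj'
    · have hval : ∀ t : ℂ, (x + t • d) j = x j + t := fun t => by simp [hd, hj]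
      simp only [hval]
      by_cases hxj : x j = 0
      · filter_upwards [eventually_mem_nhdsWithin] with t ht _
        simpa [hxj] using ht
      · have hc : ContinuousAt (fun t : ℂ => x j + t) 0 := by fun_prop
        have : ∀ᶠ t : ℂ in 𝓝 0, x j + t ≠ 0 := hc.eventually_ne (by simpa using hxj)
        exact (this.filter_mono nhdsWithin_le_nhds).mono fun t ht _ => ht
  have hz : ∀ᶠ t : ℂ in 𝓝[≠] 0, θ (x + t • d) k = 0 := by
    filter_upwards [hγ.eventually hx, hne] with t ⟨_, e1, e2⟩ e3
    have hxi' : (x + t • d) (Fin.castLE h i) = 0 := by simp [hd, hxi]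
    have e4 := e2 k (Fin.castLE h i)
    rw [logForm_eq_zero_of_coord h _ hxi' hk, mul_zero, logForm_castLE] at e4
    refine (mul_eq_zero.1 e4).resolve_right (mul_ne_zero e1 (Finset.prod_ne_zero_iff.2 ?_))
    intro j hj
    exact e3 _ fun hji => (Finset.mem_erase.1 hj).1 (Fin.castLE_injective h hji)
  have hcont : Tendsto (fun t : ℂ => θ (x + t • d) k) (𝓝[≠] 0) (𝓝 (θ x k)) :=
    ((hx.self_of_nhds.1.coord k).continuousAt.tendsto).comp hγ
  exact tendsto_nhds_unique hcont (tendsto_const_nhds.congr' (hz.mono fun t ht => ht.symm))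

/-- A map into the divisor `x_i = 0` pulls back `dx_i` to zero, while the other coefficients of `θ`
vanish on the divisor; the pull-back of `θ` would be zero. -/
theorem OneForm.not_eventually_coord_eq_zero_of_pullback {θ : OneForm n} (hθ : AnalyticAt ℂ θ 0)
    (hb : ∀ i, AnalyticAt ℂ (b i) 0) (hb0 : ∀ i, b i 0 = 0) (hlam : IsNonResonant lam)
    (hprop : θ.IsProportional (logForm h lam b)) {Ψ : CSpace 2 → CSpace n}
    (hΨ : AnalyticAt ℂ Ψ 0) (hΨ0 : Ψ 0 = 0) (hne : ¬ (θ.pullback Ψ).IsZeroGerm) (i : Fin τ) :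
    ¬ ∀ᶠ z in 𝓝 (0 : CSpace 2), Ψ z (Fin.castLE h i) = 0 := by
  intro hz
  apply hne
  have ht : Tendsto Ψ (𝓝 0) (𝓝 0) := by simpa [hΨ0] using hΨ.continuousAt.tendsto
  filter_upwards [hz, ht.eventually (θ.eq_zero_of_isProportional_logForm h hθ hb hb0 hlam hprop i),
    eventually_all.2 (EventuallyEq.pd (f := fun z => Ψ z (Fin.castLE h i)) (g := fun _ => 0) hz),
    hΨ.eventually_analyticAt] with z e1 e2 e3 e4
  funext j
  rw [OneForm.pullback]
  refine Finset.sum_eq_zero fun k _ => ?_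
  by_cases hk : k = Fin.castLE h i
  · rw [hk, pd_eq_partialD e4.differentiableAt, e3, pd_const, mul_zero]
  · rw [e2 e1 k hk, zero_mul]

theorem pullback_logForm_apply {Ψ : CSpace 2 → CSpace n} {z : CSpace 2}
    (hΨ : DifferentiableAt ℂ Ψ z) (j : Fin 2) :
    (logForm h lam b).pullback Ψ z j = ∑ i : Fin τ,
      (lam i + b i (fun q => Ψ z (Fin.castLE h q))) *
        (∏ q ∈ Finset.univ.erase i, Ψ z (Fin.castLE h q)) *
          pd j (fun z => Ψ z (Fin.castLE h i)) z := by
  rw [OneForm.pullback]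
  refine (Finset.sum_of_injOn (Fin.castLE h) (Fin.castLE_injective h).injOn (by simp)
    (fun k _ hk => ?_) (fun i _ => ?_)).symm
  · rw [logForm_of_le, zero_mul]
    by_contra hlt
    exact hk ⟨⟨k, not_le.1 hlt⟩, by simp, rfl⟩
  · rw [logForm_castLE, pd_eq_partialD hΨ]

end LogForm

/-- The logarithmic derivatives of a monomial times a unit. -/
theorem coord_mul_pd_monomial {g u : CSpace 2 → ℂ} {a m : ℕ} (hu : AnalyticAt ℂ u 0)
    (hu0 : u 0 ≠ 0) (hg : ∀ᶠ z in 𝓝 0, g z = z 0 ^ a * z 1 ^ m * u z) :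
    ∀ᶠ z in 𝓝 0, z 0 * pd 0 g z = g z * (a + z 0 * (pd 0 u z / u z)) ∧
      z 1 * pd 1 g z = g z * (m + z 1 * (pd 1 u z / u z)) := by
  filter_upwards [hg, EventuallyEq.pd hg 0, EventuallyEq.pd hg 1, hu.eventually_analyticAt,
    hu.continuousAt.eventually_ne hu0] with z e1 e2 e3 e4 e5
  have h0 := (analyticAt_coord (n := 2) 0 z)
  have h1 := (analyticAt_coord (n := 2) 1 z)
  have hpow : ∀ (i : Fin 2) (k : ℕ), z i * (k * z i ^ (k - 1)) = k * z i ^ k := by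
    intro i k
    cases k with
    | zero => simp
    | succ k => simp [pow_succ]; ring
  have hmul : ∀ j : Fin 2, pd j g z = pd j (fun z : CSpace 2 => z 0 ^ a) z * z 1 ^ m * u z +
      z 0 ^ a * pd j (fun z : CSpace 2 => z 1 ^ m) z * u z + z 0 ^ a * z 1 ^ m * pd j u z := by
    intro j
    have : pd j g z = pd j (fun z => z 0 ^ a * z 1 ^ m * u z) z := by
      fin_cases j
      · exact e2
      · exact e3
    rw [this, pd_mul j ((h0.fun_pow a).fun_mul (h1.fun_pow m)).differentiableAt
      e4.differentiableAt, pd_mul j (h0.fun_pow a).differentiableAt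
      (h1.fun_pow m).differentiableAt]
    ring
  constructor
  · rw [hmul, e1, pd_coord_pow, pd_coord_pow]
    simp only [if_true, one_ne_zero, if_false]
    field_simp
    linear_combination (z 1 ^ m * u z) * hpow 0 a
  · rw [hmul, e1, pd_coord_pow, pd_coord_pow]
    simp only [if_true, zero_ne_one, if_false]
    field_simp
    linear_combination (z 0 ^ a * u z) * hpow 1 m

/-! ### Simple complex hyperbolic points are not tangent to saddle-nodes -/

/-- If the germ of `η` is a multiple of `dx` along `x = 0` in the strong sense `B = x^p E A`,
then so are its transforms, with growing exponents. -/
theorem IsTower.exists_eq_pow_mul {c : ℕ → ℂ} {η : ℕ → OneForm 2} (ht : IsTower c η) {t p : ℕ}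
    {E : CSpace 2 → ℂ} (hE : AnalyticAt ℂ E 0)
    (h : ∀ᶠ z in 𝓝 0, η t z 1 = z 0 ^ p * E z * η t z 0) (K : ℕ) :
    ∃ E' : CSpace 2 → ℂ, AnalyticAt ℂ E' 0 ∧
      ∀ᶠ z in 𝓝 0, η (t + K) z 1 = z 0 ^ (p + K) * E' z * η (t + K) z 0 := by
  induction K with
  | zero => exact ⟨E, hE, h⟩
  | succ K ih =>
    obtain ⟨E, hE, h⟩ := ih
    set s := t + K
    have h0 := analyticAt_coord (n := 2) 0 0
    have h1 := analyticAt_coord (n := 2) 1 0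
    -- The relation gives `x A' = (A ∘ dirBlowUp) w` with `w` a unit, whereas `B' = B ∘ dirBlowUp`.
    -- Eliminating `A ∘ dirBlowUp` yields one more power of `x` and the cofactor divided by `w`.
    set w : CSpace 2 → ℂ := fun z => 1 + z 0 ^ (p + K) * E (dirBlowUp (c s) z) *
      (z 1 + 2 * c s * z 0) with hw
    have hEc := hE.comp_dirBlowUp (c s)
    have hwa : AnalyticAt ℂ w 0 := analyticAt_const.add
      (((h0.fun_pow _).mul hEc).mul (h1.add (analyticAt_const.mul h0)))
    have hw0 : w 0 ≠ 0 := by simp [hw]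
    refine ⟨fun z => E (dirBlowUp (c s) z) / w z, hEc.div hwa hw0, ?_⟩
    filter_upwards [(tendsto_dirBlowUp (c s)).eventually h, (ht.isTransform s).coord_zero,
      (ht.isTransform s).coord_one (ht.isNormalized s).analyticAt
        (ht.isNormalized _).analyticAt, hwa.continuousAt.eventually_ne hw0] with z e1 e2 e3 e4
    have e5 : z 0 * η (s + 1) z 0 = η s (dirBlowUp (c s) z) 0 * w z := by
      rw [e2, e1, dirBlowUp_apply_zero]
      simp only [hw]; ring
    have e6 : η (t + (K + 1)) z 1 = z 0 ^ (p + K) * E (dirBlowUp (c s) z) *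
        η s (dirBlowUp (c s) z) 0 := by
      rw [show t + (K + 1) = s + 1 by rfl, e3, e1, dirBlowUp_apply_zero]
    have e7 : η s (dirBlowUp (c s) z) 0 = z 0 * η (s + 1) z 0 / w z := by
      rw [e5]; field_simp
    rw [e6, e7, show t + (K + 1) = s + 1 by rfl]
    ring

/-- The power of `x` dividing `B` would grow with the level, yet `B`, being only composed with the
blow-ups, stabilizes as `x^k` times a unit. -/
theorem IsTower.not_eq_mul {c : ℕ → ℂ} {η : ℕ → OneForm 2} (ht : IsTower c η)
    (hB : BecomesPower c 0 fun z => η 0 z 1) {t : ℕ} {E : CSpace 2 → ℂ}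
    (hE : AnalyticAt ℂ E 0) (h : ∀ᶠ z in 𝓝 0, η t z 1 = z 0 * E z * η t z 0) : False := by
  obtain ⟨N, k, u, hu, hu0, hBu⟩ := hB
  -- Climbing `N + k` levels above `t` reaches the exponent `1 + N + k > k` at a level at least `N`,
  -- where `B` is already `x^k` times a unit.
  obtain ⟨E', hE', h'⟩ := ht.exists_eq_pow_mul hE (t := t) (p := 1) (by simpa using h)
    (N + k)
  obtain ⟨v, hv, hv0, hBv⟩ := isResolving_monomial (f := fun z => η 0 z 1) (c := c) (s := 0)
    (N := N) (k := k) (m := 0) hu hu0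
    (hBu.mono fun z hz => by simpa using hz) (Or.inl rfl) (t + k)
  have hη := (ht.isNormalized (t + (N + k))).analyticAt
  have h1 := ht.coord_one 0 (N + (t + k))
  rw [show 0 + (N + (t + k)) = t + (N + k) by ring] at h1
  have h2 : (fun z => v z) =ᶠ[𝓝 0]
      fun z => z 0 ^ (1 + N) * E' z * η (t + (N + k)) z 0 := by
    refine AnalyticAt.eventually_eq_of_mul_eq ((analyticAt_coord 0 0).fun_pow k) hv
      ((((analyticAt_coord 0 0).fun_pow _).mul hE').mul (hη.coord 0))
      (not_eventually_pow_eq_zero 0 k) ?_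
    filter_upwards [h', h1, hBv] with z e1 e2 e3
    rw [e1, e3] at e2
    simp only [mul_zero, add_zero, pow_zero, mul_one] at e2
    rw [← e2]; ring
  refine hv0 (h2.self_of_nhds.trans ?_)
  simp

/-- A normalized form `A dx + B dy` cannot satisfy `x A V = y B U` with `V` a unit. -/
theorem OneForm.IsNormalized.not_saddle {η : OneForm 2} (hη : η.IsNormalized)
    {X Y : CSpace 2 → ℂ} (hX : AnalyticAt ℂ X 0) (hY : AnalyticAt ℂ Y 0) (hY0 : Y 0 ≠ 0)
    (h : ∀ᶠ z in 𝓝 0, z 0 * η z 0 * Y z = z 1 * η z 1 * X z) : False := by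
  -- On the diagonal the factors `x` and `y` agree and cancel. The first-order terms of what remains
  -- give `a Y(0) = 0`, as `B` has no linear part.
  have hid : AnalyticAt ℂ (fun t : ℂ => t) 0 := analyticAt_id
  have ht := tendsto_graph hid rfl
  have hA := (hη.analyticAt.coord 0).comp_graph hid rfl
  have hB := (hη.analyticAt.coord 1).comp_graph hid rfl
  have hXg := hX.comp_graph hid rfl
  have hYg := hY.comp_graph hid rfl
  have h1 : (fun t : ℂ => η ![t, t] 0 * Y ![t, t]) =ᶠ[𝓝 0]
      fun t => η ![t, t] 1 * X ![t, t] := by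
    refine AnalyticAt.eventually_eq_of_mul_eq hid (hA.mul hYg) (hB.mul hXg) (fun h0 => ?_) ?_
    · have h3 : ∀ᶠ t : ℂ in 𝓝[≠] 0, t = 0 := h0.filter_mono nhdsWithin_le_nhds
      obtain ⟨t, e1, e2⟩ := (h3.and eventually_mem_nhdsWithin).exists
      exact e2 e1
    · filter_upwards [ht.eventually h] with t e1
      simp only [Matrix.cons_val_zero, Matrix.cons_val_one, Matrix.cons_val_fin_one] at e1
      linear_combination e1
  have hd : ∀ i, HasDerivAt (fun t : ℂ => η ![t, t] i)
      (pd 0 (fun z => η z i) 0 + pd 1 (fun z => η z i) 0) 0 := by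
    intro i
    have e1 := hasDerivAt_comp_curve (f := fun z => η z i)
      (γ := fun t : ℂ => (![t, t] : CSpace 2)) (t := 0)
      (by simpa [vec2_zero] using (hη.analyticAt.coord i).differentiableAt)
      (hasDerivAt_vec2 (hasDerivAt_id _) (hasDerivAt_id _))
    simpa [Fin.sum_univ_two, vec2_zero] using e1
  have e1 := (hd 0).mul hYg.differentiableAt.hasDerivAt
  have e2 := (hd 1).mul hXg.differentiableAt.hasDerivAt
  have e3 := HasDerivAt.unique (e1.congr_of_eventuallyEq h1.symm) e2
  simp only [vec2_zero, hη.zero, hη.pd_zero_zero, hη.pd_zero_one, hη.pd_one_one] at e3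
  simp only [Pi.zero_apply, zero_mul, add_zero, zero_add, mul_eq_zero] at e3
  exact e3.elim hη.pd_one_zero hY0

theorem IsResolving.eventually_monomial {c : ℕ → ℂ} (hc : IsResolving c) (s : ℕ)
    {f : CSpace 2 → ℂ} (hf : AnalyticAt ℂ f 0) (hf0 : f 0 = 0)
    (hne : ¬ ∀ᶠ z in 𝓝 (0 : CSpace 2), f z = 0) :
    ∀ᶠ K in atTop, ∃ (a m : ℕ) (u : CSpace 2 → ℂ), 1 ≤ a ∧ AnalyticAt ℂ u 0 ∧ u 0 ≠ 0 ∧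
      ∀ᶠ z in 𝓝 0, f (iterBlowUp c s K z) = z 0 ^ a * z 1 ^ m * u z := by
  obtain ⟨N, k, m, u, hu, hu0, hfu, hm⟩ := hc s f hf hne
  have hkm : 1 ≤ k + m := by
    by_contra hlt
    have hk : k = 0 := by omega
    have hm : m = 0 := by omega
    subst hk hm
    have := hfu.self_of_nhds
    simp only [iterBlowUp_zero, hf0, pow_zero, one_mul] at this
    exact hu0 this.symm
  -- One blow-up beyond `N` transfers any power of `y` to `x`, so `1 ≤ k + m` becomes an
  -- `x`-exponent at least one.
  filter_upwards [eventually_ge_atTop (N + 1)] with K hK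
  obtain ⟨d, rfl⟩ := Nat.exists_eq_add_of_le hK
  obtain ⟨v, hv, hv0, hfv⟩ := isResolving_monomial hu hu0 hfu hm (1 + d)
  rw [show N + (1 + d) = N + 1 + d by ring] at hfv
  exact ⟨_, m, v, by nlinarith, hv, hv0, hfv⟩

theorem not_eventually_prod_eq_zero {ι : Type*} (S : Finset ι) {g : ι → CSpace 2 → ℂ}
    (hg : ∀ i, AnalyticAt ℂ (g i) 0) (h : ∀ i, ¬ ∀ᶠ z in 𝓝 (0 : CSpace 2), g i z = 0) :
    ¬ ∀ᶠ z in 𝓝 (0 : CSpace 2), ∏ i ∈ S, g i z = 0 := by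
  induction S using Finset.cons_induction with
  | empty => exact fun h0 => by simpa using h0.self_of_nhds
  | cons a S ha ih =>
    intro h0
    simp only [Finset.prod_cons] at h0
    rcases AnalyticAt.eventually_eq_zero_or_of_mul (hg a)
      (Finset.analyticAt_fun_prod _ fun j _ => hg j) h0 with h1 | h1
    · exact h a h1
    · exact ih h1

/-- The pull-back of a simple complex hyperbolic point, by a map whose components along the
divisor are monomials times units, is not a saddle-node. -/
theorem IsTower.not_isProportional_logForm {c : ℕ → ℂ} {η : ℕ → OneForm 2} (ht : IsTower c η)
    (hB : BecomesPower c 0 fun z => η 0 z 1) {t n τ : ℕ} (h : τ ≤ n) (hτ : 1 ≤ τ)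
    {lam : Fin τ → ℂ} {b : Fin τ → CSpace τ → ℂ} (hb : ∀ i, AnalyticAt ℂ (b i) 0)
    (hb0 : ∀ i, b i 0 = 0) (hlam : IsNonResonant lam) {Ψ : CSpace 2 → CSpace n}
    (hΨ : AnalyticAt ℂ Ψ 0) (hΨ0 : Ψ 0 = 0)
    (hmon : ∀ i : Fin τ, ∃ (a m : ℕ) (u : CSpace 2 → ℂ), 1 ≤ a ∧ AnalyticAt ℂ u 0 ∧ u 0 ≠ 0 ∧
      ∀ᶠ z in 𝓝 0, Ψ z (Fin.castLE h i) = z 0 ^ a * z 1 ^ m * u z)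
    (hprop : (η t).IsProportional ((logForm h lam b).pullback Ψ)) : False := by
  choose a m u ha hu hu0 hmu using hmon
  have hη := ht.isNormalized t
  have hx := analyticAt_coord (n := 2) 0 0
  have hy := analyticAt_coord (n := 2) 1 0
  set g : Fin τ → CSpace 2 → ℂ := fun i z => Ψ z (Fin.castLE h i) with hg
  have hga : ∀ i, AnalyticAt ℂ (g i) 0 := fun i => hΨ.coord _
  have hgne : ∀ i, ¬ ∀ᶠ z in 𝓝 (0 : CSpace 2), g i z = 0 := fun i h0 =>
    not_eventually_monomial_eq_zero (k := a i) (m := m i) (hu i) (hu0 i) (by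
      filter_upwards [hmu i, h0] with z e1 e2
      rw [← e1]; exact e2)
  set W : Fin τ → CSpace 2 → ℂ := fun i z => lam i + b i (fun q => g q z) with hW
  have hWa : ∀ i, AnalyticAt ℂ (W i) 0 := fun i => analyticAt_const.add
    (AnalyticAt.comp (g := b i) (f := fun z q => g q z)
      (by
        have : (fun q => g q 0) = 0 := by funext q; simp [hg, hΨ0]
        rw [this]; exact hb i)
      (analyticAt_pi_iff.2 hga))
  have hW0 : ∀ i, W i 0 = lam i := by
    intro i
    have : (fun q => g q 0) = 0 := by funext q; simp [hg, hΨ0]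
    simp only [hW, this, hb0, add_zero]
  set r : Fin 2 → Fin τ → CSpace 2 → ℂ := fun j i z => pd j (u i) z / u i z with hr
  have hra : ∀ j i, AnalyticAt ℂ (r j i) 0 := fun j i => ((hu i).pd j).div (hu i) (hu0 i)
  -- The germs `Ux` and `Vy` are the coefficients of `dx/x` and `dy/y` in the pull-back of `∑ (λᵢ +
  -- bᵢ) dxᵢ/xᵢ`; at the origin they equal `∑ aᵢ λᵢ` and `∑ mᵢ λᵢ`.
  set Ux : CSpace 2 → ℂ := fun z => ∑ i, W i z * (a i + z 0 * r 0 i z) with hUx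
  set Vy : CSpace 2 → ℂ := fun z => ∑ i, W i z * (m i + z 1 * r 1 i z) with hVy
  have hUa : AnalyticAt ℂ Ux 0 := Finset.analyticAt_fun_sum _ fun i _ =>
    (hWa i).mul (analyticAt_const.add (hx.mul (hra 0 i)))
  have hVa : AnalyticAt ℂ Vy 0 := Finset.analyticAt_fun_sum _ fun i _ =>
    (hWa i).mul (analyticAt_const.add (hy.mul (hra 1 i)))
  have hU0 : Ux 0 ≠ 0 := by
    have e : Ux 0 = ∑ i, (a i : ℂ) * lam i := by
      simp only [hUx, hW0, Pi.zero_apply, zero_mul, add_zero]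
      exact Finset.sum_congr rfl fun i _ => mul_comm _ _
    rw [e]
    refine hlam a fun h0 => ?_
    have h1 := ha ⟨0, hτ⟩
    rw [h0] at h1
    simp at h1
  set G : CSpace 2 → ℂ := fun z => ∏ i, g i z with hG
  have hGa : AnalyticAt ℂ G 0 := Finset.analyticAt_fun_prod _ fun i _ => hga i
  have hGne : ¬ ∀ᶠ z in 𝓝 (0 : CSpace 2), G z = 0 := not_eventually_prod_eq_zero _ hga hgne
  have hl : ∀ᶠ z in 𝓝 0, z 0 * (logForm h lam b).pullback Ψ z 0 = G z * Ux z ∧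
      z 1 * (logForm h lam b).pullback Ψ z 1 = G z * Vy z := by
    filter_upwards [hΨ.eventually_analyticAt, eventually_all.2 fun i =>
      coord_mul_pd_monomial (g := g i) (hu i) (hu0 i) (hmu i)] with z e1 e2
    have hprod : ∀ i, G z = (∏ q ∈ Finset.univ.erase i, g q z) * g i z := fun i =>
      (Finset.prod_erase_mul _ _ (Finset.mem_univ i)).symm
    constructor
    · rw [pullback_logForm_apply h e1.differentiableAt, Finset.mul_sum, hUx, Finset.mul_sum]
      refine Finset.sum_congr rfl fun i _ => ?_
      rw [hprod i]
      linear_combination (W i z * ∏ q ∈ Finset.univ.erase i, g q z) * (e2 i).1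
    · rw [pullback_logForm_apply h e1.differentiableAt, Finset.mul_sum, hVy, Finset.mul_sum]
      refine Finset.sum_congr rfl fun i _ => ?_
      rw [hprod i]
      linear_combination (W i z * ∏ q ∈ Finset.univ.erase i, g q z) * (e2 i).2
  have hmain : ∀ᶠ z in 𝓝 0, z 0 * η t z 0 * Vy z = z 1 * η t z 1 * Ux z := by
    refine AnalyticAt.eventually_eq_of_mul_eq hGa
      ((hx.mul (hη.analyticAt.coord 0)).mul hVa) ((hy.mul (hη.analyticAt.coord 1)).mul hUa)
      hGne ?_
    filter_upwards [hl, hprop] with z e1 e2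
    have e3 := e2 0 1
    linear_combination (-(z 0 * η t z 0)) * e1.2 + (z 1 * η t z 1) * e1.1 + (z 0 * z 1) * e3
  -- If all `mᵢ` vanish, `Vy` is divisible by `y`, which cancels to give `B = x E A`. Otherwise
  -- non-resonance makes `Vy` a unit.
  by_cases hm : m = 0
  · have hV1 : AnalyticAt ℂ (fun z => ∑ i, W i z * r 1 i z) 0 :=
      Finset.analyticAt_fun_sum _ fun i _ => (hWa i).mul (hra 1 i)
    have hVy' : ∀ z, Vy z = z 1 * ∑ i, W i z * r 1 i z := by
      intro z
      simp only [hVy, hm, Pi.zero_apply, Nat.cast_zero, zero_add, Finset.mul_sum]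
      exact Finset.sum_congr rfl fun i _ => by ring
    have h1 : ∀ᶠ z in 𝓝 0, z 0 * η t z 0 * (∑ i, W i z * r 1 i z) = η t z 1 * Ux z := by
      refine AnalyticAt.eventually_eq_of_mul_eq hy ((hx.mul (hη.analyticAt.coord 0)).mul hV1)
        ((hη.analyticAt.coord 1).mul hUa) (not_eventually_coord_eq_zero 1) ?_
      filter_upwards [hmain] with z e1
      rw [hVy'] at e1
      linear_combination e1
    refine ht.not_eq_mul hB (t := t) (hV1.div hUa hU0) ?_
    filter_upwards [h1, hUa.continuousAt.eventually_ne hU0] with z e1 e2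
    simp only [Pi.div_apply]
    field_simp
    linear_combination -e1
  · refine hη.not_saddle hUa hVa ?_ hmain
    have e : Vy 0 = ∑ i, (m i : ℂ) * lam i := by
      simp only [hVy, hW0, Pi.zero_apply, zero_mul, add_zero]
      exact Finset.sum_congr rfl fun i _ => mul_comm _ _
    rw [e]
    exact hlam m hm

/-! ### Lifting to a simple complex hyperbolic point and conclusion -/

/-- A foliation with a resolution by simple complex hyperbolic points does not become a saddle-node
by pull-back. -/
theorem FoliationGerm.not_isProportional_tower {n : ℕ} (F : FoliationGerm n)
    {U : TopologicalSpace.Opens (CSpace n)} (hU : (0 : CSpace n) ∈ U) {M : CMfd n}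
    {π : M → CSpace n} (hπ : IsNonsingularBlowUpComposition U M π)
    (hsimple : ∀ p : M, π p = 0 → F.IsSimpleCHPoint π p) {c : ℕ → ℂ} {η : ℕ → OneForm 2}
    (ht : IsTower c η) (hc : IsResolving c) (hB : BecomesPower c 0 fun z => η 0 z 1)
    {ψ : CSpace 2 → CSpace n} (hψ : AnalyticAt ℂ ψ 0) (hψ0 : ψ 0 = 0)
    (hne : ¬ (F.form.pullback ψ).IsZeroGerm)
    (hprop : (F.form.pullback ψ).IsProportional (η 0)) : False := by
  obtain ⟨N, p, e, u, he, hp, hπp, hu, hu0, hlift⟩ := hπ.exists_lift hU hc hψ hψ0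
  obtain ⟨e', he', hp', he'p, τ, hτn, lam, b, hτ, hb, hb0, hlam, -, -, hθlog⟩ := hsimple p hπp
  have hF : ∀ x : CSpace n, x = 0 → AnalyticAt ℂ F.form x := fun x hx => hx ▸ F.analyticAt
  have hπa : AnalyticAt ℂ (π ∘ e'.symm) 0 := he'p ▸ hπ.analyticAt he' hp'
  have hπ0 : (π ∘ e'.symm) 0 = 0 := by
    have h0 : e'.symm 0 = p := by rw [← he'p, e'.left_inv hp']
    rw [Function.comp_apply, h0, hπp]
  set θ := F.form.pullback (π ∘ e'.symm) with hθ
  have hθa : AnalyticAt ℂ θ 0 := OneForm.analyticAt_pullback (hF _ hπ0) hπa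
  set Ψ : CSpace 2 → CSpace n := fun z => e' (e.symm (u z)) with hΨ
  have hΨa : AnalyticAt ℂ Ψ 0 := by
    refine AnalyticAt.comp (g := e' ∘ e.symm) ?_ hu
    rw [hu0]
    exact CMfd.analyticAt_transition he he' hp hp'
  have hΨ0 : Ψ 0 = 0 := by simp only [hΨ, hu0, e.left_inv hp, he'p]
  set ι := iterBlowUp c 0 N with hι
  have hιa : AnalyticAt ℂ ι 0 := analyticAt_iterBlowUp _ _ _ _
  have hι0 : ι 0 = 0 := iterBlowUp_zero _ _ _
  have hcomp : (π ∘ e'.symm) ∘ Ψ =ᶠ[𝓝 0] ψ ∘ ι := by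
    have hsm : ∀ᶠ z in 𝓝 0, e.symm (u z) ∈ e'.source := by
      have h2 := e.eventually_symm_mem hp e'.open_source hp'
      rw [← hu0] at h2
      exact (hu.continuousAt.eventually h2).mono fun z hz => hz.2
    filter_upwards [hlift, hsm] with z e1 e2
    simp only [Function.comp_apply, hΨ, e'.left_inv e2, e1, hι]
  have hψa : AnalyticAt ℂ (F.form.pullback ψ) 0 :=
    OneForm.analyticAt_pullback (hF _ hψ0) hψ
  have hρ : θ.pullback Ψ =ᶠ[𝓝 0] (F.form.pullback ψ).pullback ι :=
    ((F.form.pullback_pullback (a := 0) (by rw [hΨ0]; exact hπa) hΨa).trans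
      (F.form.pullback_congr hcomp)).trans
      (F.form.pullback_pullback (a := 0) (by rw [hι0]; exact hψ) hιa).symm
  have hρne : ¬ (θ.pullback Ψ).IsZeroGerm := fun h0 =>
    hne (hc.isZeroGerm_of_pullback N hψa (by
      filter_upwards [h0, hρ] with z e1 e2
      rw [← e2, e1]))
  have hρη : (θ.pullback Ψ).IsProportional (η (0 + N)) := by
    filter_upwards [hρ, ht.isProportional_pullback N hψa hprop] with z e1 e2
    rw [e1]; exact e2
  have hΨt : Tendsto Ψ (𝓝 0) (𝓝 0) := by simpa [hΨ0] using hΨa.continuousAt.tendsto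
  set L := (logForm hτn lam b).pullback Ψ with hL
  have hlogL : ∀ x : CSpace n, x = 0 → AnalyticAt ℂ (logForm hτn lam b) x := fun x hx =>
    hx ▸ analyticAt_logForm hτn hb
  have hLa : AnalyticAt ℂ L 0 := OneForm.analyticAt_pullback (hlogL _ hΨ0) hΨa
  have hρL : (θ.pullback Ψ).IsProportional L := by
    filter_upwards [hΨt.eventually hθlog] with z e1
    exact OneForm.pullback_wedge e1
  have hLη : L.IsProportional (η (0 + N)) :=
    OneForm.wedge_trans (OneForm.analyticAt_pullback (by rw [hΨ0]; exact hθa) hΨa) hLa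
      (ht.isNormalized _).analyticAt hρne hρL hρη
  have hΨne := OneForm.not_eventually_coord_eq_zero_of_pullback hτn hθa hb hb0 hlam hθlog hΨa hΨ0
    hρne
  -- Each component along the divisor is a monomial times a unit from some level on, so one `K`
  -- serves all of the finitely many components.
  obtain ⟨K, hK⟩ := (eventually_all.2 fun i : Fin τ => hc.eventually_monomial (0 + N)
    (hΨa.coord (Fin.castLE hτn i)) (by simp [hΨ0]) (hΨne i)).exists
  set κ := iterBlowUp c (0 + N) K with hκ
  have hκ0 : κ 0 = 0 := iterBlowUp_zero _ _ _
  have hLκ := ht.isProportional_pullback K hLa hLη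
  have hLκ' := (logForm hτn lam b).pullback_pullback (a := 0) (φ := Ψ) (χ := κ)
    (by rw [hκ0]; exact hΨa) (analyticAt_iterBlowUp _ _ _ _)
  refine ht.not_isProportional_logForm hB (t := 0 + N + K) hτn hτ hb hb0 hlam (Ψ := Ψ ∘ κ)
    (hΨa.comp_iterBlowUp c (0 + N) K) (by simp [hκ0, hΨ0]) hK ?_
  filter_upwards [hLκ, hLκ'] with z e1 e2 i j
  rw [← e2]
  have := e1 i j
  linear_combination -this

theorem proposition2 {n : ℕ} (F : FoliationGerm n)
    (U : TopologicalSpace.Opens (CSpace n)) (hU : (0 : CSpace n) ∈ U)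
    (M : CMfd n) (π : M → CSpace n) (hπ : IsNonsingularBlowUpComposition U M π)
    (hsimple : ∀ p : M, π p = 0 → F.IsSimpleCHPoint π p) :
    F.IsCHFoliation := by
  intro φ hφ hφ0 _ V Δ σ ⟨_, hσ, _⟩ q hq hsn
  obtain ⟨e, he, hqe, heq, β, ⟨η, ⟨hη, hηsat, hθne, -, hθη⟩, hη0, hchar⟩, hβ⟩ := hsn
  have hσa : AnalyticAt ℂ (σ ∘ e.symm) 0 := heq ▸ hσ.analyticAt he hqe
  have hσ0 : (σ ∘ e.symm) 0 = 0 := by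
    have h0 : e.symm 0 = q := by rw [← heq, e.left_inv hqe]
    rw [Function.comp_apply, h0, hq]
  set ψ := φ ∘ σ ∘ e.symm with hψ
  have hφσ : AnalyticAt ℂ φ ((σ ∘ e.symm) 0) := by rw [hσ0]; exact hφ
  have hψa : AnalyticAt ℂ ψ 0 := hφσ.comp hσa
  have hψ0 : ψ 0 = 0 := by rw [hψ, Function.comp_apply, hσ0, hφ0]
  have hpp := F.form.pullback_pullback (a := 0) hφσ hσa
  have hFψ : AnalyticAt ℂ (F.form.pullback ψ) 0 :=
    OneForm.analyticAt_pullback (hψ0 ▸ F.analyticAt) hψa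
  have hψne : ¬ (F.form.pullback ψ).IsZeroGerm := fun h0 => hθne (by
    filter_upwards [h0, hpp] with z e1 e2
    rw [e2, e1])
  have hψη : (F.form.pullback ψ).IsProportional η := by
    filter_upwards [hθη, hpp] with z e1 e2
    rw [← e2]; exact e1
  -- The first change of coordinates is linear; the second straightens the weak separatrix when it
  -- converges. Both are absorbed into the map to `ℂⁿ`.
  obtain ⟨Φ₁, Ξ₁, hΦ₁, hnorm⟩ := OneForm.exists_isNormalized hη hη0 hβ hchar
  obtain ⟨Φ₂, Ξ₂, c, η', hΦ₂, ht, hη'0, hc, hB⟩ :=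
    hnorm.exists_resolving_tower (hΦ₁.isSaturated hηsat)
  have hΦ := hΦ₁.comp hΦ₂
  have h0 : η' 0 =ᶠ[𝓝 0] η.pullback (Φ₁ ∘ Φ₂) := by
    rw [hη'0]
    exact η.pullback_pullback (by rw [hΦ₂.zero]; exact hΦ₁.analyticAt) hΦ₂.analyticAt
  have hψΦ := F.form.pullback_pullback (φ := ψ) (χ := Φ₁ ∘ Φ₂) (a := 0)
    (by rw [hΦ.zero]; exact hψa) hΦ.analyticAt
  have hΦt : Tendsto (Φ₁ ∘ Φ₂) (𝓝 0) (𝓝 0) := by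
    have h := hΦ.analyticAt.continuousAt.tendsto
    rwa [hΦ.zero] at h
  refine F.not_isProportional_tower hU hπ hsimple ht hc hB (ψ := ψ ∘ Φ₁ ∘ Φ₂)
    (AnalyticAt.comp (by rw [hΦ.zero]; exact hψa) hΦ.analyticAt)
    (by rw [Function.comp_apply, hΦ.zero, hψ0]) (fun hz => hψne (hΦ.isZeroGerm ?_)) ?_
  · filter_upwards [hz, hψΦ] with z e1 e2
    rw [e2, e1]
  · filter_upwards [hψΦ, h0, hΦt.eventually hψη] with z e1 e2 e3
    rw [← e1, e2]
    exact OneForm.pullback_wedge e3
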